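/- \textbf{Setting.} Let $N$ be a Poisson process with rate $\lambda>0$ on a probability space $(\Omega,\mathcal A,\mathbb P)$, let $U_1,U_2,\dots$ be non-negative i.i.d. random variables independent of $N$, and put $S(t)=\sum_{n=1}^{N(t)}U_n$. Let $c_1,c_2>0$, $b_1,b_2>0$ with $b_1+b_2=1$, and $q>0$. For $\mathbf x=(x_1,x_2)\in\mathbb R^2$ let $X_i(t)=x_i+c_it-b_iS(t)$, $i=1,2$, and let $\mathbb F$ be the natural filtration of $\mathbf X=(X_1,X_2)$. The solvency set is $\mathcal S=\mathbb R^2\setminus(-\infty,0)^2$. For a process $\mathbf L=(L_1,L_2)$ put $\mathbf X^{\mathbf L}=\mathbf X-\mathbf L$ and $\tau^{\mathbf L}=\inf\{t>0: X_1^{\mathbf L}(t)<0\text{ and }X_2^{\mathbf L}(t)<0\}$, where $\inf\emptyset=\infty$. For $\mathbf x\in\mathcal S$ let $\Pi_{\mathbf x}$ be the set of admissible dividend strategies, i.e. of the $\mathbb F$-predictable processes $\mathbf L$ with values in $\mathbb R^2$ such that, almost surely, for $i=1,2$: $L_i$ is non-decreasing and c\`agl\`ad with $L_i(0)=0$; for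 every $t\ge0$ with $X_i(t)<L_i(t)$, $L_i$ is constant on $[t,t+\delta]$ for some $\delta>0$; for every $t\ge 0$ with $X_i(t)\ge L_i(t)$, one has $X_i(s)\ge L_i(s)$ for all $s\in[t,t+\delta]$ for some $\delta>0$; and $L_i(t)=L_i(\tau^{\mathbf L})$ for all $t\ge\tau^{\mathbf L}$. Define $$V(\mathbf x)=\sup_{\mathbf L\in\Pi_{\mathbf x}}\mathbb E\Big[\int_0^{\tau^{\mathbf L}}e^{-qs}\,dL_1(s)+\int_0^{\tau^{\mathbf L}}e^{-qs}\,dL_2(s)\Big]\quad(\mathbf x\in\mathcal S),\qquad V(\mathbf x)=0\quad(\mathbf x\in(-\infty,0)^2),$$ where $\int_0^T$ denotes the Lebesgue--Stieltjes integral over $[0,T)$, so that a lump sum $L_i(0+)-L_i(0)$ paid at time $0$ is included and a lump sum $L_i(T+)-L_i(T)$ paid at time $T$ is not. \textbf{Proposition (Dynamic Programming Principle).} For every $\mathbf x\in\mathcal S$ and every $\mathbb F$-stopping time $\tau$ with values in $[0,\infty]$, $V(\mathbf x)$ is finite and $$V(\mathbf x)=\sup_{\mathbf L\in\Pi_{\mathbf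 x}}\mathbb E\Big[\int_0^{\tau\wedge\tau^{\mathbf L}}e^{-qs}\,dL_1(s)+\int_0^{\tau\wedge\tau^{\mathbf L}}e^{-qs}\,dL_2(s)+e^{-q(\tau\wedge\tau^{\mathbf L})}\,V\big(\mathbf X^{\mathbf L}(\tau\wedge\tau^{\mathbf L})\big)\Big],$$ where the last term is read as $0$ where $\tau\wedge\tau^{\mathbf L}=\infty$. -/

import Mathlib

open MeasureTheory ProbabilityTheory Filter Set
open scoped NNReal ENNReal Topology

noncomputable section

/-- `N` is a Poisson process with rate `rate`: a counting process (sample paths with values in `ℕ`,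
started at `0`, nondecreasing and right-continuous) whose increments are independent and
Poisson distributed with parameter `rate * (t - s)`. -/
structure IsPoissonProcess {Ω : Type*} [MeasurableSpace Ω] (N : ℝ≥0 → Ω → ℕ) (rate : ℝ≥0)
    (P : Measure Ω) : Prop where
  measurable : ∀ t, Measurable (N t)
  zero : ∀ ω, N 0 ω = 0
  mono : ∀ ω, Monotone fun t => N t ω
  rightCts : ∀ ω t, ContinuousWithinAt (fun s => N s ω) (Ici t) t
  indep : HasIndepIncrements N P
  law : ∀ s t : ℝ≥0, s ≤ t →
    P.map (fun ω => N t ω - N s ω) = poissonMeasure (rate * (t - s))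

/-- The data of the degenerate bivariate risk model (the two branches are indexed by `Fin 2`):
premium rates `c`, proportions `b`, discount rate `q`, claim arrival process `N`
with rate `rate`, and claim sizes `U n`. -/
structure DegenerateRiskModel (Ω : Type*) [MeasurableSpace Ω] (P : Measure Ω) where
  c : Fin 2 → ℝ
  b : Fin 2 → ℝ
  q : ℝ
  rate : ℝ≥0
  N : ℝ≥0 → Ω → ℕ
  U : ℕ → Ω → ℝ
  c_pos : ∀ i, 0 < c i
  b_pos : ∀ i, 0 < b i
  b_sum : b 0 + b 1 = 1
  q_pos : 0 < q
  rate_pos : 0 < rate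
  poisson : IsPoissonProcess N rate P
  U_measurable : ∀ n, Measurable (U n)
  U_nonneg : ∀ n ω, 0 ≤ U n ω
  U_indep : iIndepFun U P
  U_ident : ∀ n, IdentDistrib (U n) (U 0) P P
  U_indep_N : IndepFun (fun ω n => U n ω) (fun ω t => N t ω) P

/-- The solvency set: the plane without the open negative quadrant. -/
def solvencySet : Set (Fin 2 → ℝ) := {x | ¬ ∀ i, x i < 0}

/-- Left-continuous with (finite) right limits. -/
def IsCaglad (f : ℝ≥0 → ℝ) : Prop :=
  ∀ t, ContinuousWithinAt f (Iio t) t ∧ ∃ l, Tendsto f (𝓝[>] t) (𝓝 l)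

open Classical in
/-- The Lebesgue–Stieltjes measure `dℓ` on `ℝ` of a nondecreasing path `ℓ` on `[0, ∞)`, extended to
negative times by the constant `ℓ 0`. If `ℓ` is left-continuous, then `[a, b)` has mass
`ℓ b - ℓ a` for `0 ≤ a ≤ b`; in particular `{0}` has mass `ℓ (0+) - ℓ 0`.
(The value for a path that is not monotone is irrelevant.) -/
def pathMeasure (ℓ : ℝ≥0 → ℝ) : Measure ℝ :=
  if h : Monotone (fun s : ℝ => ℓ s.toNNReal) then h.stieltjesFunction.measure else 0

/-- `∫_{[0, T)} e^{-q s} dℓ(s)`, where `T = ⊤` stands for `T = ∞`. Since `ℓ` is left-continuous,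
`ℓ t` does not contain a lump sum paid at time `t`, and the integral up to `T` does not contain
a lump sum paid at time `T` either. -/
def discountedIntegral (q : ℝ) (ℓ : ℝ≥0 → ℝ) (T : WithTop ℝ≥0) : ℝ≥0∞ :=
  ∫⁻ s in {s : ℝ | 0 ≤ s ∧ (s.toNNReal : WithTop ℝ≥0) < T},
    ENNReal.ofReal (Real.exp (-q * s)) ∂(pathMeasure ℓ)

namespace DegenerateRiskModel

variable {Ω : Type*} [MeasurableSpace Ω] {P : Measure Ω}

/-- The aggregate claim process `S(t) = ∑_{n ≤ N(t)} U_n`. -/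
def claims (M : DegenerateRiskModel Ω P) (t : ℝ≥0) (ω : Ω) : ℝ :=
  ∑ n ∈ Finset.range (M.N t ω), M.U n ω

/-- The uncontrolled surplus `X(t) = x + c t - b S(t)` started at `x`. -/
def surplus (M : DegenerateRiskModel Ω P) (x : Fin 2 → ℝ) (t : ℝ≥0) (ω : Ω) : Fin 2 → ℝ :=
  fun i => x i + M.c i * t - M.b i * M.claims t ω

theorem measurable_claims (M : DegenerateRiskModel Ω P) (t : ℝ≥0) : Measurable (M.claims t) := by
  have h : Measurable (fun p : ℕ × Ω => ∑ n ∈ Finset.range p.1, M.U n p.2) :=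
    measurable_from_prod_countable_right fun k =>
      Finset.measurable_sum (Finset.range k) fun n _ => M.U_measurable n
  exact h.comp ((M.poisson.measurable t).prodMk measurable_id)

theorem measurable_surplus (M : DegenerateRiskModel Ω P) (x : Fin 2 → ℝ) (t : ℝ≥0) :
    Measurable (M.surplus x t) :=
  measurable_pi_lambda _ fun _ => ((M.measurable_claims t).const_mul _).const_sub _

/-- The natural filtration of the uncontrolled surplus process. -/
def filtration (M : DegenerateRiskModel Ω P) (x : Fin 2 → ℝ) :
    Filtration ℝ≥0 (inferInstance : MeasurableSpace Ω) :=
  Filtration.natural (M.surplus x) fun t => (M.measurable_surplus x t).stronglyMeasurable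

/-- The controlled surplus `X^L(t) = X(t) - L(t)`. -/
def controlled (M : DegenerateRiskModel Ω P) (x : Fin 2 → ℝ) (L : ℝ≥0 → Ω → Fin 2 → ℝ)
    (t : ℝ≥0) (ω : Ω) : Fin 2 → ℝ :=
  fun i => M.surplus x t ω i - L t ω i

/-- The time of simultaneous ruin, `inf {t > 0 : X₁^L(t) < 0 and X₂^L(t) < 0}`
(with `inf ∅ = ⊤`). -/
def ruinTime (M : DegenerateRiskModel Ω P) (x : Fin 2 → ℝ) (L : ℝ≥0 → Ω → Fin 2 → ℝ)
    (ω : Ω) : WithTop ℝ≥0 :=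
  sInf ((fun t : ℝ≥0 => (t : WithTop ℝ≥0)) '' {t | 0 < t ∧ ∀ i, M.controlled x L t ω i < 0})

/-- Admissible dividend strategies for the initial surplus `x`. As usual, the conditions on the
sample paths are required almost surely. -/
structure IsAdmissible (M : DegenerateRiskModel Ω P) (x : Fin 2 → ℝ)
    (L : ℝ≥0 → Ω → Fin 2 → ℝ) : Prop where
  predictable : IsStronglyPredictable (M.filtration x) L
  mono : ∀ᵐ ω ∂P, ∀ i, Monotone fun t => L t ω i
  caglad : ∀ᵐ ω ∂P, ∀ i, IsCaglad fun t => L t ω i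
  zero : ∀ᵐ ω ∂P, ∀ i, L 0 ω i = 0
  /-- If `X_i(t) < L_i(t)`, then `dL_i(t) = 0`: nothing is paid at, and right after, time `t`. -/
  no_pay : ∀ᵐ ω ∂P, ∀ i t, M.surplus x t ω i < L t ω i → ∀ᶠ s in 𝓝[>] t, L s ω i = L t ω i
  /-- If `X_i(t) ≥ L_i(t)`, then `X_i^L(t) + dX_i(t) ≥ dL_i(t)`: the payments at, and right after,
  time `t` do not make the controlled surplus of the branch negative. -/
  no_ruin_by_pay : ∀ᵐ ω ∂P, ∀ i t, L t ω i ≤ M.surplus x t ω i →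
    ∀ᶠ s in 𝓝[>] t, L s ω i ≤ M.surplus x s ω i
  /-- No dividends are paid from the ruin time on. -/
  stopped : ∀ᵐ ω ∂P, ∀ i (r t : ℝ≥0), M.ruinTime x L ω = r → r ≤ t → L t ω i = L r ω i

/-- The discounted dividends of both branches paid before time `T`,
`∫_0^T e^{-q s} dL₁(s) + ∫_0^T e^{-q s} dL₂(s)`. -/
def dividends (M : DegenerateRiskModel Ω P) (L : ℝ≥0 → Ω → Fin 2 → ℝ) (T : WithTop ℝ≥0)
    (ω : Ω) : ℝ≥0∞ :=
  ∑ i, discountedIntegral M.q (fun t => L t ω i) T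

/-- The value `V^L(x)` of a strategy: its expected discounted dividends up to ruin. -/
def strategyValue (M : DegenerateRiskModel Ω P) (x : Fin 2 → ℝ) (L : ℝ≥0 → Ω → Fin 2 → ℝ) :
    ℝ≥0∞ :=
  ∫⁻ ω, M.dividends L (M.ruinTime x L ω) ω ∂P

open Classical in
/-- The optimal value function `V`: the supremum of `V^L(x)` over all admissible `L` if `x` is in
the solvency set, and zero on the open negative quadrant. -/
def value (M : DegenerateRiskModel Ω P) (x : Fin 2 → ℝ) : ℝ≥0∞ :=
  if x ∈ solvencySet then ⨆ (L) (_ : M.IsAdmissible x L), M.strategyValue x L else 0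

open Classical in
/-- `e^{-q T} V(X^L(T))`, which is zero for `T = ∞`. -/
def discountedValue (M : DegenerateRiskModel Ω P) (x : Fin 2 → ℝ) (L : ℝ≥0 → Ω → Fin 2 → ℝ)
    (T : WithTop ℝ≥0) (ω : Ω) : ℝ≥0∞ :=
  if T = ⊤ then 0
  else ENNReal.ofReal (Real.exp (-M.q * (T.untopD 0 : ℝ≥0))) *
    M.value (M.controlled x L (T.untopD 0) ω)

end DegenerateRiskModel

end

/-! The problem is moved to the space of claim paths, the nondecreasing right-continuous step
functions. Up to a null set, an admissible strategy is a nonanticipating functional of the claim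
path: by the Doob–Dynkin lemma its value at each time of a dense sequence is a function of the
stopped path, and left-continuity determines the rest (`IsAdmissible.exists_rule`). The local
payment rules are equivalent to two conditions on pairs of times (`PathAdmissible`). These reduce to
countably many times, so admissibility of a rule is a measurable event. As payments cease at ruin,
the value of a rule is the expectation of its whole discounted payoff, without reference to the ruin
time.

The probabilistic input is the strong Markov property (`map_past_future`): on `τ < ∞`, the claims
after `τ` are independent of `τ` and the claims up to `τ`, and are distributed as the claim path. It
is proved at fixed times from the independent stationary increments of `N` and the i.i.d. claim
sizes, then at discretized stopping times, and finally by right-continuity of the paths.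

For `≤`, the payoff of a rule splits at `τ` (`ruleValue_split`). Given the past, the continuation is
admissible for the surplus reached, hence worth at most `V` there, and it is worth nothing after
ruin (`ae_continuation`).

For `≥`, nearly optimal continuations must be chosen measurably in the surplus reached. The plane is
cut into countably many cells with sides `c i * δ`, and from any point of a cell a `δ`-optimal rule
for its lower left corner is followed; this is admissible because the corner has the smaller surplus
(`PathAdmissible.paste`, `paste_le_value`). The loss is controlled by `value_le_mul_value`: starting
at the corner and waiting for a time `δ`, no claim occurs with probability at least `e^{-rate δ}`,
and the surplus then dominates the whole cell. So `V` on the cell is at most `e^{(q + rate) δ}`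
times `V` at the corner, and `δ → 0` concludes.

Finiteness holds because payments up to `t` never exceed `max (x i) 0 + c i * t`. -/

noncomputable section

/-! ### Right induction, dense times and step paths -/

/-- Induction along `[0, ∞)`: a property that propagates to the right of a point where it holds, and
to the supremum of an initial segment on which it holds, is true everywhere. -/
theorem NNReal.right_induction {p : ℝ≥0 → Prop} (h0 : p 0)
    (hright : ∀ t, p t → ∃ v > t, ∀ u, t < u → u < v → p u)
    (hleft : ∀ t, 0 < t → (∀ u < t, p u) → p t) (t : ℝ≥0) : p t := by
  by_contra hn
  have hne : {t | ¬ p t}.Nonempty := ⟨t, hn⟩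
  set t₀ := sInf {t | ¬ p t}
  have hlt : ∀ u < t₀, p u := fun u hu => by
    by_contra h
    exact absurd (csInf_le (OrderBot.bddBelow _) h) (not_le.2 hu)
  have hp : p t₀ := by
    rcases eq_zero_or_pos t₀ with h | h
    · rw [h]; exact h0
    · exact hleft _ h hlt
  obtain ⟨v, hv, h⟩ := hright _ hp
  have : v ≤ t₀ := by
    refine le_csInf hne fun u hu => ?_
    by_contra huv
    rcases lt_trichotomy u t₀ with h1 | h1 | h1
    · exact hu (hlt u h1)
    · exact hu (h1 ▸ hp)
    · exact hu (h u h1 (not_le.1 huv))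
  exact absurd hv (not_lt.2 this)

/-- A dense sequence of times. -/
def denseTime : ℕ → ℝ≥0 := TopologicalSpace.denseSeq ℝ≥0

theorem exists_denseTime_between {a b : ℝ≥0} (h : a < b) :
    ∃ n, a < denseTime n ∧ denseTime n < b := by
  obtain ⟨z, ⟨n, rfl⟩, hz⟩ := (TopologicalSpace.denseRange_denseSeq ℝ≥0).exists_between h
  exact ⟨n, hz⟩

/-- Nondecreasing right-continuous step paths started at `0`. -/
structure StepPath where
  /-- The underlying function. -/
  toFun : ℝ≥0 → ℝ
  mono' : Monotone toFun
  zero' : toFun 0 = 0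
  right' : ∀ t, ∃ v > t, toFun v = toFun t

namespace StepPath

instance : CoeFun StepPath fun _ => ℝ≥0 → ℝ := ⟨toFun⟩

instance : MeasurableSpace StepPath := MeasurableSpace.comap toFun inferInstance

theorem mono (s : StepPath) : Monotone s := s.mono'

@[simp] theorem zero (s : StepPath) : s 0 = 0 := s.zero'

theorem exists_const (s : StepPath) (t : ℝ≥0) :
    ∃ v > t, ∀ u, t ≤ u → u ≤ v → s u = s t := by
  obtain ⟨v, hv, h⟩ := s.right' t
  exact ⟨v, hv, fun u h1 h2 => le_antisymm (h ▸ s.mono h2) (s.mono h1)⟩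

theorem nonneg (s : StepPath) (t : ℝ≥0) : 0 ≤ s t := by
  simpa using s.mono zero_le

@[ext] theorem ext {s s' : StepPath} (h : ∀ t, s t = s' t) : s = s' := by
  cases s; cases s'; congr; exact funext h

theorem measurable_toFun : Measurable toFun := comap_measurable _

theorem measurable_apply (t : ℝ≥0) : Measurable fun s : StepPath => s t :=
  (measurable_pi_apply t).comp measurable_toFun

theorem measurable_of_apply {α : Type*} {_ : MeasurableSpace α} {f : α → StepPath}
    (h : ∀ t, Measurable fun a => f a t) : Measurable f :=
  measurable_comap_iff.2 (measurable_pi_iff.2 h)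

/-- The value of a step path is jointly measurable in time and path. -/
theorem measurable_eval : Measurable fun p : ℝ≥0 × StepPath => p.2 p.1 := by
  refine measurable_of_Ioi fun a => ?_
  -- The set where `s t ≤ a` is the countable union: right constancy carries the inequality to a
  -- dense time just after `t`, and monotonicity brings it back.
  refine MeasurableSet.of_compl ?_
  have key : ((fun p : ℝ≥0 × StepPath => p.2 p.1) ⁻¹' Ioi a)ᶜ =
      ⋃ n, {p : ℝ≥0 × StepPath | p.1 < denseTime n ∧ p.2 (denseTime n) ≤ a} := by
    ext p
    simp only [mem_compl_iff, mem_preimage, mem_Ioi, not_lt, mem_iUnion, mem_ofPred_eq]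
    constructor
    · intro h
      obtain ⟨v, hv, hc⟩ := p.2.exists_const p.1
      obtain ⟨n, h1, h2⟩ := exists_denseTime_between hv
      exact ⟨n, h1, (hc _ h1.le h2.le).trans_le h⟩
    · rintro ⟨n, h1, h2⟩
      exact (p.2.mono h1.le).trans h2
  rw [key]
  refine MeasurableSet.iUnion fun n => ?_
  exact (measurableSet_lt measurable_fst measurable_const).inter
    (measurableSet_le ((measurable_apply _).comp measurable_snd) measurable_const)

theorem measurable_eval_comp {α : Type*} {_ : MeasurableSpace α} {f : α → StepPath} {T : α → ℝ≥0}
    (hf : Measurable f) (hT : Measurable T) : Measurable fun a => f a (T a) :=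
  measurable_eval.comp (hT.prodMk hf)

/-- The path stopped at time `T`. -/
def stopAt (s : StepPath) (T : ℝ≥0) : StepPath :=
  ⟨fun u => s (min u T), fun u v h => s.mono (min_le_min_right _ h), by simp, fun t => by
    obtain ⟨v, hv, h⟩ := s.exists_const t
    refine ⟨v, hv, ?_⟩
    rcases le_total t T with h1 | h1
    · rw [min_eq_left h1]
      exact h _ (le_min hv.le h1) (min_le_left _ _)
    · rw [min_eq_right h1, min_eq_right (h1.trans hv.le)]⟩

@[simp] theorem stopAt_apply (s : StepPath) (T u : ℝ≥0) : s.stopAt T u = s (min u T) := rfl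

theorem measurable_stopAt {α : Type*} {_ : MeasurableSpace α} {f : α → StepPath} {T : α → ℝ≥0}
    (hf : Measurable f) (hT : Measurable T) : Measurable fun a => (f a).stopAt (T a) :=
  measurable_of_apply fun t =>
    measurable_eval_comp (T := fun a => min t (T a)) hf (measurable_const.min hT)

/-- The increments of the path after time `T`. -/
def shift (s : StepPath) (T : ℝ≥0) : StepPath :=
  ⟨fun u => s (T + u) - s T, fun u v h => sub_le_sub_right (s.mono (by gcongr)) _, by simp,
    fun t => by
      obtain ⟨v, hv, h⟩ := s.exists_const (T + t)
      have hTv : T ≤ v := le_self_add.trans hv.le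
      refine ⟨v - T, lt_tsub_iff_left.2 hv, ?_⟩
      rw [add_tsub_cancel_of_le hTv, h v hv.le le_rfl]⟩

@[simp] theorem shift_apply (s : StepPath) (T u : ℝ≥0) : s.shift T u = s (T + u) - s T := rfl

theorem measurable_shift {α : Type*} {_ : MeasurableSpace α} {f : α → StepPath} {T : α → ℝ≥0}
    (hf : Measurable f) (hT : Measurable T) : Measurable fun a => (f a).shift (T a) :=
  measurable_of_apply fun t =>
    (measurable_eval_comp hf (hT.add_const t)).sub (measurable_eval_comp hf hT)

/-- The path that follows `s` up to time `T` and has the increments of `s'` afterwards. -/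
def concat (T : ℝ≥0) (s s' : StepPath) : StepPath :=
  ⟨fun u => s (min u T) + s' (u - T), fun u v h =>
    add_le_add (s.mono (min_le_min_right _ h)) (s'.mono (tsub_le_tsub_right h _)), by simp,
    fun t => by
      obtain ⟨v, hv, h⟩ := s.exists_const t
      obtain ⟨v', hv', h'⟩ := s'.exists_const (t - T)
      rcases lt_or_ge t T with h1 | h1
      · refine ⟨min v T, lt_min hv h1, ?_⟩
        rw [tsub_eq_zero_of_le (min_le_right v T), tsub_eq_zero_of_le h1.le, min_eq_left h1.le,
          min_eq_left (min_le_right v T), h _ (le_min hv.le h1.le) (min_le_left _ _)]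
      · have h2 : t < v' + T := by
          have := add_lt_add_of_lt_of_le hv' (le_refl T)
          rwa [tsub_add_cancel_of_le h1] at this
        refine ⟨v' + T, h2, ?_⟩
        rw [min_eq_right h1, min_eq_right (h1.trans h2.le), add_tsub_cancel_right,
          h' v' hv'.le le_rfl]⟩

theorem concat_apply (T : ℝ≥0) (s s' : StepPath) (u : ℝ≥0) :
    concat T s s' u = s (min u T) + s' (u - T) := rfl

theorem concat_of_le {T : ℝ≥0} (s s' : StepPath) {u : ℝ≥0} (h : u ≤ T) :
    concat T s s' u = s u := by
  rw [concat_apply, min_eq_left h, tsub_eq_zero_of_le h, zero, add_zero]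

theorem concat_add (T : ℝ≥0) (s s' : StepPath) (u : ℝ≥0) :
    concat T s s' (T + u) = s T + s' u := by
  rw [concat_apply, min_eq_right le_self_add, add_tsub_cancel_left]

theorem concat_stopAt_shift (s : StepPath) (T : ℝ≥0) : concat T (s.stopAt T) (s.shift T) = s := by
  ext u
  rcases le_total u T with h | h
  · rw [concat_of_le _ _ h, stopAt_apply, min_eq_left h]
  · obtain ⟨v, rfl⟩ := exists_add_of_le h
    rw [concat_add]
    simp

theorem measurable_concat {α : Type*} {_ : MeasurableSpace α} {f g : α → StepPath} {T : α → ℝ≥0}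
    (hT : Measurable T) (hf : Measurable f) (hg : Measurable g) :
    Measurable fun a => concat (T a) (f a) (g a) :=
  measurable_of_apply fun _ =>
    (measurable_eval_comp hf (measurable_const.min hT)).add
      (measurable_eval_comp hg (measurable_const.sub hT))

/-- Measures on step paths are determined by their images on the product space. -/
theorem measure_ext {μ ν : Measure StepPath}
    (h : μ.map toFun = ν.map toFun) : μ = ν := by
  ext B hB
  obtain ⟨B', hB', rfl⟩ := hB
  rw [← Measure.map_apply measurable_toFun hB', h, Measure.map_apply measurable_toFun hB']

end StepPath

/-! ### Dividend paths -/

/-- Nondecreasing left-continuous paths started at `0`, in order-theoretic terms. -/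
structure IsDividendPath (f : ℝ≥0 → ℝ) : Prop where
  mono : Monotone f
  zero : f 0 = 0
  left : ∀ t a, 0 < t → (∀ u < t, f u ≤ a) → f t ≤ a

namespace IsDividendPath

variable {f g : ℝ≥0 → ℝ}

theorem nonneg (hf : IsDividendPath f) (t : ℝ≥0) : 0 ≤ f t := hf.zero ▸ hf.mono zero_le

theorem of_leftContinuous (h1 : Monotone f) (h2 : f 0 = 0)
    (h3 : ∀ t, ContinuousWithinAt f (Iio t) t) : IsDividendPath f := by
  refine ⟨h1, h2, fun t a ht ha => ?_⟩
  have : (𝓝[<] t).NeBot := nhdsLT_neBot_of_exists_lt ⟨0, ht⟩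
  exact le_of_tendsto (h3 t) (eventually_mem_nhdsWithin.mono fun u hu => ha u hu)

theorem isCaglad (hf : IsDividendPath f) : IsCaglad f := by
  intro t
  refine ⟨?_, _, hf.mono.tendsto_rightLim t⟩
  rcases eq_zero_or_pos t with rfl | ht
  · have : Iio (0 : ℝ≥0) = ∅ := by ext; simp
    rw [ContinuousWithinAt, this]; simp
  · refine tendsto_order.2 ⟨fun a ha => ?_, fun a ha => ?_⟩
    · obtain ⟨u, hu, hau⟩ : ∃ u < t, a < f u := by
        by_contra! h
        exact absurd (hf.left t a ht h) (not_le.2 ha)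
      filter_upwards [Ioo_mem_nhdsLT hu] with v hv using hau.trans_le (hf.mono hv.1.le)
    · filter_upwards [self_mem_nhdsWithin] with v hv using (hf.mono (le_of_lt hv)).trans_lt ha

/-- By left-continuity, a level exceeded at `t` is already exceeded shortly before; `0 ≤ a` excludes
`t = 0`, which has no earlier times. Joint measurability and predictability of payments rest on
this. -/
theorem lt_iff_exists_denseTime (hf : IsDividendPath f) {t : ℝ≥0} {a : ℝ} (ha : 0 ≤ a) :
    a < f t ↔ ∃ n, denseTime n < t ∧ a < f (denseTime n) := by
  constructor
  · intro h
    have ht : 0 < t := by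
      refine pos_of_ne_zero ?_
      rintro rfl
      rw [hf.zero] at h
      exact absurd h (not_lt.2 ha)
    by_contra! hn
    refine absurd (hf.left t a ht fun u hu => ?_) (not_le.2 h)
    obtain ⟨n, h1, h2⟩ := exists_denseTime_between hu
    exact (hf.mono h1.le).trans (hn n h2)
  · rintro ⟨n, h1, h2⟩
    exact h2.trans_le (hf.mono h1.le)

theorem le_of_forall_denseTime (hf : IsDividendPath f) {u t : ℝ≥0} {a : ℝ} (hut : u < t)
    (h : ∀ n, u < denseTime n → denseTime n < t → f (denseTime n) ≤ a) : f t ≤ a := by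
  refine hf.left t a (zero_le.trans_lt hut) fun v hv => ?_
  obtain ⟨n, h1, h2⟩ := exists_denseTime_between (max_lt hut hv)
  exact (hf.mono ((le_max_right _ _).trans h1.le)).trans (h n ((le_max_left _ _).trans_lt h1) h2)

theorem const_zero : IsDividendPath fun _ => 0 :=
  ⟨monotone_const, rfl, fun _ _ ht h => h 0 ht⟩

theorem shift (hf : IsDividendPath f) (T : ℝ≥0) : IsDividendPath fun t => f (T + t) - f T := by
  refine ⟨fun u v h => sub_le_sub_right (hf.mono (by gcongr)) _, by simp, fun t a ht h => ?_⟩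
  rw [sub_le_iff_le_add]
  refine hf.left _ _ (ht.trans_le le_add_self) fun u hu => ?_
  rcases le_total u T with h1 | h1
  · have := h 0 ht
    have := hf.mono h1
    simp at *
    linarith
  · obtain ⟨v, rfl⟩ := exists_add_of_le h1
    have := h v (by simpa using hu)
    linarith

/-- The path that pays as `f` up to time `T` and as `g` afterwards. -/
theorem paste (hf : IsDividendPath f) (hg : IsDividendPath g) (T : ℝ≥0) :
    IsDividendPath fun t => f (min t T) + g (t - T) := by
  refine ⟨fun u v h => add_le_add (hf.mono (min_le_min_right _ h))
    (hg.mono (tsub_le_tsub_right h _)), by simp [hf.zero, hg.zero], fun t a ht h => ?_⟩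
  rcases le_or_gt t T with h1 | h1
  · rw [min_eq_left h1, tsub_eq_zero_of_le h1, hg.zero, add_zero]
    refine hf.left _ _ ht fun u hu => ?_
    simpa [min_eq_left (hu.le.trans h1), tsub_eq_zero_of_le (hu.le.trans h1), hg.zero]
      using h u hu
  · rw [min_eq_right h1.le, ← le_sub_iff_add_le']
    refine hg.left _ _ (tsub_pos_of_lt h1) fun u hu => ?_
    have := h (u + T) (lt_tsub_iff_right.1 hu)
    rw [min_eq_right le_add_self, add_tsub_cancel_right] at this
    linarith

end IsDividendPath

/-! ### Payment rules on claim paths -/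

/-- Nonanticipating measurable payment rules: the amounts paid before time `t` are a function of the
claims before time `t`. -/
structure PathStrategy where
  /-- The accumulated payments along a given claim path. -/
  toFun : StepPath → ℝ≥0 → Fin 2 → ℝ
  measurable' : ∀ t, Measurable fun s => toFun s t
  nonanticipating : ∀ s s' t, (∀ u < t, s.toFun u = s'.toFun u) → toFun s t = toFun s' t
  isDividendPath : ∀ s i, IsDividendPath fun t => toFun s t i

namespace PathStrategy

instance : CoeFun PathStrategy fun _ => StepPath → ℝ≥0 → Fin 2 → ℝ := ⟨toFun⟩

theorem measurable_apply (F : PathStrategy) (t : ℝ≥0) (i : Fin 2) :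
    Measurable fun s => F s t i := (measurable_pi_apply i).comp (F.measurable' t)

/-- Payments are jointly measurable in path and time. -/
theorem measurable_eval (F : PathStrategy) (i : Fin 2) :
    Measurable fun p : ℝ≥0 × StepPath => F p.2 p.1 i := by
  refine measurable_of_Ioi fun a => ?_
  rcases lt_or_ge a 0 with ha | ha
  · convert MeasurableSet.univ
    ext p
    simpa using ha.trans_le ((F.isDividendPath p.2 i).nonneg p.1)
  · have key : (fun p : ℝ≥0 × StepPath => F p.2 p.1 i) ⁻¹' Ioi a =
        ⋃ n, {p : ℝ≥0 × StepPath | denseTime n < p.1 ∧ a < F p.2 (denseTime n) i} := by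
      ext p
      simp only [mem_preimage, mem_Ioi, mem_iUnion, mem_ofPred_eq]
      exact (F.isDividendPath p.2 i).lt_iff_exists_denseTime ha
    rw [key]
    exact MeasurableSet.iUnion fun n =>
      (measurableSet_lt measurable_const measurable_fst).inter
        (measurableSet_lt measurable_const ((F.measurable_apply _ i).comp measurable_snd))

theorem measurable_eval_comp (F : PathStrategy) {α : Type*} {_ : MeasurableSpace α}
    {f : α → StepPath} {T : α → ℝ≥0} (hf : Measurable f) (hT : Measurable T) (i : Fin 2) :
    Measurable fun a => F (f a) (T a) i :=
  (F.measurable_eval i).comp (hT.prodMk hf)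

/-- Never paying anything. -/
protected def zero : PathStrategy where
  toFun _ _ _ := 0
  measurable' _ := measurable_const
  nonanticipating _ _ _ _ := rfl
  isDividendPath _ _ := .const_zero

/-- The payments after time `T`, as a function of the claims after time `T`, if the claims up to time
`T` are those of the path `y`. -/
def continuation (F : PathStrategy) (T : ℝ≥0) (y : StepPath) : PathStrategy where
  toFun s t i := F (.concat T y s) (T + t) i - F (.concat T y s) T i
  measurable' t := measurable_pi_iff.2 fun i => by
    have := StepPath.measurable_concat (measurable_const (a := T)) (measurable_const (a := y))
      measurable_id
    exact ((F.measurable_apply _ i).comp this).sub ((F.measurable_apply _ i).comp this)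
  nonanticipating s s' t h := by
    have h1 : F (.concat T y s) (T + t) = F (.concat T y s') (T + t) := by
      refine F.nonanticipating _ _ _ fun u hu => ?_
      rcases le_total u T with h1 | h1
      · simp only [StepPath.concat_of_le _ _ h1]
      · obtain ⟨v, rfl⟩ := exists_add_of_le h1
        rw [StepPath.concat_add, StepPath.concat_add, h v (by simpa using hu)]
    have h2 : F (.concat T y s) T = F (.concat T y s') T :=
      F.nonanticipating _ _ _ fun u hu => by simp only [StepPath.concat_of_le _ _ hu.le]
    rw [h1, h2]
  isDividendPath s i := (F.isDividendPath _ i).shift T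

end PathStrategy

/-! ### Pathwise admissibility and ruin -/

theorem exists_forall_of_eventually_nhdsGT {p : ℝ≥0 → Prop} {t : ℝ≥0} (h : ∀ᶠ u in 𝓝[>] t, p u) :
    ∃ v > t, ∀ u, t < u → u < v → p u := by
  obtain ⟨v, hv, h⟩ := mem_nhdsGT_iff_exists_Ioo_subset.1 h
  exact ⟨v, hv, fun u h1 h2 => h ⟨h1, h2⟩⟩

theorem eventually_nhdsGT_of_forall {p : ℝ≥0 → Prop} {t v : ℝ≥0} (hv : t < v)
    (h : ∀ u, t < u → u < v → p u) : ∀ᶠ u in 𝓝[>] t, p u :=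
  mem_nhdsGT_iff_exists_Ioo_subset.2 ⟨v, hv, fun u hu => h u hu.1 hu.2⟩

namespace DegenerateRiskModel

variable {Ω : Type*} [MeasurableSpace Ω] {P : Measure Ω} (M : DegenerateRiskModel Ω P)

/-- The uncontrolled surplus along a claim path. -/
def pathSurplus (x : Fin 2 → ℝ) (s : StepPath) (t : ℝ≥0) (i : Fin 2) : ℝ :=
  x i + M.c i * t - M.b i * s t

/-- The pathwise conditions on an admissible strategy: between two claims, payments may be made
only out of a nonnegative surplus, and payments cease at ruin. -/
structure PathAdmissible (x : Fin 2 → ℝ) (s : StepPath) (f : ℝ≥0 → Fin 2 → ℝ) : Prop where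
  pay : ∀ i u t, u ≤ t → s u = s t → f t i ≤ max (f u i) (M.pathSurplus x s t i)
  stopped : ∀ r t, r ≤ t → (∀ i, M.pathSurplus x s r i < f r i) → ∀ i, f t i = f r i

/-- The time of simultaneous ruin along a claim path. -/
def pathRuinTime (x : Fin 2 → ℝ) (s : StepPath) (f : ℝ≥0 → Fin 2 → ℝ) : WithTop ℝ≥0 :=
  sInf ((fun t : ℝ≥0 => (t : WithTop ℝ≥0)) '' {t | 0 < t ∧ ∀ i, M.pathSurplus x s t i - f t i < 0})

variable {M} {x : Fin 2 → ℝ} {s : StepPath} {f : ℝ≥0 → Fin 2 → ℝ}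

theorem pathSurplus_mono_time {u t : ℝ≥0} (h : u ≤ t) (hs : s u = s t) (i : Fin 2) :
    M.pathSurplus x s u i ≤ M.pathSurplus x s t i := by
  have : M.c i * (u : ℝ) ≤ M.c i * t := mul_le_mul_of_nonneg_left (by exact_mod_cast h) (M.c_pos i).le
  rw [pathSurplus, pathSurplus, hs]
  linarith

theorem pathSurplus_le (t : ℝ≥0) (i : Fin 2) : M.pathSurplus x s t i ≤ x i + M.c i * t := by
  have := mul_nonneg (M.b_pos i).le (s.nonneg t)
  rw [pathSurplus]
  linarith

/-- A surplus below a level stays below it for some time. -/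
theorem exists_pathSurplus_lt {t : ℝ≥0} {i : Fin 2} {a : ℝ} (h : M.pathSurplus x s t i < a) :
    ∃ v > t, ∀ u, t ≤ u → u ≤ v → s u = s t ∧ M.pathSurplus x s u i < a := by
  obtain ⟨v, hv, hc⟩ := s.exists_const t
  have hcont : ContinuousAt (fun u : ℝ≥0 => x i + M.c i * (u : ℝ) - M.b i * s t) t := by fun_prop
  have h2 : ∀ᶠ u : ℝ≥0 in 𝓝[>] t, x i + M.c i * (u : ℝ) - M.b i * s t < a :=
    (hcont.tendsto.eventually (gt_mem_nhds h)).filter_mono nhdsWithin_le_nhds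
  obtain ⟨w, hw, hlt⟩ := exists_forall_of_eventually_nhdsGT h2
  obtain ⟨z, hz1, hz2⟩ := exists_between (lt_min hv hw)
  refine ⟨z, hz1, fun u hu1 hu2 => ?_⟩
  have hsu : s u = s t := hc u hu1 (hu2.trans (hz2.le.trans (min_le_left _ _)))
  refine ⟨hsu, ?_⟩
  rcases hu1.eq_or_lt with rfl | hu1
  · exact h
  · rw [pathSurplus, hsu]
    exact hlt u hu1 (hu2.trans_lt (hz2.trans_le (min_le_right _ _)))

/-- The local rules of admissibility imply the pathwise conditions. -/
theorem PathAdmissible.of_rules (hx : x ∈ solvencySet) (hf : ∀ i, IsDividendPath fun t => f t i)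
    (no_pay : ∀ i t, M.pathSurplus x s t i < f t i → ∀ᶠ u in 𝓝[>] t, f u i = f t i)
    (no_ruin : ∀ i t, f t i ≤ M.pathSurplus x s t i →
      ∀ᶠ u in 𝓝[>] t, f u i ≤ M.pathSurplus x s u i)
    (hstopAt : ∀ i (r t : ℝ≥0), M.pathRuinTime x s f = r → r ≤ t → f t i = f r i) :
    M.PathAdmissible x s f := by
  refine ⟨fun i u t hut hs => ?_, fun r t hrt hneg i => ?_⟩
  · suffices H : ∀ v, u ≤ v → s u = s v → f v i ≤ max (f u i) (M.pathSurplus x s v i) from H t hut hs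
    -- The bound propagates to the right of `v`: if the surplus is below `f v`, payments are frozen
    -- and `f v ≤ f u`; otherwise they stay within the surplus. It passes to left limits because the
    -- surplus increases while `s` is constant.
    refine NNReal.right_induction (fun h0 _ => ?_) (fun v hv => ?_) (fun v hv0 hv => ?_)
    · rw [le_antisymm h0 zero_le]; exact le_max_left _ _
    · rcases lt_or_ge v u with hvu | hvu
      · exact ⟨u, hvu, fun w _ hwu h => absurd h (not_le.2 hwu)⟩
      by_cases hsv : s u = s v
      · have hv' := hv hvu hsv
        rcases lt_or_ge (M.pathSurplus x s v i) (f v i) with h | h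
        · obtain ⟨z, hz, hz'⟩ := exists_forall_of_eventually_nhdsGT (no_pay i v h)
          refine ⟨z, hz, fun w h1 h2 _ _ => ?_⟩
          rw [hz' w h1 h2]
          rcases le_max_iff.1 hv' with h3 | h3
          · exact h3.trans (le_max_left _ _)
          · exact absurd h (not_lt.2 h3)
        · obtain ⟨z, hz, hz'⟩ := exists_forall_of_eventually_nhdsGT (no_ruin i v h)
          exact ⟨z, hz, fun w h1 h2 _ _ => (hz' w h1 h2).trans (le_max_right _ _)⟩
      · refine ⟨v + 1, lt_add_one v, fun w h1 _ _ h => absurd ?_ hsv⟩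
        exact le_antisymm (s.mono hvu) (h ▸ s.mono h1.le)
    · intro huv hsv
      rcases huv.eq_or_lt with rfl | huv
      · exact le_max_left _ _
      refine (hf i).left v _ hv0 fun w hw => ?_
      rcases le_total w u with hwu | hwu
      · exact ((hf i).mono hwu).trans (le_max_left _ _)
      · have h1 : s u = s w := le_antisymm (s.mono hwu) (hsv ▸ s.mono hw.le)
        exact (hv w hw hwu h1).trans
          (max_le_max le_rfl (pathSurplus_mono_time hw.le (h1 ▸ hsv) i))
  -- The infimum defining ruin runs over positive times. A solvent start excludes `r = 0`, so the
  -- ruin time is at most `r`, and payments are frozen from then on.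
  · have hr0 : 0 < r := by
      refine pos_of_ne_zero ?_
      rintro rfl
      refine hx fun i => ?_
      have := hneg i
      rw [(hf i).zero] at this
      simpa [pathSurplus] using this
    set A := (fun t : ℝ≥0 => (t : WithTop ℝ≥0)) ''
      {t | 0 < t ∧ ∀ i, M.pathSurplus x s t i - f t i < 0}
    have hle : sInf A ≤ r :=
      csInf_le (OrderBot.bddBelow _) ⟨r, ⟨hr0, fun i => sub_neg.2 (hneg i)⟩, rfl⟩
    obtain ⟨r', hr'⟩ := WithTop.ne_top_iff_exists.1 (hle.trans_lt (WithTop.coe_lt_top r)).ne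
    rw [← hr', WithTop.coe_le_coe] at hle
    rw [hstopAt i r' t hr'.symm (hle.trans hrt), hstopAt i r' r hr'.symm hle]

namespace PathAdmissible

/-- A surplus below `f t i` stays below it for some time without claims, so the second alternative
of the maximum in `pay` never exceeds the first. -/
theorem no_pay (h : M.PathAdmissible x s f) (hf : ∀ i, IsDividendPath fun t => f t i) {i : Fin 2}
    {t : ℝ≥0} (hlt : M.pathSurplus x s t i < f t i) : ∀ᶠ u in 𝓝[>] t, f u i = f t i := by
  obtain ⟨v, hv, hv'⟩ := exists_pathSurplus_lt hlt
  refine eventually_nhdsGT_of_forall hv fun u h1 h2 => ?_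
  obtain ⟨h3, h4⟩ := hv' u h1.le h2.le
  have := h.pay i t u h1.le h3.symm
  rw [max_eq_left h4.le] at this
  exact le_antisymm this ((hf i).mono h1.le)

theorem no_ruin (h : M.PathAdmissible x s f) {i : Fin 2}
    {t : ℝ≥0} (hle : f t i ≤ M.pathSurplus x s t i) :
    ∀ᶠ u in 𝓝[>] t, f u i ≤ M.pathSurplus x s u i := by
  obtain ⟨v, hv, hv'⟩ := s.exists_const t
  refine eventually_nhdsGT_of_forall hv fun u h1 h2 => ?_
  have h3 := (hv' u h1.le h2.le).symm
  exact (h.pay i t u h1.le h3).trans (max_le (hle.trans (pathSurplus_mono_time h1.le h3 i)) le_rfl)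

/-- Ruin occurs at the ruin time. -/
theorem neg_at_ruin (h : M.PathAdmissible x s f) {r : ℝ≥0}
    (hr : M.pathRuinTime x s f = r) :
    ∀ i, M.pathSurplus x s r i < f r i := by
  by_contra! hn
  obtain ⟨i, hi⟩ := hn
  rw [pathRuinTime] at hr
  -- A branch that is solvent at `r` stays solvent on `[r, v)`, which makes `v` a lower bound of a
  -- set with infimum `r < v`.
  obtain ⟨v, hv, hv'⟩ := exists_forall_of_eventually_nhdsGT (h.no_ruin hi)
  set A := (fun t : ℝ≥0 => (t : WithTop ℝ≥0)) ''
    {t | 0 < t ∧ ∀ i, M.pathSurplus x s t i - f t i < 0}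
  have hne : A.Nonempty := by
    by_contra hA
    rw [not_nonempty_iff_eq_empty.1 hA, WithTop.sInf_empty] at hr
    exact WithTop.top_ne_coe hr
  have : (v : WithTop ℝ≥0) ≤ sInf A := by
    refine le_csInf hne ?_
    rintro _ ⟨t, ⟨ht0, ht⟩, rfl⟩
    by_contra hlt
    replace hlt : t < v := WithTop.coe_lt_coe.1 (not_le.1 hlt)
    have hrt : r ≤ t := by
      rw [← WithTop.coe_le_coe, ← hr]
      exact csInf_le (OrderBot.bddBelow _) ⟨t, ⟨ht0, ht⟩, rfl⟩
    rcases hrt.eq_or_lt with rfl | hrt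
    · exact absurd (ht i) (not_lt.2 (sub_nonneg.2 hi))
    · exact absurd (ht i) (not_lt.2 (sub_nonneg.2 (hv' t hrt hlt)))
  rw [hr, WithTop.coe_le_coe] at this
  exact absurd hv (not_lt.2 this)

theorem stopped_at_ruin (h : M.PathAdmissible x s f) (i : Fin 2) (r t : ℝ≥0)
    (hr : M.pathRuinTime x s f = r) (hrt : r ≤ t) : f t i = f r i :=
  h.stopped r t hrt (h.neg_at_ruin hr) i

/-- The payments are bounded by the initial surplus and the premiums. -/
theorem le_bound (h : M.PathAdmissible x s f) (hf : ∀ i, IsDividendPath fun t => f t i) (i : Fin 2)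
    (t : ℝ≥0) : f t i ≤ max (x i) 0 + M.c i * t := by
  refine NNReal.right_induction (p := fun t => f t i ≤ max (x i) 0 + M.c i * t) ?_
    (fun v hv => ?_) (fun v hv0 hv => ?_) t
  · simp [(hf i).zero]
  · obtain ⟨w, hw, hw'⟩ := s.exists_const v
    refine ⟨w, hw, fun u h1 h2 => ?_⟩
    have hcu : M.c i * (v : ℝ) ≤ M.c i * u :=
      mul_le_mul_of_nonneg_left (by exact_mod_cast h1.le) (M.c_pos i).le
    refine (h.pay i v u h1.le (hw' u h1.le h2.le).symm).trans (max_le (by linarith) ?_)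
    exact (pathSurplus_le u i).trans (by gcongr; exact le_max_left _ _)
  · refine (hf i).left v _ hv0 fun u hu => (hv u hu).trans ?_
    have hcu : M.c i * (u : ℝ) ≤ M.c i * v :=
      mul_le_mul_of_nonneg_left (by exact_mod_cast hu.le) (M.c_pos i).le
    linarith

/-- The pathwise conditions only involve countably many times. -/
theorem iff_denseTime (hf : ∀ i, IsDividendPath fun t => f t i) :
    M.PathAdmissible x s f ↔
      (∀ i n (k : ℕ), f (denseTime n) i ≤ max (M.pathSurplus x s (denseTime n) i) 0 ∨
        ∃ m, s (denseTime m) < s (denseTime n) ∧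
          f (denseTime n) i ≤ f (denseTime m) i + 1 / ((k : ℝ) + 1)) ∧
      (∀ n m, denseTime n ≤ denseTime m →
        (∀ i, M.pathSurplus x s (denseTime n) i < f (denseTime n) i) →
        ∀ i, f (denseTime m) i = f (denseTime n) i) := by
  constructor
  · refine fun h => ⟨fun i n k => ?_, fun n m => h.stopped _ _⟩
    set t := denseTime n
    -- `u` is the start of the claim-free interval ending at `t`, attained by right constancy. Times
    -- before `u` are recognized by their smaller value of `s`. Left-continuity yields `f u` only as
    -- a supremum over such times, whence the slack `1 / (k + 1)`.
    set u := sInf {u | s u = s t}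
    have hne : {u | s u = s t}.Nonempty := ⟨t, rfl⟩
    have hut : u ≤ t := csInf_le (OrderBot.bddBelow _) rfl
    have hsu : s u = s t := by
      obtain ⟨v, hv, hv'⟩ := s.exists_const u
      obtain ⟨w, hw, hwv⟩ := exists_lt_of_csInf_lt hne hv
      have : u ≤ w := csInf_le (OrderBot.bddBelow _) hw
      rw [← hv' w this hwv.le]; exact hw
    have hlt : ∀ w < u, s w < s t := fun w hw =>
      lt_of_le_of_ne (s.mono (hw.le.trans hut)) fun h =>
        absurd (csInf_le (s := {u | s u = s t}) (OrderBot.bddBelow _) h) (not_le.2 hw)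
    rcases le_max_iff.1 (h.pay i u t hut hsu) with h1 | h1
    · by_cases h0 : f t i ≤ 0
      · exact Or.inl (h0.trans (le_max_right _ _))
      right
      push Not at h0
      have hpos : (0 : ℝ) < 1 / ((k : ℝ) + 1) := by positivity
      have ha : max (f t i - 1 / ((k : ℝ) + 1)) 0 < f u i := by
        refine max_lt (by linarith) (by linarith)
      obtain ⟨m, hm1, hm2⟩ := ((hf i).lt_iff_exists_denseTime (le_max_right _ _)).1 ha
      exact ⟨m, hlt _ hm1, by linarith [(le_max_left (f t i - 1 / ((k : ℝ) + 1)) 0)]⟩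
    · exact Or.inl (h1.trans (le_max_left _ _))
  · rintro ⟨h1, h2⟩
    have pay : ∀ i u t, u ≤ t → s u = s t → f t i ≤ max (f u i) (M.pathSurplus x s t i) := by
      intro i u t hut hs
      rcases hut.eq_or_lt with rfl | hut
      · exact le_max_left _ _
      refine (hf i).le_of_forall_denseTime hut fun n hn1 hn2 => ?_
      have hsn : s (denseTime n) = s t :=
        le_antisymm (s.mono hn2.le) (hs ▸ s.mono hn1.le)
      have hX := pathSurplus_mono_time (M := M) (x := x) hn2.le hsn i
      by_cases hle : f (denseTime n) i ≤ max (M.pathSurplus x s (denseTime n) i) 0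
      · refine hle.trans (max_le (hX.trans (le_max_right _ _)) ?_)
        exact ((hf i).nonneg u).trans (le_max_left _ _)
      · refine le_trans ?_ (le_max_left _ _)
        refine le_of_forall_pos_le_add fun ε hε => ?_
        obtain ⟨k, hk⟩ := exists_nat_one_div_lt hε
        obtain ⟨m, hm1, hm2⟩ := (h1 i n k).resolve_left hle
        have hmu : denseTime m ≤ u := by
          by_contra hmu
          have := s.mono (not_le.1 hmu).le
          rw [hsn, ← hs] at hm1
          exact absurd hm1 (not_lt.2 this)
        have : f (denseTime m) i ≤ f u i := (hf i).mono hmu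
        linarith
    refine ⟨pay, fun r t hrt hneg i => ?_⟩
    rcases hrt.eq_or_lt with rfl | hrt
    · rfl
    -- Just after a time `r` of ruin, both surpluses remain below the payments, which do not move;
    -- so ruin is visible at a dense time between `r` and `t`.
    choose v hv hv' using fun i => exists_pathSurplus_lt (hneg i)
    have hlt : r < min (min (v 0) (v 1)) t := lt_min (lt_min (hv 0) (hv 1)) hrt
    obtain ⟨n, hn1, hn2⟩ := exists_denseTime_between hlt
    have hnv : ∀ i, denseTime n ≤ v i := by
      intro i
      fin_cases i
      · exact hn2.le.trans ((min_le_left _ _).trans (min_le_left _ _))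
      · exact hn2.le.trans ((min_le_left _ _).trans (min_le_right _ _))
    have hfn : ∀ i, f (denseTime n) i = f r i := fun i => by
      obtain ⟨h3, h4⟩ := hv' i _ hn1.le (hnv i)
      have := pay i r _ hn1.le h3.symm
      rw [max_eq_left h4.le] at this
      exact le_antisymm this ((hf i).mono hn1.le)
    have hnneg : ∀ i, M.pathSurplus x s (denseTime n) i < f (denseTime n) i := fun i =>
      (hfn i).symm ▸ (hv' i _ hn1.le (hnv i)).2
    refine le_antisymm ?_ ((hf i).mono hrt.le)
    refine (hf i).le_of_forall_denseTime (hn2.trans_le (min_le_right _ _)) fun m hm _ => ?_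
    rw [h2 n m hm.le hnneg i, hfn i]

end PathAdmissible

theorem measurable_pathSurplus (x : Fin 2 → ℝ) (t : ℝ≥0) (i : Fin 2) :
    Measurable fun s => M.pathSurplus x s t i :=
  ((StepPath.measurable_apply t).const_mul _).const_sub _

/-- The set of claim paths along which a given rule is admissible is measurable. -/
theorem measurableSet_pathAdmissible (x : Fin 2 → ℝ) (F : PathStrategy) :
    MeasurableSet {s | M.PathAdmissible x s (F s)} := by
  simp only [PathAdmissible.iff_denseTime (F.isDividendPath _), ofPred_and, ofPred_forall]
  have hF := F.measurable_apply
  have hX := M.measurable_pathSurplus x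
  refine MeasurableSet.inter ?_ ?_
  · refine .iInter fun i => .iInter fun n => .iInter fun k => ?_
    simp only [ofPred_or, ofPred_exists, ofPred_and]
    refine .union (measurableSet_le (hF _ i) ((hX _ i).max measurable_const)) (.iUnion fun m => ?_)
    exact .inter (measurableSet_lt (StepPath.measurable_apply _) (StepPath.measurable_apply _))
      (measurableSet_le (hF _ i) ((hF _ i).add_const _))
  · refine .iInter fun n => .iInter fun m => .iInter fun _ => ?_
    have : {s | (∀ i, M.pathSurplus x s (denseTime n) i < F s (denseTime n) i) →
        ∀ i, F s (denseTime m) i = F s (denseTime n) i} =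
        (⋂ i, {s | M.pathSurplus x s (denseTime n) i < F s (denseTime n) i})ᶜ ∪
        ⋂ i, {s | F s (denseTime m) i = F s (denseTime n) i} := by
      ext s
      simp only [mem_ofPred_eq, mem_union, mem_compl_iff, mem_iInter, imp_iff_not_or]
    rw [this]
    exact .union (MeasurableSet.iInter fun i => measurableSet_lt (hX _ i) (hF _ i)).compl
      (.iInter fun i => measurableSet_eq_fun (hF _ i) (hF _ i))

end DegenerateRiskModel

/-! ### Shifting and pasting admissible payments -/

theorem StepPath.shift_concat (T : ℝ≥0) (s s' : StepPath) : (StepPath.concat T s s').shift T = s' := by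
  ext u
  rw [StepPath.shift_apply, StepPath.concat_add, StepPath.concat_of_le _ _ le_rfl]
  ring

namespace DegenerateRiskModel

variable {Ω : Type*} [MeasurableSpace Ω] {P : Measure Ω} {M : DegenerateRiskModel Ω P}
variable {x : Fin 2 → ℝ} {s : StepPath} {f g : ℝ≥0 → Fin 2 → ℝ}

theorem pathSurplus_add (x : Fin 2 → ℝ) (s : StepPath) (T t : ℝ≥0) (i : Fin 2) :
    M.pathSurplus x s (T + t) i =
      M.pathSurplus x s T i + (M.c i * t - M.b i * s.shift T t) := by
  simp only [pathSurplus, StepPath.shift_apply, NNReal.coe_add]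
  ring

/-- The payments after time `T` are admissible for the surplus reached at time `T`. -/
theorem PathAdmissible.shift (h : M.PathAdmissible x s f) (T : ℝ≥0) :
    M.PathAdmissible (fun i => M.pathSurplus x s T i - f T i) (s.shift T)
      (fun t i => f (T + t) i - f T i) := by
  have key : ∀ t i, M.pathSurplus (fun i => M.pathSurplus x s T i - f T i) (s.shift T) t i =
      M.pathSurplus x s (T + t) i - f T i := fun t i => by
    rw [pathSurplus_add, pathSurplus]; ring
  refine ⟨fun i u t hut hs => ?_, fun r t hrt hneg i => ?_⟩
  · rw [key, max_sub_sub_right]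
    refine sub_le_sub_right (h.pay i _ _ (by gcongr) ?_) _
    simpa using hs
  · rw [h.stopped (T + r) (T + t) (by gcongr) fun i => ?_]
    have := hneg i
    rw [key] at this
    linarith

/-- Ruin has not occurred up to time `T`. -/
def Alive (M : DegenerateRiskModel Ω P) (x : Fin 2 → ℝ) (s : StepPath) (f : ℝ≥0 → Fin 2 → ℝ)
    (T : ℝ≥0) : Prop :=
  ∀ r ≤ T, ∃ i, f r i ≤ M.pathSurplus x s r i

/-- Ruin before `T` lasts for some time, since payments are then frozen and the surplus stays below
them for a while; a dense time before `T` detects it. This makes survival up to `T` a measurable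
event. -/
theorem PathAdmissible.alive_iff (h : M.PathAdmissible x s f) (T : ℝ≥0) :
    M.Alive x s f T ↔ (∃ i, f T i ≤ M.pathSurplus x s T i) ∧
      ∀ n, denseTime n < T → ∃ i, f (denseTime n) i ≤ M.pathSurplus x s (denseTime n) i := by
  refine ⟨fun hA => ⟨hA T le_rfl, fun n hn => hA _ hn.le⟩, ?_⟩
  rintro ⟨h1, h2⟩ r hr
  rcases hr.eq_or_lt with rfl | hr
  · exact h1
  by_contra! hneg
  choose v hv hv' using fun i => exists_pathSurplus_lt (hneg i)
  obtain ⟨n, hn1, hn2⟩ := exists_denseTime_between (lt_min (lt_min (hv 0) (hv 1)) hr)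
  obtain ⟨i, hi⟩ := h2 n (hn2.trans_le (min_le_right _ _))
  have hnv : denseTime n ≤ v i := by
    fin_cases i
    · exact hn2.le.trans ((min_le_left _ _).trans (min_le_left _ _))
    · exact hn2.le.trans ((min_le_left _ _).trans (min_le_right _ _))
  rw [h.stopped r _ hn1.le hneg i] at hi
  exact absurd (hv' i _ hn1.le hnv).2 (not_lt.2 hi)

/-- The infimum defining ruin is attained, so survival up to and including `T` corresponds to a
strict inequality. -/
theorem PathAdmissible.lt_ruin_iff (h : M.PathAdmissible x s f) (hx : x ∈ solvencySet)
    (hf0 : ∀ i, f 0 i = 0) (T : ℝ≥0) :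
    (T : WithTop ℝ≥0) < M.pathRuinTime x s f ↔ M.Alive x s f T := by
  constructor
  · intro hT r hr
    rcases eq_zero_or_pos r with rfl | hr0
    · by_contra! hneg
      refine hx fun i => ?_
      have := hneg i
      rw [hf0] at this
      simpa [pathSurplus] using this
    · by_contra! hneg
      have := hT.trans_le (csInf_le (OrderBot.bddBelow _)
        ⟨r, ⟨hr0, fun i => sub_neg.2 (hneg i)⟩, rfl⟩)
      exact absurd (WithTop.coe_lt_coe.1 this) (not_lt.2 hr)
  · intro hA
    by_contra hle
    obtain ⟨r, hr⟩ := WithTop.ne_top_iff_exists.1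
      ((not_lt.1 hle).trans_lt (WithTop.coe_lt_top T)).ne
    rw [← hr, not_lt, WithTop.coe_le_coe] at hle
    obtain ⟨i, hi⟩ := hA r hle
    exact absurd (h.neg_at_ruin hr.symm i) (not_lt.2 hi)

/-- Switching at time `T`, before ruin, to payments that are admissible for a smaller surplus. -/
theorem PathAdmissible.paste (h : M.PathAdmissible x s f)
    (hg0 : ∀ i, g 0 i = 0) {T : ℝ≥0} {y : Fin 2 → ℝ} (h' : M.PathAdmissible y (s.shift T) g)
    (hy : ∀ i, y i ≤ M.pathSurplus x s T i - f T i) (hA : M.Alive x s f T) :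
    M.PathAdmissible x s (fun t i => f (min t T) i + g (t - T) i) := by
  have key : ∀ t i, M.pathSurplus y (s.shift T) t i ≤ M.pathSurplus x s (T + t) i - f T i :=
    fun t i => by
      have := hy i
      rw [pathSurplus_add, pathSurplus]
      linarith
  refine ⟨fun i u t hut hs => ?_, fun r t hrt hneg i => ?_⟩
  · rcases le_total t T with h1 | h1
    · simp only [min_eq_left h1, min_eq_left (hut.trans h1), tsub_eq_zero_of_le h1,
        tsub_eq_zero_of_le (hut.trans h1), hg0, add_zero]
      exact h.pay i u t hut hs
    obtain ⟨t, rfl⟩ := exists_add_of_le h1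
    simp only [min_eq_right h1, add_tsub_cancel_left]
    rcases le_total u T with h2 | h2
    -- The claim-free interval straddles `T`: the bound for `f` from `u` to `T` is chained with the
    -- bound for `g` from `0`.
    · simp only [min_eq_left h2, tsub_eq_zero_of_le h2, hg0, add_zero]
      have hsT : s T = s (T + t) := le_antisymm (s.mono h1) (hs ▸ s.mono h2)
      have e1 := h.pay i u T h2 (hs.trans hsT.symm)
      have e2 := h'.pay i 0 t zero_le (by simp [hsT])
      have e3 := pathSurplus_mono_time (M := M) (x := x) h1 hsT i
      have e4 := key t i
      rw [hg0] at e2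
      rcases le_max_iff.1 e1 with e1 | e1 <;> rcases le_max_iff.1 e2 with e2 | e2 <;>
        refine le_max_iff.2 ?_ <;> first | (left; linarith) | (right; linarith)
    · obtain ⟨u, rfl⟩ := exists_add_of_le h2
      simp only [min_eq_right h2, add_tsub_cancel_left]
      have e2 := h'.pay i u t (by simpa using hut) (by simpa using hs)
      have e4 := key t i
      rcases le_max_iff.1 e2 with e2 | e2
      · exact le_max_of_le_left (by linarith)
      · exact le_max_of_le_right (by linarith)
  -- Aliveness puts every ruin of the pasted path no earlier than `T`. From there the stopping
  -- condition of `g` applies, because the surplus for which `g` is admissible is at most the true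
  -- one.
  · have hr : T ≤ r := by
      by_contra! hr
      obtain ⟨j, hj⟩ := hA r hr.le
      have := hneg j
      rw [min_eq_left hr.le, tsub_eq_zero_of_le hr.le, hg0] at this
      linarith
    obtain ⟨t, rfl⟩ := exists_add_of_le (hr.trans hrt)
    obtain ⟨r, rfl⟩ := exists_add_of_le hr
    simp only [min_eq_right le_self_add, add_tsub_cancel_left] at hneg ⊢
    rw [h'.stopped r t (by simpa using hrt) fun j => ?_]
    linarith [hneg j, key r j]

/-- Ceasing all payments at time `T`. -/
theorem PathAdmissible.paste_zero (h : M.PathAdmissible x s f) (T : ℝ≥0) :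
    M.PathAdmissible x s (fun t i => f (min t T) i) := by
  refine ⟨fun i u t hut hs => ?_, fun r t hrt hneg i => ?_⟩
  · rcases le_total t T with h1 | h1
    · simp only [min_eq_left h1, min_eq_left (hut.trans h1)]
      exact h.pay i u t hut hs
    · rw [min_eq_right h1]
      rcases le_total u T with h2 | h2
      · rw [min_eq_left h2]
        have hsT : s T = s t := le_antisymm (s.mono h1) (hs ▸ s.mono h2)
        exact (h.pay i u T h2 (hs.trans hsT.symm)).trans
          (max_le_max le_rfl (pathSurplus_mono_time h1 hsT i))
      · rw [min_eq_right h2]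
        exact le_max_left _ _
  · rcases le_total r T with h1 | h1
    · simp only [min_eq_left h1] at hneg ⊢
      exact h.stopped _ _ (le_min hrt h1) hneg i
    · rw [min_eq_right h1, min_eq_right (h1.trans hrt)]

theorem pathAdmissible_zero (x : Fin 2 → ℝ) (s : StepPath) :
    M.PathAdmissible x s (fun _ _ => 0) :=
  ⟨fun _ _ _ _ _ => le_max_left _ _, fun _ _ _ _ _ => rfl⟩

end DegenerateRiskModel

/-! ### Discounted payments as exponential averages -/

/-- The discounted payments of a path `f`, as the integral of `f` against the exponential density;
for a left-continuous nondecreasing path started at `0` this is `∫_{[0, ∞)} e^{-q u} df(u)`. -/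
def payoff (q : ℝ) (f : ℝ≥0 → ℝ) : ℝ≥0∞ :=
  ∫⁻ u in Ioi (0 : ℝ), ENNReal.ofReal (q * Real.exp (-q * u)) * ENNReal.ofReal (f u.toNNReal)

theorem lintegral_exp_density {q : ℝ} (hq : 0 < q) (a : ℝ) :
    ∫⁻ u in Ioi a, ENNReal.ofReal (q * Real.exp (-q * u)) = ENNReal.ofReal (Real.exp (-q * a)) := by
  rw [← ofReal_integral_eq_lintegral_ofReal]
  · rw [integral_const_mul, integral_exp_mul_Ioi (by linarith)]
    congr 1
    field_simp
  · exact (integrableOn_exp_mul_Ioi (by linarith) a).const_mul q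
  · exact ae_of_all _ fun u => by positivity

/-- The Stieltjes function consists of the right limits of `f`, but its left limits are those of
`f`, which by left-continuity are the values of `f`. -/
theorem IsDividendPath.pathMeasure_Ico {f : ℝ≥0 → ℝ} (hf : IsDividendPath f) (b : ℝ) :
    pathMeasure f (Ico 0 b) = ENNReal.ofReal (f b.toNNReal) := by
  have hm : Monotone fun s : ℝ => f s.toNNReal := fun a b h => hf.mono (Real.toNNReal_mono h)
  rcases le_or_gt b 0 with hb | hb
  · rw [Ico_eq_empty (not_lt.2 hb), measure_empty, Real.toNNReal_of_nonpos hb, hf.zero,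
      ENNReal.ofReal_zero]
  have hleft : ∀ a : ℝ, Function.leftLim hm.stieltjesFunction a = f a.toNNReal := by
    intro a
    have h1 : Function.leftLim hm.stieltjesFunction a =
        Function.leftLim (fun s : ℝ => f s.toNNReal) a :=
      leftLim_rightLim (hm.tendsto_leftLim a)
    rw [h1]
    refine hm.continuousWithinAt_Iio_iff_leftLim_eq.1 ?_
    rcases le_or_gt a 0 with ha | ha
    · refine ContinuousWithinAt.congr (continuousWithinAt_const (b := f 0)) (fun u hu => ?_) ?_
      · rw [Real.toNNReal_of_nonpos (le_of_lt (lt_of_lt_of_le hu ha))]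
      · rw [Real.toNNReal_of_nonpos ha]
    · refine (hf.isCaglad a.toNNReal).1.comp (t := Iio a.toNNReal)
        continuous_real_toNNReal.continuousWithinAt fun u hu => ?_
      exact (Real.toNNReal_lt_toNNReal_iff ha).2 hu
  rw [pathMeasure, dif_pos hm, StieltjesFunction.measure_Ico, hleft, hleft, Real.toNNReal_zero,
    hf.zero, sub_zero]

/-- Required for exchanging the integrals in `IsDividendPath.discountedIntegral_eq`. -/
instance (f : ℝ≥0 → ℝ) : SFinite (pathMeasure f) := by
  rw [pathMeasure]
  split_ifs <;> infer_instance

/-- The discounted payments before `T` in terms of the path stopped at `T`. -/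
theorem IsDividendPath.discountedIntegral_eq {q : ℝ} (hq : 0 < q) {f : ℝ≥0 → ℝ}
    (hf : IsDividendPath f) (T : WithTop ℝ≥0) :
    discountedIntegral q f T = payoff q fun u => f ((min (u : WithTop ℝ≥0) T).untopD 0) := by
  set A : Set ℝ := {s : ℝ | 0 ≤ s ∧ (s.toNNReal : WithTop ℝ≥0) < T}
  have hA : MeasurableSet A := by
    refine measurableSet_Ici.inter ?_
    have : OrdConnected {s : ℝ | (s.toNNReal : WithTop ℝ≥0) < T} :=
      ⟨fun a _ b hb c hc => lt_of_le_of_lt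
        (WithTop.coe_le_coe.2 (Real.toNNReal_mono hc.2)) hb⟩
    exact this.measurableSet
  have hinner : ∀ u : ℝ, 0 < u → pathMeasure f (A ∩ Iio u) =
      ENNReal.ofReal (f ((min ((u.toNNReal : ℝ≥0) : WithTop ℝ≥0) T).untopD 0)) := by
    intro u hu
    have : A ∩ Iio u = Ico 0 ((((min ((u.toNNReal : ℝ≥0) : WithTop ℝ≥0) T).untopD 0 : ℝ≥0)) : ℝ) := by
      ext v
      simp only [A, mem_inter_iff, mem_ofPred_eq, mem_Iio, mem_Ico, and_assoc]
      refine and_congr_right fun hv => ?_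
      induction T with
      | top =>
        rw [min_eq_left le_top, WithTop.untopD_coe, Real.coe_toNNReal _ hu.le]
        exact and_iff_right (WithTop.coe_lt_top _)
      | coe T =>
        rw [← WithTop.coe_min, WithTop.untopD_coe, WithTop.coe_lt_coe, NNReal.coe_min,
          Real.coe_toNNReal _ hu.le, lt_min_iff, and_comm]
        refine and_congr_right fun _ => ?_
        rw [← NNReal.coe_lt_coe, Real.coe_toNNReal _ hv]
    rw [this, hf.pathMeasure_Ico, Real.toNNReal_coe]
  have hmeas : Measurable fun p : ℝ × ℝ => ENNReal.ofReal (q * Real.exp (-q * p.2)) := by fun_prop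
  -- Integration by parts in the form of Tonelli's theorem: `e^{-q s}` is the integral of `q e^{-q
  -- u}` over `u > s`, and after the swap the inner integral is the mass of `[0, min u T)`.
  calc discountedIntegral q f T
      = ∫⁻ s in A, (∫⁻ u in Ioi (0 : ℝ), (Iio u).indicator
          (fun _ => ENNReal.ofReal (q * Real.exp (-q * u))) s) ∂(pathMeasure f) := by
        refine setLIntegral_congr_fun hA fun s hs => ?_
        have hs0 : 0 ≤ s := hs.1
        rw [← lintegral_exp_density hq s, ← inter_eq_right.2 (Ioi_subset_Ioi hs0),
          inter_comm, ← setLIntegral_indicator measurableSet_Ioi]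
        refine lintegral_congr fun u => ?_
        by_cases h : s < u <;> simp [h, indicator]
    _ = ∫⁻ u in Ioi (0 : ℝ), ∫⁻ s in A, (Iio u).indicator
          (fun _ => ENNReal.ofReal (q * Real.exp (-q * u))) s ∂(pathMeasure f) := by
        refine lintegral_lintegral_swap (Measurable.aemeasurable ?_)
        have : (Function.uncurry fun (s u : ℝ) => (Iio u).indicator
            (fun _ => ENNReal.ofReal (q * Real.exp (-q * u))) s) =
            {p : ℝ × ℝ | p.1 < p.2}.indicator
              fun p => ENNReal.ofReal (q * Real.exp (-q * p.2)) := by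
          ext p
          by_cases h : p.1 < p.2 <;> simp [h, indicator, Function.uncurry]
        rw [this]
        exact hmeas.indicator (measurableSet_lt measurable_fst measurable_snd)
    _ = payoff q fun u => f ((min (u : WithTop ℝ≥0) T).untopD 0) := by
        refine setLIntegral_congr_fun measurableSet_Ioi fun u hu => ?_
        dsimp only
        rw [lintegral_indicator_const measurableSet_Iio, Measure.restrict_apply measurableSet_Iio,
          inter_comm, hinner u hu]

theorem payoff_zero (q : ℝ) : payoff q (fun _ => 0) = 0 := by simp [payoff]

/-- The discounted payments of a path that follows `f` up to time `T` and `g` afterwards. -/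
theorem payoff_paste (q : ℝ) {f g : ℝ≥0 → ℝ} (hf : IsDividendPath f) (hg : IsDividendPath g)
    (T : ℝ≥0) :
    payoff q (fun t => f (min t T) + g (t - T)) =
      payoff q (fun t => f (min t T)) + ENNReal.ofReal (Real.exp (-q * T)) * payoff q g := by
  have hmf : Measurable fun u : ℝ => f (min u.toNNReal T) :=
    hf.mono.measurable.comp (measurable_real_toNNReal.min measurable_const)
  have hmg : Measurable fun u : ℝ => g u.toNNReal := hg.mono.measurable.comp measurable_real_toNNReal
  have h1 : payoff q (fun t => f (min t T) + g (t - T)) = payoff q (fun t => f (min t T)) +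
      ∫⁻ u in Ioi (0 : ℝ), ENNReal.ofReal (q * Real.exp (-q * u)) *
        ENNReal.ofReal (g (u.toNNReal - T)) := by
    rw [payoff, payoff, ← lintegral_add_left]
    · refine lintegral_congr fun u => ?_
      rw [ENNReal.ofReal_add (hf.nonneg _) (hg.nonneg _), mul_add]
    · exact (by fun_prop : Measurable fun u : ℝ => ENNReal.ofReal (q * Real.exp (-q * u))).mul
        hmf.ennreal_ofReal
  rw [h1]
  congr 1
  -- Substitution `u = v + T`. The integrand vanishes for `v ≤ 0` because `g 0 = 0`, and the density
  -- yields the factor `e^{-q T}`.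
  set φ : ℝ → ℝ≥0∞ := (Ioi (0 : ℝ)).indicator fun u => ENNReal.ofReal (q * Real.exp (-q * u)) *
        ENNReal.ofReal (g (u.toNNReal - T))
  have h2 : ∀ v : ℝ, φ (v + T) = ENNReal.ofReal (Real.exp (-q * T)) *
      (Ioi (0 : ℝ)).indicator (fun u => ENNReal.ofReal (q * Real.exp (-q * u)) *
        ENNReal.ofReal (g u.toNNReal)) v := by
    intro v
    have hsub : (v + T).toNNReal - T = v.toNNReal := by
      rcases le_total 0 v with hv | hv
      · rw [Real.toNNReal_add hv T.coe_nonneg, Real.toNNReal_coe, add_tsub_cancel_right]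
      · rw [Real.toNNReal_of_nonpos hv, tsub_eq_zero_iff_le, Real.toNNReal_le_iff_le_coe]
        linarith
    by_cases hv : 0 < v
    · have hv' : 0 < v + T := by positivity
      simp only [φ, indicator, mem_Ioi, hv, hv', if_true, hsub]
      rw [← mul_assoc, ← ENNReal.ofReal_mul (Real.exp_pos _).le]
      congr 2
      rw [show -q * (v + T) = -q * T + -q * v by ring, Real.exp_add]
      ring
    · simp only [φ, indicator, mem_Ioi, hv, if_false, hsub,
        Real.toNNReal_of_nonpos (not_lt.1 hv), hg.zero, ENNReal.ofReal_zero, mul_zero]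
      split_ifs <;> rfl
  rw [← lintegral_indicator measurableSet_Ioi]
  change ∫⁻ u, φ u = _
  rw [← lintegral_add_right_eq_self φ (T : ℝ), lintegral_congr h2, lintegral_const_mul,
    lintegral_indicator measurableSet_Ioi]
  · rfl
  · exact ((by fun_prop : Measurable fun u : ℝ => ENNReal.ofReal (q * Real.exp (-q * u))).mul
      hmg.ennreal_ofReal).indicator measurableSet_Ioi

/-- Splitting discounted payments at time `T`. -/
theorem payoff_split (q : ℝ) {f : ℝ≥0 → ℝ} (hf : IsDividendPath f) (T : ℝ≥0) :
    payoff q f = payoff q (fun t => f (min t T)) +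
      ENNReal.ofReal (Real.exp (-q * T)) * payoff q fun t => f (T + t) - f T := by
  rw [← payoff_paste q hf (hf.shift T)]
  congr 1
  ext t
  rcases le_total t T with h | h
  · simp [h, tsub_eq_zero_of_le h]
  · simp [h, add_tsub_cancel_of_le h]

theorem payoff_mono {q : ℝ} {f g : ℝ≥0 → ℝ} (h : ∀ t, f t ≤ g t) : payoff q f ≤ payoff q g :=
  lintegral_mono fun u => by gcongr; exact h _

theorem payoff_affine_lt_top {q : ℝ} (hq : 0 < q) (a b : ℝ) :
    payoff q (fun t => a + b * t) < ∞ := by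
  have h1 : IntegrableOn (fun u : ℝ => Real.exp (-q * u)) (Ioi 0) :=
    integrableOn_exp_mul_Ioi (by linarith) 0
  have h2 : IntegrableOn (fun u : ℝ => u * Real.exp (-q * u)) (Ioi 0) := by
    -- Dominating function: `u e^{-q u} ≤ (2 / q) e^{-(q / 2) u}`, since `(q / 2) u ≤ e^{(q / 2)
    -- u}`.
    have h3 : IntegrableOn (fun u : ℝ => (2 / q) * Real.exp (-(q / 2) * u)) (Ioi 0) :=
      (integrableOn_exp_mul_Ioi (by linarith) 0).const_mul _
    refine h3.mono' (by fun_prop) ?_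
    refine (ae_restrict_iff' measurableSet_Ioi).2 (ae_of_all _ fun u hu => ?_)
    have hu0 : (0 : ℝ) < u := hu
    rw [Real.norm_of_nonneg (by positivity),
      show -q * u = -(q / 2) * u + -(q / 2) * u by ring, Real.exp_add, ← mul_assoc]
    refine mul_le_mul_of_nonneg_right ?_ (Real.exp_pos _).le
    have h4 := Real.add_one_le_exp (q / 2 * u)
    rw [neg_mul, Real.exp_neg, ← div_eq_mul_inv, div_le_iff₀ (Real.exp_pos _)]
    calc u = 2 / q * (q / 2 * u) := by field_simp
      _ ≤ _ := by gcongr; linarith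
  have h5 : IntegrableOn (fun u : ℝ => q * Real.exp (-q * u) * (a + b * u)) (Ioi 0) := by
    have := (h1.const_mul (q * a)).add (h2.const_mul (q * b))
    refine this.congr (ae_of_all _ fun u => ?_)
    simp only [Pi.add_apply]
    ring
  refine lt_of_eq_of_lt ?_ h5.lintegral_lt_top
  refine setLIntegral_congr_fun measurableSet_Ioi fun u hu => ?_
  have hu0 : (0 : ℝ) < u := hu
  dsimp only
  rw [Real.coe_toNNReal _ hu0.le,
    ENNReal.ofReal_mul (p := q * Real.exp (-q * u)) (by positivity)]

theorem measurable_payoff {α : Type*} {_ : MeasurableSpace α} (q : ℝ) {f : α → ℝ≥0 → ℝ}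
    (hf : Measurable fun p : α × ℝ≥0 => f p.1 p.2) : Measurable fun a => payoff q (f a) := by
  refine Measurable.lintegral_prod_right' (f := fun p : α × ℝ =>
    ENNReal.ofReal (q * Real.exp (-q * p.2)) * ENNReal.ofReal (f p.1 p.2.toNNReal)) ?_
  exact (by fun_prop : Measurable fun p : α × ℝ => ENNReal.ofReal (q * Real.exp (-q * p.2))).mul
    (hf.comp (measurable_fst.prodMk (measurable_real_toNNReal.comp measurable_snd))).ennreal_ofReal

/-! ### Admissible strategies as rules -/

/-- A process with nondecreasing left-continuous paths that is adapted is predictable. -/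
theorem isStronglyPredictable_of_isDividendPath {Ω : Type*} {m : MeasurableSpace Ω}
    {ℱ : Filtration ℝ≥0 m} {L : ℝ≥0 → Ω → Fin 2 → ℝ}
    (hL : ∀ ω i, IsDividendPath fun t => L t ω i) (hm : ∀ t i, Measurable[ℱ t] fun ω => L t ω i) :
    IsStronglyPredictable ℱ L := by
  suffices h : Measurable[ℱ.predictable] (Function.uncurry L) from h.stronglyMeasurable
  refine @measurable_pi_lambda _ _ _ ℱ.predictable _ _ fun i => ?_
  refine measurable_of_Ioi (mδ := ℱ.predictable) fun a => ?_
  rcases lt_or_ge a 0 with ha | ha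
  · have : (fun p : ℝ≥0 × Ω => Function.uncurry L p i) ⁻¹' Ioi a = univ := by
      ext p
      simpa [Function.uncurry] using ha.trans_le ((hL p.2 i).nonneg p.1)
    rw [this]
    exact @MeasurableSet.univ _ ℱ.predictable
  -- By left-continuity the superlevel set is a countable union of predictable rectangles.
  · have : (fun p : ℝ≥0 × Ω => Function.uncurry L p i) ⁻¹' Ioi a =
        ⋃ n, Ioi (denseTime n) ×ˢ {ω | a < L (denseTime n) ω i} := by
      ext p
      simp only [mem_preimage, mem_Ioi, mem_iUnion, mem_prod, mem_ofPred_eq]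
      exact (hL p.2 i).lt_iff_exists_denseTime ha
    rw [this]
    refine @MeasurableSet.iUnion _ _ ℱ.predictable _ _ fun n => ?_
    exact measurableSet_predictable_Ioi_prod (hm _ i measurableSet_Ioi)

namespace DegenerateRiskModel

variable {Ω : Type*} [mΩ : MeasurableSpace Ω] {P : Measure Ω} (M : DegenerateRiskModel Ω P)

/-- The aggregate claims as a random step path. -/
def claimPath (ω : Ω) : StepPath where
  toFun t := M.claims t ω
  mono' u v h := Finset.sum_le_sum_of_subset_of_nonneg
    (Finset.range_mono (M.poisson.mono ω h)) fun n _ _ => M.U_nonneg n ω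
  zero' := by simp [claims, M.poisson.zero ω]
  right' t := by
    have h := M.poisson.rightCts ω t
    have h1 : ∀ᶠ u in 𝓝[>] t, M.N u ω = M.N t ω :=
      (h.eventually (IsOpen.mem_nhds (isOpen_discrete {M.N t ω}) rfl)).filter_mono
        (nhdsWithin_mono _ Ioi_subset_Ici_self)
    obtain ⟨v, hv, h2⟩ := exists_forall_of_eventually_nhdsGT h1
    obtain ⟨w, hw1, hw2⟩ := exists_between hv
    exact ⟨w, hw1, by rw [claims, claims, h2 w hw1 hw2]⟩

@[simp] theorem claimPath_apply (ω : Ω) (t : ℝ≥0) : M.claimPath ω t = M.claims t ω := rfl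

theorem measurable_claimPath : Measurable M.claimPath :=
  StepPath.measurable_of_apply M.measurable_claims

/-- The information up to time `t` is carried by the claim path stopped at `t`. -/
theorem filtration_eq_comap (x : Fin 2 → ℝ) (t : ℝ≥0) :
    (M.filtration x t : MeasurableSpace Ω) =
      MeasurableSpace.comap (fun ω => (M.claimPath ω).stopAt t) inferInstance := by
  refine le_antisymm ?_ ?_
  · refine iSup₂_le fun u hu => ?_
    refine measurable_iff_comap_le.1 ?_
    have h := comap_measurable (m := inferInstanceAs (MeasurableSpace StepPath))
      fun ω => (M.claimPath ω).stopAt t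
    refine @measurable_pi_lambda _ _ _ (MeasurableSpace.comap _ _) _ _ fun i => ?_
    have h2 : (fun ω => M.surplus x u ω i) =
        (fun s : StepPath => x i + M.c i * u - M.b i * s u) ∘
          fun ω => (M.claimPath ω).stopAt t := by
      ext ω
      simp [surplus, min_eq_left hu]
    rw [h2]
    exact (((StepPath.measurable_apply u).const_mul _).const_sub _).comp h
  · refine measurable_iff_comap_le.1 ?_
    refine @StepPath.measurable_of_apply _ (M.filtration x t) _ fun u => ?_
    have h1 : Measurable[M.filtration x t] (M.surplus x (min u t)) :=
      (measurable_iff_comap_le.2 (le_iSup₂_of_le (min u t) (min_le_right u t) le_rfl))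
    have h2 : Measurable[M.filtration x t] fun ω => M.surplus x (min u t) ω 0 :=
      (measurable_pi_apply 0).comp h1
    -- As `b 0 > 0`, the first branch alone reveals the claims.
    have h3 : (fun ω => (M.claimPath ω).stopAt t u) =
        fun ω => (x 0 + M.c 0 * (min u t : ℝ≥0) - M.surplus x (min u t) ω 0) / M.b 0 := by
      ext ω
      have := (M.b_pos 0).ne'
      simp only [StepPath.stopAt_apply, claimPath_apply, surplus]
      field_simp
      ring
    rw [h3]
    exact (h2.const_sub _).div_const _

theorem measurable_stopAt_claimPath (x : Fin 2 → ℝ) (t : ℝ≥0) :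
    Measurable[M.filtration x t] fun ω => (M.claimPath ω).stopAt t := by
  rw [filtration_eq_comap]
  exact comap_measurable _

/-- The law of the claim path. -/
def pathLaw : Measure StepPath := P.map M.claimPath

instance [IsProbabilityMeasure P] : IsProbabilityMeasure M.pathLaw :=
  Measure.isProbabilityMeasure_map M.measurable_claimPath.aemeasurable

/-- A rule that is admissible along almost every claim path. -/
def AdmissibleRule (x : Fin 2 → ℝ) (F : PathStrategy) : Prop :=
  ∀ᵐ s ∂M.pathLaw, M.PathAdmissible x s (F s)

/-- The discounted payments of both branches. -/
def pathPayoff (f : ℝ≥0 → Fin 2 → ℝ) : ℝ≥0∞ := ∑ i, payoff M.q fun t => f t i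

/-- The expected discounted payments of a rule. -/
def ruleValue (F : PathStrategy) : ℝ≥0∞ := ∫⁻ s, M.pathPayoff (F s) ∂M.pathLaw

variable {M} {x : Fin 2 → ℝ}

theorem measurable_pathPayoff {α : Type*} {_ : MeasurableSpace α} {f : α → ℝ≥0 → Fin 2 → ℝ}
    (hf : ∀ i, Measurable fun p : α × ℝ≥0 => f p.1 p.2 i) :
    Measurable fun a => M.pathPayoff (f a) :=
  Finset.measurable_sum _ fun i _ => measurable_payoff M.q (hf i)

theorem measurable_pathPayoff_rule (F : PathStrategy) : Measurable fun s => M.pathPayoff (F s) :=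
  measurable_pathPayoff fun i => F.measurable_eval_comp measurable_fst measurable_snd i

theorem ruleValue_eq (F : PathStrategy) :
    M.ruleValue F = ∫⁻ ω, M.pathPayoff (F (M.claimPath ω)) ∂P :=
  lintegral_map (measurable_pathPayoff_rule F) M.measurable_claimPath

theorem admissibleRule_iff {F : PathStrategy} :
    M.AdmissibleRule x F ↔ ∀ᵐ ω ∂P, M.PathAdmissible x (M.claimPath ω) (F (M.claimPath ω)) :=
  ae_map_iff M.measurable_claimPath.aemeasurable (measurableSet_pathAdmissible x F)

/-- The discounted payments before `T` or ruin are those before `T`. -/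
theorem PathAdmissible.sum_discountedIntegral {s : StepPath} {f : ℝ≥0 → Fin 2 → ℝ}
    (h : M.PathAdmissible x s f) (hf : ∀ i, IsDividendPath fun t => f t i) (T : WithTop ℝ≥0) :
    ∑ i, discountedIntegral M.q (fun t => f t i) (min T (M.pathRuinTime x s f)) =
      M.pathPayoff fun t i => f ((min (t : WithTop ℝ≥0) T).untopD 0) i := by
  refine Finset.sum_congr rfl fun i _ => ?_
  rw [(hf i).discountedIntegral_eq M.q_pos]
  congr 1
  ext u
  obtain ⟨v, hv⟩ := WithTop.ne_top_iff_exists.1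
    ((min_le_left (u : WithTop ℝ≥0) T).trans_lt (WithTop.coe_lt_top u)).ne
  simp only [← min_assoc, ← hv, WithTop.untopD_coe]
  rcases le_total (v : WithTop ℝ≥0) (M.pathRuinTime x s f) with h1 | h1
  · rw [min_eq_left h1, WithTop.untopD_coe]
  -- Payments are frozen after ruin, so truncating there changes nothing.
  · obtain ⟨r, hr⟩ := WithTop.ne_top_iff_exists.1 (h1.trans_lt (WithTop.coe_lt_top v)).ne
    rw [min_eq_right h1, ← hr, WithTop.untopD_coe]
    rw [← hr, WithTop.coe_le_coe] at h1
    exact (h.stopped_at_ruin i r v hr.symm h1).symm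

theorem IsAdmissible.of_path {L : ℝ≥0 → Ω → Fin 2 → ℝ}
    (hL : ∀ ω i, IsDividendPath fun t => L t ω i)
    (hm : ∀ t i, Measurable[M.filtration x t] fun ω => L t ω i)
    (h : ∀ᵐ ω ∂P, M.PathAdmissible x (M.claimPath ω) fun t => L t ω) : M.IsAdmissible x L where
  predictable := isStronglyPredictable_of_isDividendPath hL hm
  mono := ae_of_all _ fun ω i => (hL ω i).mono
  caglad := ae_of_all _ fun ω i => (hL ω i).isCaglad
  zero := ae_of_all _ fun ω i => (hL ω i).zero
  no_pay := h.mono fun ω hω _ _ hlt => hω.no_pay (hL ω) hlt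
  no_ruin_by_pay := h.mono fun _ hω _ _ hle => hω.no_ruin hle
  stopped := h.mono fun _ hω i r t hr hrt => hω.stopped_at_ruin i r t hr hrt

theorem lintegral_pathPayoff_le_value (hx : x ∈ solvencySet) {L : ℝ≥0 → Ω → Fin 2 → ℝ}
    (hL : ∀ ω i, IsDividendPath fun t => L t ω i)
    (hm : ∀ t i, Measurable[M.filtration x t] fun ω => L t ω i)
    (h : ∀ᵐ ω ∂P, M.PathAdmissible x (M.claimPath ω) fun t => L t ω) :
    ∫⁻ ω, M.pathPayoff (fun t => L t ω) ∂P ≤ M.value x := by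
  have h1 : ∫⁻ ω, M.pathPayoff (fun t => L t ω) ∂P = M.strategyValue x L := by
    refine lintegral_congr_ae (h.mono fun ω hω => ?_)
    have := hω.sum_discountedIntegral (hL ω) ⊤
    simp only [min_eq_left le_top, WithTop.untopD_coe, min_eq_right le_top] at this
    exact this.symm
  rw [h1, value, if_pos hx]
  exact le_iSup₂_of_le L (.of_path hL hm h) le_rfl

theorem measurable_rule_claimPath (F : PathStrategy) (x : Fin 2 → ℝ) (t : ℝ≥0) (i : Fin 2) :
    Measurable[M.filtration x t] fun ω => F (M.claimPath ω) t i := by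
  have : (fun ω => F (M.claimPath ω) t i) = (fun s => F s t i) ∘
      fun ω => (M.claimPath ω).stopAt t := by
    ext ω
    rw [Function.comp_apply, F.nonanticipating _ ((M.claimPath ω).stopAt t) t fun u hu => by
      rw [StepPath.stopAt_apply, min_eq_left hu.le]]
  rw [this]
  exact (F.measurable_apply t i).comp (M.measurable_stopAt_claimPath x t)

theorem ruleValue_le_value (hx : x ∈ solvencySet) {F : PathStrategy} (hF : M.AdmissibleRule x F) :
    M.ruleValue F ≤ M.value x := by
  rw [ruleValue_eq]
  exact lintegral_pathPayoff_le_value (L := fun t ω => F (M.claimPath ω) t) hx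
    (fun ω i => F.isDividendPath _ i) (measurable_rule_claimPath F x) (admissibleRule_iff.1 hF)

/-- A bounded dividend path whose value at each dense time is a measurable function of the claims up to
that time is generated by a rule, uniformly in the path. -/
theorem exists_rule_of_adapted (B : Fin 2 → ℝ≥0 → ℝ) (hB : ∀ i, Monotone (B i))
    (hB0 : ∀ i t, 0 ≤ B i t) (G : ℕ → StepPath → Fin 2 → ℝ) (hG : ∀ n, Measurable (G n)) :
    ∃ F : PathStrategy, ∀ s (f : ℝ≥0 → Fin 2 → ℝ), (∀ i, IsDividendPath fun t => f t i) →
      (∀ i t, f t i ≤ B i t) → (∀ n, f (denseTime n) = G n (s.stopAt (denseTime n))) →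
      F s = f := by
  classical
  -- The rule is the supremum of `term` over `n`. Only dense times before `t` contribute, which
  -- gives left-continuity and nonanticipation; clipping to `[0, B]` keeps the supremum finite along
  -- every path, also where `G` does not come from a dividend path.
  set term : StepPath → ℝ≥0 → Fin 2 → ℕ → ℝ := fun s t i n =>
    if denseTime n < t then max 0 (min (G n (s.stopAt (denseTime n)) i) (B i (denseTime n))) else 0
  have hle : ∀ s t i n, term s t i n ≤ B i t := fun s t i n => by
    simp only [term]
    split_ifs with h
    · exact max_le (hB0 i t) ((min_le_right _ _).trans (hB i h.le))
    · exact hB0 i t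
  have h0 : ∀ s t i n, 0 ≤ term s t i n := fun s t i n => by
    simp only [term]
    split_ifs with h
    · exact le_max_left _ _
    · exact le_rfl
  have hbdd : ∀ s t i, BddAbove (range (term s t i)) := fun s t i =>
    ⟨B i t, by rintro _ ⟨n, rfl⟩; exact hle s t i n⟩
  refine ⟨⟨fun s t i => ⨆ n, term s t i n, fun t => ?_, fun s s' t h => ?_, fun s i => ?_⟩,
    fun s f hf hfB hfG => ?_⟩
  · refine measurable_pi_lambda _ fun i => Measurable.iSup fun n => ?_
    simp only [term]
    split_ifs
    · refine measurable_const.max (Measurable.min ?_ measurable_const)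
      exact (measurable_pi_apply i).comp ((hG n).comp
        (StepPath.measurable_stopAt measurable_id measurable_const))
    · exact measurable_const
  · ext i
    congr 1
    ext n
    simp only [term]
    split_ifs with hn
    · have : s.stopAt (denseTime n) = s'.stopAt (denseTime n) := by
        ext u
        exact h _ ((min_le_right _ _).trans_lt hn)
      rw [this]
    · rfl
  · refine ⟨fun u v huv => ciSup_mono (hbdd s v i) fun n => ?_, ?_, fun t a ht ha => ?_⟩
    · simp only [term]
      split_ifs with h1 h2 h2
      · exact le_rfl
      · exact absurd (h1.trans_le huv) h2
      · exact le_max_left _ _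
      · exact le_rfl
    · simp [term]
    · refine ciSup_le fun n => ?_
      by_cases hn : denseTime n < t
      · obtain ⟨u, hu1, hu2⟩ := exists_between hn
        refine le_trans ?_ (ha u hu2)
        refine le_trans ?_ (le_ciSup (hbdd s u i) n)
        simp [term, hn, hu1]
      · have : term s t i n = 0 := by simp [term, hn]
        rw [this]
        exact (h0 s 0 i 0).trans ((le_ciSup (hbdd s 0 i) 0).trans (ha 0 ht))
  · ext t i
    have hterm : ∀ n, denseTime n < t → term s t i n = f (denseTime n) i := fun n hn => by
      simp only [term, hn, if_true, ← hfG n, min_eq_left (hfB i _), max_eq_right ((hf i).nonneg _)]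
    change ⨆ n, term s t i n = f t i
    refine le_antisymm (ciSup_le fun n => ?_) ?_
    · by_cases hn : denseTime n < t
      · rw [hterm n hn]
        exact (hf i).mono hn.le
      · have : term s t i n = 0 := by simp [term, hn]
        rw [this]
        exact (hf i).nonneg t
    · rcases eq_zero_or_pos t with rfl | ht
      · rw [(hf i).zero]
        exact (h0 s 0 i 0).trans (le_ciSup (hbdd s 0 i) 0)
      · refine (hf i).le_of_forall_denseTime ht fun n _ hn => ?_
        rw [← hterm n hn]
        exact le_ciSup (hbdd s t i) n

/-- Every admissible strategy is given by a rule, up to a null set. -/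
theorem IsAdmissible.exists_rule (hx : x ∈ solvencySet) {L : ℝ≥0 → Ω → Fin 2 → ℝ}
    (hL : M.IsAdmissible x L) :
    ∃ F : PathStrategy, M.AdmissibleRule x F ∧
      ∀ᵐ ω ∂P, (fun t => L t ω) = F (M.claimPath ω) := by
  -- Doob–Dynkin: measurability with respect to the stopped claim path means factoring through it.
  have hfac : ∀ n, ∃ G : StepPath → Fin 2 → ℝ, Measurable G ∧
      L (denseTime n) = G ∘ fun ω => (M.claimPath ω).stopAt (denseTime n) := fun n => by
    have h1 := (hL.predictable.stronglyAdapted (denseTime n)).measurable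
    rw [filtration_eq_comap] at h1
    exact h1.exists_eq_measurable_comp
  choose G hG hGL using hfac
  -- The ceiling is the a priori bound `PathAdmissible.le_bound`.
  obtain ⟨F, hF⟩ := exists_rule_of_adapted (fun i t => max (x i) 0 + M.c i * t)
    (fun i u v h => by
      have : M.c i * (u : ℝ) ≤ M.c i * v :=
        mul_le_mul_of_nonneg_left (by exact_mod_cast h) (M.c_pos i).le
      dsimp only
      linarith)
    (fun i t => by have := M.c_pos i; positivity) G hG
  have key : ∀ᵐ ω ∂P, (fun t => L t ω) = F (M.claimPath ω) ∧
      M.PathAdmissible x (M.claimPath ω) (F (M.claimPath ω)) := by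
    filter_upwards [hL.mono, hL.caglad, hL.zero, hL.no_pay, hL.no_ruin_by_pay, hL.stopped]
      with ω h1 h2 h3 h4 h5 h6
    have hd : ∀ i, IsDividendPath fun t => L t ω i := fun i =>
      .of_leftContinuous (h1 i) (h3 i) fun t => (h2 i t).1
    have hadm : M.PathAdmissible x (M.claimPath ω) fun t => L t ω :=
      .of_rules hx hd h4 h5 h6
    have := hF (M.claimPath ω) (fun t => L t ω) hd (hadm.le_bound hd) fun n => by
      rw [hGL n]; rfl
    exact ⟨this.symm, this ▸ hadm⟩
  exact ⟨F, admissibleRule_iff.2 (key.mono fun _ h => h.2), key.mono fun _ h => h.1⟩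

theorem ruinTime_eq {L : ℝ≥0 → Ω → Fin 2 → ℝ} {ω : Ω} :
    M.ruinTime x L ω = M.pathRuinTime x (M.claimPath ω) fun t => L t ω := rfl

/-- The supremum may be taken over rules: each admissible strategy agrees almost surely with one,
and cutting its payments at ruin does not change the payoff. -/
theorem value_le (hx : x ∈ solvencySet) {C : ℝ≥0∞}
    (h : ∀ F, M.AdmissibleRule x F → M.ruleValue F ≤ C) : M.value x ≤ C := by
  rw [value, if_pos hx]
  refine iSup₂_le fun L hL => ?_
  obtain ⟨F, hF, hLF⟩ := hL.exists_rule hx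
  refine le_trans (le_of_eq ?_) (h F hF)
  rw [ruleValue_eq]
  refine lintegral_congr_ae ?_
  filter_upwards [hLF, admissibleRule_iff.1 hF] with ω h1 h2
  have := h2.sum_discountedIntegral (F.isDividendPath _) ⊤
  rw [← h1] at this ⊢
  simp only [min_eq_left le_top, WithTop.untopD_coe, min_eq_right le_top] at this
  exact this

/-- Payments are bounded by an affine function of time, uniformly in the path and the rule, and its
discounted payoff is finite. -/
theorem value_lt_top [IsProbabilityMeasure P] (M : DegenerateRiskModel Ω P) (x : Fin 2 → ℝ) :
    M.value x < ∞ := by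
  by_cases hx : x ∈ solvencySet
  · have hfin : M.pathPayoff (fun t i => max (x i) 0 + M.c i * t) < ∞ :=
      ENNReal.sum_lt_top.2 fun i _ => payoff_affine_lt_top M.q_pos _ _
    refine lt_of_le_of_lt (value_le hx fun F hF => ?_) hfin
    calc M.ruleValue F ≤ ∫⁻ _, M.pathPayoff (fun t i => max (x i) 0 + M.c i * t) ∂M.pathLaw := by
          refine lintegral_mono_ae (hF.mono fun s hs => Finset.sum_le_sum fun i _ => ?_)
          exact payoff_mono fun t => hs.le_bound (F.isDividendPath s) i t
      _ = _ := by simp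
  · rw [value, if_neg hx]
    exact ENNReal.zero_lt_top

end DegenerateRiskModel

/-! ### Independence and the Markov property at fixed times -/

theorem comap_prod_eq_generateFrom {Ω α β : Type*} [MeasurableSpace α] [MeasurableSpace β]
    (f : Ω → α × β) :
    Prod.instMeasurableSpace.comap f = MeasurableSpace.generateFrom
      {s | ∃ t ∈ image2 (· ×ˢ ·) {s : Set α | MeasurableSet s} {t : Set β | MeasurableSet t},
        f ⁻¹' t = s} := by
  rw [← generateFrom_prod, MeasurableSpace.comap_generateFrom]
  rfl

/-- On rectangles, the probability factors over all four variables and can be regrouped. Applied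
with claim sizes as `X` and claim counts as `Y`, indexed by past and future. -/
theorem ProbabilityTheory.IndepFun.prodMk_prodMk_of_indep {Ω α₁ α₂ β₁ β₂ : Type*}
    {mΩ : MeasurableSpace Ω} {P : Measure Ω} [IsZeroOrProbabilityMeasure P]
    [MeasurableSpace α₁] [MeasurableSpace α₂] [MeasurableSpace β₁] [MeasurableSpace β₂]
    {X₁ : Ω → α₁} {X₂ : Ω → α₂} {Y₁ : Ω → β₁} {Y₂ : Ω → β₂}
    (hX₁ : Measurable X₁) (hX₂ : Measurable X₂) (hY₁ : Measurable Y₁) (hY₂ : Measurable Y₂)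
    (hX : IndepFun X₁ X₂ P) (hY : IndepFun Y₁ Y₂ P)
    (h : IndepFun (fun ω => (X₁ ω, X₂ ω)) (fun ω => (Y₁ ω, Y₂ ω)) P) :
    IndepFun (fun ω => (X₁ ω, Y₁ ω)) (fun ω => (X₂ ω, Y₂ ω)) P := by
  refine IndepSets.indep (hX₁.prodMk hY₁).comap_le (hX₂.prodMk hY₂).comap_le
    (IsPiSystem.comap isPiSystem_prod _) (IsPiSystem.comap isPiSystem_prod _)
    (comap_prod_eq_generateFrom _) (comap_prod_eq_generateFrom _) ?_
  rw [IndepSets_iff]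
  rintro - - ⟨-, ⟨a, ha, b, hb, rfl⟩, rfl⟩ ⟨-, ⟨c, hc, d, hd, rfl⟩, rfl⟩
  have h1 := indepFun_iff_measure_inter_preimage_eq_mul.1 h (a ×ˢ c) (b ×ˢ d) (ha.prod hc)
    (hb.prod hd)
  have e1 := indepFun_iff_measure_inter_preimage_eq_mul.1 hX a c ha hc
  have e2 := indepFun_iff_measure_inter_preimage_eq_mul.1 hY b d hb hd
  have e3 := indepFun_iff_measure_inter_preimage_eq_mul.1 h (a ×ˢ univ) (b ×ˢ univ)
    (ha.prod .univ) (hb.prod .univ)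
  have e4 := indepFun_iff_measure_inter_preimage_eq_mul.1 h (univ ×ˢ c) (univ ×ˢ d)
    (MeasurableSet.univ.prod hc) (MeasurableSet.univ.prod hd)
  simp only [mk_preimage_prod, preimage_univ, inter_univ, univ_inter] at h1 e3 e4 ⊢
  rw [e3, e4, inter_inter_inter_comm, h1, e1, e2]
  ring

/-- A finite set of times is contained in an initial piece of a nondecreasing sequence. -/
theorem exists_monotone_enumeration (K : Finset ℝ≥0) :
    ∃ (t : ℕ → ℝ≥0) (m : ℕ), Monotone t ∧ t 0 = 0 ∧ ∀ u ∈ K, ∃ k < m, t k = u := by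
  suffices H : ∃ (t : ℕ → ℝ≥0) (m : ℕ), 0 < m ∧ Monotone t ∧ t 0 = 0 ∧
      ∀ u ∈ K, ∃ k < m, t k = u by
    obtain ⟨t, m, -, h⟩ := H
    exact ⟨t, m, h⟩
  induction K using Finset.induction_on_max with
  | empty => exact ⟨fun _ => 0, 1, one_pos, monotone_const, rfl, by simp⟩
  | insert a K hK ih =>
    obtain ⟨t, m, hm, ht, ht0, hKt⟩ := ih
    refine ⟨fun k => if k < m then min (t k) a else a, m + 1, m.succ_pos, ?_, by simp [hm, ht0], ?_⟩
    · intro k l hkl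
      dsimp only
      split_ifs with h1 h2 h2
      · exact min_le_min_right _ (ht hkl)
      · exact min_le_right _ _
      · omega
      · exact le_rfl
    · intro u hu
      rcases Finset.mem_insert.1 hu with rfl | hu
      · exact ⟨m, m.lt_succ_self, by simp⟩
      · obtain ⟨k, hk, rfl⟩ := hKt u hu
        exact ⟨k, hk.trans m.lt_succ_self, by simp [hk, (hK _ hu).le]⟩

namespace IsPoissonProcess

variable {Ω : Type*} [MeasurableSpace Ω] {P : Measure Ω} {N : ℝ≥0 → Ω → ℕ} {rate : ℝ≥0}

theorem sum_increments (hN : IsPoissonProcess N rate P) {t : ℕ → ℝ≥0} (ht : Monotone t) (ω : Ω)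
    (k : ℕ) : ∑ i ∈ Finset.range k, (N (t (i + 1)) ω - N (t i) ω) = N (t k) ω - N (t 0) ω :=
  Finset.sum_range_tsub (f := fun k => N (t k) ω) (fun _ _ h => hN.mono ω (ht h)) k

theorem measurable_sub (hN : IsPoissonProcess N rate P) (s t : ℝ≥0) :
    Measurable fun ω => N t ω - N s ω := (hN.measurable t).sub (hN.measurable s)

/-- The increments of a Poisson process after time `d` are independent of the process up to `d`. -/
theorem indepFun_past_future [IsProbabilityMeasure P] (hN : IsPoissonProcess N rate P) (d : ℝ≥0) :
    IndepFun (fun ω u => N (min u d) ω) (fun ω r => N (d + r) ω - N d ω) P := by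
  refine IndepFun.process_indepFun_process (X := fun u ω => N (min u d) ω)
    (Y := fun r ω => N (d + r) ω - N d ω) (fun u => hN.measurable _)
    (fun r => hN.measurable_sub _ _) fun I J => ?_
  obtain ⟨t, m, ht, ht0, hI⟩ := exists_monotone_enumeration I
  obtain ⟨t', m', ht', ht0', hJ⟩ := exists_monotone_enumeration J
  -- One time sequence for both index sets: the times of `I` cut off at `d` have indices below `m`,
  -- and `d` plus the times of `J` follow, starting with `T m = d`. Past values are sums of
  -- increments with index below `m`, future ones of increments with index at least `m`.
  set T : ℕ → ℝ≥0 := fun k => if k < m then min (t k) d else d + t' (k - m)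
  have hT : Monotone T := by
    intro k l hkl
    simp only [T]
    split_ifs with h1 h2 h2
    · exact min_le_min_right _ (ht hkl)
    · exact (min_le_right _ _).trans le_self_add
    · omega
    · exact add_le_add le_rfl (ht' (Nat.sub_le_sub_right hkl m))
  have hind := hN.indep.nat hT
  choose kI hkI hkI' using fun u : I => hI u u.2
  choose kJ hkJ hkJ' using fun r : J => hJ r r.2
  have h1 := hind.indepFun_finset (Finset.range m) (Finset.Ico m (m + m'))
    (by
      rw [Finset.disjoint_left]
      intro a ha hb
      simp only [Finset.mem_range, Finset.mem_Ico] at ha hb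
      omega) (fun i => hN.measurable_sub _ _)
  let φ : (Finset.range m → ℕ) → I → ℕ := fun v u =>
    ∑ i : Finset.range (kI u), v ⟨i, Finset.mem_range.2
      ((Finset.mem_range.1 i.2).trans (hkI u))⟩
  let ψ : (Finset.Ico m (m + m') → ℕ) → J → ℕ := fun v r =>
    ∑ i : Finset.range (kJ r), v ⟨m + i, Finset.mem_Ico.2 ⟨Nat.le_add_right _ _,
      by have := Finset.mem_range.1 i.2; have := hkJ r; omega⟩⟩
  have h2 := h1.comp (φ := φ) (ψ := ψ)
    (measurable_pi_lambda _ fun u => Finset.measurable_sum _ fun i _ => measurable_pi_apply _)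
    (measurable_pi_lambda _ fun u => Finset.measurable_sum _ fun i _ => measurable_pi_apply _)
  convert h2 using 1
  · ext ω u
    have hm : 0 < m := (Nat.zero_le _).trans_lt (hkI u)
    have e := hN.sum_increments hT ω (kI u)
    rw [← Finset.sum_coe_sort] at e
    simp only [φ, Function.comp_apply]
    rw [e]
    simp [T, hkI u, hkI' u, hm, ht0, hN.zero]
  · ext ω r
    have e := hN.sum_increments (t := fun k => T (m + k)) (fun k l h => hT (by omega)) ω (kJ r)
    rw [← Finset.sum_coe_sort] at e
    simp only [ψ, Function.comp_apply]
    simp only [add_assoc] at e ⊢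
    rw [e]
    simp [T, hkJ' r, ht0']

/-- The increments of a Poisson process after time `d` form a process with the same law. -/
theorem map_future_eq [IsProbabilityMeasure P] (hN : IsPoissonProcess N rate P) (d : ℝ≥0) :
    P.map (fun ω r => N (d + r) ω - N d ω) = P.map (fun ω r => N r ω) := by
  have hm1 : Measurable fun ω r => N (d + r) ω - N d ω :=
    measurable_pi_lambda _ fun r => hN.measurable_sub _ _
  have hm2 : Measurable fun ω r => N r ω := measurable_pi_lambda _ hN.measurable
  have key : ∀ J : Finset ℝ≥0, (P.map (fun ω r => N (d + r) ω - N d ω)).map J.restrict =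
      (P.map (fun ω r => N r ω)).map J.restrict := by
    intro J
    obtain ⟨t, m, ht, ht0, hJ⟩ := exists_monotone_enumeration J
    choose k hk hk' using fun r : J => hJ r r.2
    have ht' : Monotone fun i => d + t i := fun i j h => add_le_add le_rfl (ht h)
    -- Both increment sequences are independent, with Poisson laws that depend only on the lengths
    -- of the time intervals.
    have hlaw : P.map (fun ω i => N (d + t (i + 1)) ω - N (d + t i) ω) =
        P.map (fun ω i => N (t (i + 1)) ω - N (t i) ω) := by
      rw [(hN.indep.nat ht').map_fun_eq_infinitePi_map fun i => hN.measurable_sub _ _,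
        (hN.indep.nat ht).map_fun_eq_infinitePi_map fun i => hN.measurable_sub _ _]
      congr 1
      ext1 i
      rw [hN.law _ _ (ht' i.le_succ), hN.law _ _ (ht i.le_succ), add_tsub_add_eq_tsub_left]
    let φ : (ℕ → ℕ) → J → ℕ := fun v r => ∑ i ∈ Finset.range (k r), v i
    have hφ : Measurable φ :=
      measurable_pi_lambda _ fun r => Finset.measurable_sum _ fun i _ => measurable_pi_apply _
    have hr : Measurable (J.restrict : (ℝ≥0 → ℕ) → J → ℕ) :=
      measurable_pi_lambda _ fun r => measurable_pi_apply _
    rw [Measure.map_map hr hm1, Measure.map_map hr hm2]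
    have e1 : J.restrict ∘ (fun ω r => N (d + r) ω - N d ω) =
        φ ∘ fun ω i => N (d + t (i + 1)) ω - N (d + t i) ω := by
      ext ω r
      have e := hN.sum_increments ht' ω (k r)
      simp only [φ, Function.comp_apply, Finset.restrict]
      rw [e]
      simp [hk' r, ht0]
    have e2 : J.restrict ∘ (fun ω r => N r ω) =
        φ ∘ fun ω i => N (t (i + 1)) ω - N (t i) ω := by
      ext ω r
      have e := hN.sum_increments ht ω (k r)
      simp only [φ, Function.comp_apply, Finset.restrict]
      rw [e]
      simp [hk' r, ht0, hN.zero]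
    rw [e1, e2, ← Measure.map_map hφ (measurable_pi_lambda _ fun i => hN.measurable_sub _ _),
      ← Measure.map_map hφ (measurable_pi_lambda _ fun i => hN.measurable_sub _ _), hlaw]
  have hP : ∀ J : Finset ℝ≥0, IsFiniteMeasure ((P.map (fun ω r => N r ω)).map J.restrict) :=
    fun J => inferInstance
  exact IsProjectiveLimit.unique (P := fun J => (P.map (fun ω r => N r ω)).map J.restrict) key
    fun J => rfl

end IsPoissonProcess

namespace DegenerateRiskModel

variable {Ω : Type*} [mΩ : MeasurableSpace Ω] {P : Measure Ω} (M : DegenerateRiskModel Ω P)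

/-- On `N d = k`, the first `k` claim sizes belong to the past of `d` and the others to its future.
-/
theorem indepFun_U_split [IsProbabilityMeasure P] (k : ℕ) :
    IndepFun (fun ω (n : Finset.range k) => M.U n ω) (fun ω n => M.U (k + n) ω) P := by
  refine IndepFun.indepFun_process (Y := fun n ω => M.U (k + n) ω)
    (measurable_pi_lambda _ fun n => M.U_measurable _) (fun n => M.U_measurable _) fun J => ?_
  have h1 := M.U_indep.indepFun_finset (Finset.range k) (J.map (addLeftEmbedding k))
    (by
      rw [Finset.disjoint_left]
      intro a ha hb
      obtain ⟨n, -, rfl⟩ := Finset.mem_map.1 hb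
      simp at ha) M.U_measurable
  let ψ : (J.map (addLeftEmbedding k) → ℝ) → J → ℝ := fun v n =>
    v ⟨k + n, Finset.mem_map.2 ⟨n, n.2, rfl⟩⟩
  exact h1.comp (φ := id) (ψ := ψ) measurable_id
    (measurable_pi_lambda _ fun n => measurable_pi_apply _)

theorem map_U_shift [IsProbabilityMeasure P] (k : ℕ) :
    P.map (fun ω n => M.U (k + n) ω) = P.map (fun ω n => M.U n ω) := by
  have h := M.U_indep.precomp (g := fun n => k + n) (add_right_injective k)
  rw [iIndepFun.map_fun_eq_infinitePi_map (fun n => M.U_measurable _) h,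
    M.U_indep.map_fun_eq_infinitePi_map M.U_measurable]
  congr 1
  ext1 n
  rw [(M.U_ident (k + n)).map_eq, (M.U_ident n).map_eq]

/-- The sums `∑_{j < n r} u j` of claims up to each time. -/
def compound (u : ℕ → ℝ) (n : ℝ≥0 → ℕ) (r : ℝ≥0) : ℝ := ∑ j ∈ Finset.range (n r), u j

theorem measurable_compound :
    Measurable fun p : (ℕ → ℝ) × (ℝ≥0 → ℕ) => compound p.1 p.2 := by
  refine measurable_pi_lambda _ fun r => ?_
  have h : Measurable (fun p : ℕ × (ℕ → ℝ) => ∑ j ∈ Finset.range p.1, p.2 j) :=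
    measurable_from_prod_countable_right fun k =>
      Finset.measurable_sum (Finset.range k) fun n _ => measurable_pi_apply n
  have h' : Measurable fun p : (ℕ → ℝ) × (ℝ≥0 → ℕ) => (p.2 r, p.1) :=
    ((measurable_pi_apply r).comp measurable_snd).prodMk measurable_fst
  exact h.comp h'

/-- Markov property at a fixed time. -/
theorem measure_stopAt_inter_shift [IsProbabilityMeasure P] (d : ℝ≥0) {A B : Set StepPath}
    (hA : MeasurableSet A) (hB : MeasurableSet B) :
    P ((fun ω => (M.claimPath ω).stopAt d) ⁻¹' A ∩ (fun ω => (M.claimPath ω).shift d) ⁻¹' B) =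
      P ((fun ω => (M.claimPath ω).stopAt d) ⁻¹' A) * M.pathLaw B := by
  have hmN := M.poisson.measurable
  have hmU := M.U_measurable
  set E : Set Ω := (fun ω => (M.claimPath ω).stopAt d) ⁻¹' A
  set E' : Set Ω := (fun ω => (M.claimPath ω).shift d) ⁻¹' B
  have hE : MeasurableSet E :=
    StepPath.measurable_stopAt M.measurable_claimPath measurable_const hA
  have hE' : MeasurableSet E' :=
    StepPath.measurable_shift M.measurable_claimPath measurable_const hB
  have hk : ∀ k, MeasurableSet {ω | M.N d ω = k} := fun k => hmN d (measurableSet_singleton k)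
  have hsum : ∀ G : Set Ω, MeasurableSet G → P G = ∑' k, P (G ∩ {ω | M.N d ω = k}) := by
    intro G hG
    rw [← measure_iUnion _ fun k => hG.inter (hk k)]
    · congr 1
      ext ω
      simp
    · intro k l hkl
      refine Set.disjoint_left.2 fun ω h1 h2 => hkl ?_
      exact h1.2.symm.trans h2.2
  obtain ⟨A', hA', rfl⟩ := hA
  obtain ⟨B', hB', rfl⟩ := hB
  -- Splitting by `N d = k` fixes which claims are past: up to `d` the path depends on `k` claim
  -- sizes and `N` up to `d`, afterwards on the later sizes and the increments of `N`.
  rw [hsum _ (hE.inter hE'), hsum _ hE, ← ENNReal.tsum_mul_right]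
  congr 1
  ext1 k
  set p : Ω → (Finset.range k → ℝ) × (ℝ≥0 → ℕ) := fun ω =>
    (fun n => M.U n ω, fun u => M.N (min u d) ω)
  set f : Ω → (ℕ → ℝ) × (ℝ≥0 → ℕ) := fun ω =>
    (fun n => M.U (k + n) ω, fun r => M.N (d + r) ω - M.N d ω)
  have hm1 : Measurable fun ω (n : Finset.range k) => M.U n ω := measurable_pi_lambda _ fun _ => hmU _
  have hm2 : Measurable fun ω n => M.U (k + n) ω := measurable_pi_lambda _ fun _ => hmU _
  have hm3 : Measurable fun ω u => M.N (min u d) ω := measurable_pi_lambda _ fun _ => hmN _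
  have hm4 : Measurable fun ω r => M.N (d + r) ω - M.N d ω :=
    measurable_pi_lambda _ fun _ => M.poisson.measurable_sub _ _
  have hUN : ∀ k', IndepFun (fun ω => ((fun n : Finset.range k => M.U n ω), fun n => M.U (k' + n) ω))
      (fun ω => ((fun u => M.N (min u d) ω), fun r => M.N (d + r) ω - M.N d ω)) P := fun k' =>
    M.U_indep_N.comp (φ := fun u => ((fun n : Finset.range k => u n), fun n => u (k' + n)))
      (ψ := fun n => ((fun u => n (min u d)), fun r => n (d + r) - n d))
      ((measurable_pi_lambda _ fun _ => measurable_pi_apply _).prodMk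
        (measurable_pi_lambda _ fun _ => measurable_pi_apply _))
      ((measurable_pi_lambda _ fun _ => measurable_pi_apply _).prodMk
        (measurable_pi_lambda _ fun r =>
          (measurable_pi_apply (d + r)).sub (measurable_pi_apply d)))
  have hind : IndepFun p f P :=
    IndepFun.prodMk_prodMk_of_indep hm1 hm2 hm3 hm4 (M.indepFun_U_split k)
      (M.poisson.indepFun_past_future d) (hUN k)
  have hlaw : P.map f = P.map fun ω => ((fun n => M.U n ω), fun r => M.N r ω) := by
    have h1 : IndepFun (fun ω n => M.U (k + n) ω) (fun ω r => M.N (d + r) ω - M.N d ω) P :=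
      (hUN k).comp measurable_snd measurable_snd
    rw [(indepFun_iff_map_prod_eq_prod_map_map hm2.aemeasurable hm4.aemeasurable).1 h1,
      (indepFun_iff_map_prod_eq_prod_map_map (measurable_pi_lambda _ hmU).aemeasurable
        (measurable_pi_lambda _ hmN).aemeasurable).1 M.U_indep_N, M.map_U_shift k,
      M.poisson.map_future_eq d]
  -- The padding by zeros is never summed, because `N (min u d) ≤ k` on the event considered.
  let ext0 : (Finset.range k → ℝ) → ℕ → ℝ := fun v n =>
    if h : n ∈ Finset.range k then v ⟨n, h⟩ else 0
  have hext : Measurable ext0 := by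
    refine measurable_pi_lambda _ fun n => ?_
    by_cases h : n ∈ Finset.range k
    · simp only [ext0, h, dif_pos]
      exact measurable_pi_apply _
    · simp only [ext0, h, dif_neg, not_false_eq_true]
      exact measurable_const
  set Ak : Set ((Finset.range k → ℝ) × (ℝ≥0 → ℕ)) :=
    {z | compound (ext0 z.1) z.2 ∈ A' ∧ z.2 d = k}
  set Bk : Set ((ℕ → ℝ) × (ℝ≥0 → ℕ)) := {z | compound z.1 z.2 ∈ B'}
  have hAk : MeasurableSet Ak := by
    have h1 : Measurable fun z : (Finset.range k → ℝ) × (ℝ≥0 → ℕ) => z.2 d :=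
      (measurable_pi_apply d).comp measurable_snd
    exact ((measurable_compound.comp ((hext.comp measurable_fst).prodMk measurable_snd)) hA').inter
      (h1 (measurableSet_singleton k))
  have hBk : MeasurableSet Bk := measurable_compound hB'
  have hpast : E ∩ {ω | M.N d ω = k} = p ⁻¹' Ak := by
    ext ω
    simp only [E, Ak, p, mem_inter_iff, mem_preimage, mem_ofPred_eq, min_self]
    refine and_congr_left fun hω => ?_
    have : ((M.claimPath ω).stopAt d).toFun =
        compound (ext0 fun n => M.U n ω) fun u => M.N (min u d) ω := by
      ext u
      simp only [StepPath.stopAt_apply, claimPath_apply, claims, compound, ext0]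
      refine Finset.sum_congr rfl fun n hn => ?_
      have h1 : n ∈ Finset.range k := by
        have h2 := M.poisson.mono ω (min_le_right u d)
        have h3 := Finset.mem_range.1 hn
        dsimp only at h2
        exact Finset.mem_range.2 (by omega)
      rw [dif_pos h1]
    rw [this]
  have hfut : ∀ ω, M.N d ω = k → (ω ∈ E' ↔ ω ∈ f ⁻¹' Bk) := by
    intro ω hω
    have : ((M.claimPath ω).shift d).toFun = compound (f ω).1 (f ω).2 := by
      ext r
      simp only [StepPath.shift_apply, claimPath_apply, claims, compound, f]
      have h2 : M.N d ω ≤ M.N (d + r) ω := M.poisson.mono ω le_self_add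
      rw [← Finset.sum_Ico_eq_sub _ h2, Finset.sum_Ico_eq_sum_range, hω]
    simp only [E', Bk, mem_preimage, mem_ofPred_eq, this]
  have h1 : E ∩ E' ∩ {ω | M.N d ω = k} = p ⁻¹' Ak ∩ f ⁻¹' Bk := by
    rw [← hpast]
    ext ω
    simp only [mem_inter_iff, mem_ofPred_eq]
    constructor
    · rintro ⟨⟨h1, h2⟩, h3⟩
      exact ⟨⟨h1, h3⟩, (hfut ω h3).1 h2⟩
    · rintro ⟨⟨h1, h3⟩, h2⟩
      exact ⟨⟨h1, (hfut ω h3).2 h2⟩, h3⟩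
  rw [h1, hpast, indepFun_iff_measure_inter_preimage_eq_mul.1 hind _ _ hAk hBk]
  congr 1
  rw [← Measure.map_apply (hm2.prodMk hm4) hBk]
  change P.map f Bk = _
  rw [hlaw, Measure.map_apply ((measurable_pi_lambda _ hmU).prodMk (measurable_pi_lambda _ hmN)) hBk,
    pathLaw, Measure.map_apply M.measurable_claimPath ⟨B', hB', rfl⟩]
  rfl

/-- No claims have been made up to time `t` with probability at least `e^{-rate t}`. -/
theorem exp_le_measure_claims_eq_zero (t : ℝ≥0) :
    ENNReal.ofReal (Real.exp (-(M.rate * t))) ≤ P {ω | M.claims t ω = 0} := by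
  have h := M.poisson.law 0 t zero_le
  have h1 : P {ω | M.N t ω = 0} = ENNReal.ofReal (Real.exp (-(M.rate * t))) := by
    have h2 : (fun ω => M.N t ω - M.N 0 ω) = M.N t := by
      ext ω
      rw [M.poisson.zero, Nat.sub_zero]
    rw [h2, tsub_zero] at h
    have h3 := congrArg (fun μ => μ {0}) h
    simp only [Measure.map_apply (M.poisson.measurable t) (measurableSet_singleton 0),
      poissonMeasure_singleton] at h3
    refine Eq.trans ?_ (h3.trans ?_)
    · rfl
    · simp
  rw [← h1]
  refine measure_mono fun ω hω => ?_
  simp only [mem_ofPred_eq] at hω ⊢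
  simp [claims, hω]

end DegenerateRiskModel

/-! ### Stopping times and the strong Markov property -/

namespace DegenerateRiskModel

variable {Ω : Type*} [mΩ : MeasurableSpace Ω] {P : Measure Ω} {M : DegenerateRiskModel Ω P}
  {x : Fin 2 → ℝ} {τ : Ω → WithTop ℝ≥0}

theorem measurableSet_ne_top (hτ : IsStoppingTime (M.filtration x) τ) :
    MeasurableSet {ω | τ ω ≠ ⊤} := by
  have : {ω | τ ω ≠ ⊤} = ⋃ k : ℕ, {ω | τ ω ≤ ((k : ℝ≥0) : WithTop ℝ≥0)} := by
    ext ω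
    simp only [mem_ofPred_eq, mem_iUnion]
    constructor
    · intro h
      obtain ⟨t, ht⟩ := WithTop.ne_top_iff_exists.1 h
      obtain ⟨k, hk⟩ := exists_nat_ge t
      exact ⟨k, by rw [← ht]; exact WithTop.coe_le_coe.2 hk⟩
    · rintro ⟨k, hk⟩
      exact (hk.trans_lt (WithTop.coe_lt_top _)).ne
  rw [this]
  exact .iUnion fun k => (M.filtration x).le _ _ (hτ _)

theorem measurable_untopD (hτ : IsStoppingTime (M.filtration x) τ) :
    Measurable fun ω => (τ ω).untopD 0 := by
  refine measurable_of_Iic fun a => ?_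
  have : (fun ω => (τ ω).untopD 0) ⁻¹' Iic a = {ω | τ ω ≤ a} ∪ {ω | τ ω ≠ ⊤}ᶜ := by
    ext ω
    simp only [mem_preimage, mem_Iic, mem_union, mem_ofPred_eq, mem_compl_iff, not_not]
    cases h : τ ω with
    | top => simp
    | coe t =>
      rw [WithTop.untopD_coe, WithTop.coe_le_coe]
      exact (or_iff_left WithTop.coe_ne_top).symm
  rw [this]
  exact ((M.filtration x).le _ _ (hτ a)).union (measurableSet_ne_top hτ).compl

theorem measurable_min_untopD (hτ : IsStoppingTime (M.filtration x) τ) (t : ℝ≥0) :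
    Measurable[M.filtration x t] fun ω => (min (τ ω) t).untopD 0 := by
  refine measurable_of_Iic (mδ := M.filtration x t) fun a => ?_
  rcases lt_or_ge a t with hat | hat
  · have : (fun ω => (min (τ ω) t).untopD 0) ⁻¹' Iic a = {ω | τ ω ≤ a} := by
      ext ω
      simp only [mem_preimage, mem_Iic, mem_ofPred_eq]
      cases h : τ ω with
      | top =>
        rw [min_eq_right le_top, WithTop.untopD_coe]
        exact iff_of_false (not_le.2 hat) (not_le.2 (WithTop.coe_lt_top a))
      | coe u =>
        rw [← WithTop.coe_min, WithTop.untopD_coe, WithTop.coe_le_coe, min_le_iff]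
        exact or_iff_left (not_le.2 hat)
    rw [this]
    exact (M.filtration x).mono hat.le _ (hτ a)
  · have : (fun ω => (min (τ ω) t).untopD 0) ⁻¹' Iic a = univ := by
      ext ω
      simp only [mem_preimage, mem_Iic, mem_univ, iff_true]
      cases h : τ ω with
      | top =>
        rw [min_eq_right le_top, WithTop.untopD_coe]
        exact hat
      | coe u =>
        rw [← WithTop.coe_min, WithTop.untopD_coe]
        exact (min_le_right _ _).trans hat
    rw [this]
    exact @MeasurableSet.univ _ (M.filtration x t)

/-- Discrete times that decrease to `T`. -/
def ceilTime (n : ℕ) (T : ℝ≥0) : ℝ≥0 := (⌊T * (n + 1)⌋₊ + 1) / (n + 1)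

theorem lt_ceilTime (n : ℕ) (T : ℝ≥0) : T < ceilTime n T := by
  rw [ceilTime, lt_div_iff₀ (by positivity)]
  exact Nat.lt_floor_add_one _

theorem ceilTime_le (n : ℕ) (T : ℝ≥0) : ceilTime n T ≤ T + 1 / (n + 1) := by
  have h : (0 : ℝ≥0) < n + 1 := by positivity
  rw [ceilTime, div_le_iff₀ h, add_mul, one_div, inv_mul_cancel₀ h.ne']
  gcongr
  exact Nat.floor_le zero_le

theorem tendsto_ceilTime (T : ℝ≥0) : Tendsto (fun n => ceilTime n T) atTop (𝓝 T) := by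
  have h : Tendsto (fun n : ℕ => T + 1 / ((n : ℝ≥0) + 1)) atTop (𝓝 (T + 0)) :=
    tendsto_const_nhds.add tendsto_one_div_add_atTop_nhds_zero_nat
  rw [add_zero] at h
  exact tendsto_of_tendsto_of_tendsto_of_le_of_le tendsto_const_nhds h
    (fun n => (lt_ceilTime n T).le) fun n => ceilTime_le n T

/-- The path is constant just to the right of `T` and of `T + u`, so the approximation is eventually
exact. -/
theorem eventually_shift_ceilTime (s : StepPath) (T u : ℝ≥0) :
    ∀ᶠ n in atTop, s.shift (ceilTime n T) u = s.shift T u := by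
  obtain ⟨v, hv, h1⟩ := s.exists_const T
  obtain ⟨w, hw, h2⟩ := s.exists_const (T + u)
  have e1 := (tendsto_ceilTime T).eventually (gt_mem_nhds hv)
  have e2 := ((tendsto_ceilTime T).add_const u).eventually (gt_mem_nhds hw)
  filter_upwards [e1, e2] with n h3 h4
  have h5 := (lt_ceilTime n T).le
  rw [StepPath.shift_apply, StepPath.shift_apply, h1 _ h5 h3.le, h2 _ (by gcongr) h4.le]

/-- The strong Markov property at discretized times. -/
theorem measure_inter_shift_ceilTime [IsProbabilityMeasure P]
    (hτ : IsStoppingTime (M.filtration x) τ) {A : Set Ω} (hA : A ⊆ {ω | τ ω ≠ ⊤})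
    (hAm : ∀ t : ℝ≥0, MeasurableSet[M.filtration x t] (A ∩ {ω | τ ω ≤ t})) (hAΩ : MeasurableSet A)
    (n : ℕ) {B : Set StepPath} (hB : MeasurableSet B) :
    P (A ∩ {ω | (M.claimPath ω).shift (ceilTime n ((τ ω).untopD 0)) ∈ B}) =
      P A * M.pathLaw B := by
  set T : Ω → ℝ≥0 := fun ω => (τ ω).untopD 0
  have hT : Measurable T := measurable_untopD hτ
  set K : ℕ → Set Ω := fun k => {ω | ⌊T ω * (n + 1)⌋₊ = k}
  have hK : ∀ k, MeasurableSet (K k) := fun k =>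
    (Nat.measurable_floor.comp (hT.mul_const _)) (measurableSet_singleton k)
  have hsum : ∀ G : Set Ω, MeasurableSet G → P G = ∑' k, P (G ∩ K k) := by
    intro G hG
    rw [← measure_iUnion _ fun k => hG.inter (hK k)]
    · congr 1
      ext ω
      simp [K]
    · intro k l hkl
      refine Set.disjoint_left.2 fun ω h1 h2 => hkl ?_
      exact h1.2.symm.trans h2.2
  have hceil : Measurable fun ω => ceilTime n (T ω) := by
    refine Measurable.div_const (Measurable.add_const ?_ _) _
    exact measurable_from_nat.comp (Nat.measurable_floor.comp (hT.mul_const _))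
  have hS : MeasurableSet {ω | (M.claimPath ω).shift (ceilTime n (T ω)) ∈ B} :=
    StepPath.measurable_shift M.measurable_claimPath hceil hB
  rw [hsum _ (hAΩ.inter hS), hsum _ hAΩ, ← ENNReal.tsum_mul_right]
  congr 1
  ext1 k
  set d : ℝ≥0 := (k + 1) / (n + 1)
  have hn : (0 : ℝ≥0) < n + 1 := by positivity
  -- On `A`, the floor equals `k` if and only if `k / (n + 1) ≤ τ < d`, which is known at time `d`;
  -- so the Markov property at the fixed time `d` applies to each piece.
  have hAk : MeasurableSet[M.filtration x d] (A ∩ K k) := by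
    have : A ∩ K k = (A ∩ {ω | τ ω ≤ d}) ∩ ({ω | τ ω < d} ∩
        {ω | ((k / (n + 1) : ℝ≥0) : WithTop ℝ≥0) ≤ τ ω}) := by
      ext ω
      simp only [mem_inter_iff, mem_ofPred_eq, K]
      rw [and_assoc]
      refine and_congr_right fun hω => ?_
      obtain ⟨t, ht⟩ := WithTop.ne_top_iff_exists.1 (hA hω)
      simp only [T, ← ht, WithTop.untopD_coe, WithTop.coe_le_coe, WithTop.coe_lt_coe]
      rw [Nat.floor_eq_iff zero_le, div_le_iff₀ hn, lt_div_iff₀ hn, le_div_iff₀ hn]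
      exact ⟨fun h => ⟨h.2.le, h.2, h.1⟩, fun h => ⟨h.2.2, h.2.1⟩⟩
    rw [this]
    refine MeasurableSet.inter (hAm d) (MeasurableSet.inter (hτ.measurableSet_lt d) ?_)
    refine (M.filtration x).mono ?_ _ (hτ.measurableSet_ge _)
    exact div_le_div_of_nonneg_right (le_add_of_nonneg_right zero_le) hn.le
  have h1 : A ∩ {ω | (M.claimPath ω).shift (ceilTime n (T ω)) ∈ B} ∩ K k =
      A ∩ K k ∩ (fun ω => (M.claimPath ω).shift d) ⁻¹' B := by
    ext ω
    simp only [mem_inter_iff, mem_ofPred_eq, mem_preimage, K]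
    constructor
    · rintro ⟨⟨h1, h2⟩, h3⟩
      rw [ceilTime, h3] at h2
      exact ⟨⟨h1, h3⟩, h2⟩
    · rintro ⟨⟨h1, h3⟩, h2⟩
      refine ⟨⟨h1, ?_⟩, h3⟩
      rw [ceilTime, h3]
      exact h2
  rw [filtration_eq_comap] at hAk
  obtain ⟨C, hC, hCA⟩ := hAk
  rw [h1, ← hCA, M.measure_stopAt_inter_shift d hC hB]

/-- The strong Markov property. -/
theorem measure_inter_shift [IsProbabilityMeasure P]
    (hτ : IsStoppingTime (M.filtration x) τ) {A : Set Ω} (hA : A ⊆ {ω | τ ω ≠ ⊤})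
    (hAm : ∀ t : ℝ≥0, MeasurableSet[M.filtration x t] (A ∩ {ω | τ ω ≤ t})) (hAΩ : MeasurableSet A)
    {B : Set StepPath} (hB : MeasurableSet B) :
    P (A ∩ {ω | (M.claimPath ω).shift ((τ ω).untopD 0) ∈ B}) = P A * M.pathLaw B := by
  set T : Ω → ℝ≥0 := fun ω => (τ ω).untopD 0
  have hT : Measurable T := measurable_untopD hτ
  have hceil : ∀ n, Measurable fun ω => ceilTime n (T ω) := fun n => by
    refine Measurable.div_const (Measurable.add_const ?_ _) _
    exact measurable_from_nat.comp (Nat.measurable_floor.comp (hT.mul_const _))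
  have hSn : ∀ n, Measurable fun ω => (M.claimPath ω).shift (ceilTime n (T ω)) := fun n =>
    StepPath.measurable_shift M.measurable_claimPath (hceil n)
  have hS : Measurable fun ω => (M.claimPath ω).shift (T ω) :=
    StepPath.measurable_shift M.measurable_claimPath hT
  have hmap : ∀ n, (P.restrict A).map (fun ω => (M.claimPath ω).shift (ceilTime n (T ω))) =
      P A • M.pathLaw := fun n => by
    ext B hB
    rw [Measure.map_apply (hSn n) hB, Measure.restrict_apply (hSn n hB), inter_comm,
      Measure.smul_apply, smul_eq_mul]
    exact measure_inter_shift_ceilTime hτ hA hAm hAΩ n hB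
  have hfin : IsFiniteMeasure (P A • M.pathLaw) := ⟨by
    rw [Measure.smul_apply, smul_eq_mul]
    exact ENNReal.mul_lt_top (measure_lt_top _ _) (measure_lt_top _ _)⟩
  suffices H : (P.restrict A).map (fun ω => (M.claimPath ω).shift (T ω)) = P A • M.pathLaw by
    have := congrArg (fun μ => μ B) H
    simp only [Measure.map_apply hS hB, Measure.restrict_apply (hS hB), Measure.smul_apply,
      smul_eq_mul] at this
    rw [← this, inter_comm]
    rfl
  -- Finite-dimensional laws suffice. Integrals of a bounded continuous function of the path shifted
  -- by `ceilTime n` do not depend on `n`, and they converge by dominated convergence.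
  refine StepPath.measure_ext ?_
  have hr : ∀ J : Finset ℝ≥0, Measurable (J.restrict : (ℝ≥0 → ℝ) → J → ℝ) := fun J =>
    measurable_pi_lambda _ fun r => measurable_pi_apply _
  refine IsProjectiveLimit.unique
    (P := fun J => ((P A • M.pathLaw).map StepPath.toFun).map J.restrict) (fun J => ?_)
    fun J => rfl
  dsimp only
  rw [Measure.map_map (hr J) StepPath.measurable_toFun,
    Measure.map_map (hr J) StepPath.measurable_toFun,
    Measure.map_map ((hr J).comp StepPath.measurable_toFun) hS]
  have hρ : Measurable (J.restrict ∘ StepPath.toFun) := (hr J).comp StepPath.measurable_toFun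
  refine ext_of_forall_integral_eq_of_IsFiniteMeasure fun g => ?_
  have hg : Measurable g := g.continuous.measurable
  rw [integral_map (hρ.comp hS).aemeasurable hg.aestronglyMeasurable,
    integral_map hρ.aemeasurable hg.aestronglyMeasurable]
  have hlim : Tendsto (fun n => ∫ ω in A, g ((J.restrict ∘ StepPath.toFun)
      ((M.claimPath ω).shift (ceilTime n (T ω)))) ∂P) atTop
      (𝓝 (∫ ω in A, g ((J.restrict ∘ StepPath.toFun) ((M.claimPath ω).shift (T ω))) ∂P)) := by
    refine tendsto_integral_of_dominated_convergence (fun _ => ‖g‖)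
      (fun n => (hg.comp (hρ.comp (hSn n))).aestronglyMeasurable) (integrable_const _)
      (fun n => ae_of_all _ fun ω => g.norm_coe_le_norm _) (ae_of_all _ fun ω => ?_)
    refine tendsto_const_nhds.congr' ?_
    have : ∀ᶠ n in atTop, ∀ r : J, (M.claimPath ω).shift (ceilTime n (T ω)) r =
        (M.claimPath ω).shift (T ω) r :=
      eventually_all.2 fun r => eventually_shift_ceilTime _ _ _
    filter_upwards [this] with n hn
    congr 1
    ext r
    exact (hn r).symm
  have hconst : ∀ n, ∫ ω in A, g ((J.restrict ∘ StepPath.toFun)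
      ((M.claimPath ω).shift (ceilTime n (T ω)))) ∂P =
      ∫ s, g ((J.restrict ∘ StepPath.toFun) s) ∂(P A • M.pathLaw) := fun n => by
    rw [← hmap n]
    exact (integral_map (hSn n).aemeasurable (hg.comp hρ).aestronglyMeasurable).symm
  simp only [hconst] at hlim
  exact tendsto_nhds_unique hlim tendsto_const_nhds

/-- The time `τ` and the claims up to it (meaningful if `τ` is finite). -/
def past (M : DegenerateRiskModel Ω P) (τ : Ω → WithTop ℝ≥0) (ω : Ω) : ℝ≥0 × StepPath :=
  ((τ ω).untopD 0, (M.claimPath ω).stopAt ((τ ω).untopD 0))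

/-- The claims after time `τ` (meaningful if `τ` is finite). -/
def future (M : DegenerateRiskModel Ω P) (τ : Ω → WithTop ℝ≥0) (ω : Ω) : StepPath :=
  (M.claimPath ω).shift ((τ ω).untopD 0)

theorem measurable_past (hτ : IsStoppingTime (M.filtration x) τ) : Measurable (M.past τ) :=
  (measurable_untopD hτ).prodMk
    (StepPath.measurable_stopAt M.measurable_claimPath (measurable_untopD hτ))

theorem measurable_future (hτ : IsStoppingTime (M.filtration x) τ) : Measurable (M.future τ) :=
  StepPath.measurable_shift M.measurable_claimPath (measurable_untopD hτ)

/-- Past and future of a stopping time are independent, and the future claims are distributed as the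
claim process. -/
theorem map_past_future [IsProbabilityMeasure P] (hτ : IsStoppingTime (M.filtration x) τ) :
    (P.restrict {ω | τ ω ≠ ⊤}).map (fun ω => (M.past τ ω, M.future τ ω)) =
      ((P.restrict {ω | τ ω ≠ ⊤}).map (M.past τ)).prod M.pathLaw := by
  have hm := (measurable_past hτ).prodMk (measurable_future hτ)
  have hne := measurableSet_ne_top hτ
  refine (Measure.prod_eq fun C B hC hB => ?_).symm
  rw [Measure.map_apply hm (hC.prod hB), Measure.restrict_apply (hm (hC.prod hB)),
    Measure.map_apply (measurable_past hτ) hC, Measure.restrict_apply (measurable_past hτ hC),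
    mk_preimage_prod]
  -- On `τ ≤ t`, the past is a function of `min τ t` and of the path stopped at `t`.
  have hA : ∀ t : ℝ≥0, MeasurableSet[M.filtration x t]
      ((M.past τ ⁻¹' C ∩ {ω | τ ω ≠ ⊤}) ∩ {ω | τ ω ≤ t}) := by
    intro t
    have hT := measurable_min_untopD hτ t
    have hY : Measurable[M.filtration x t] fun ω => ((min (τ ω) t).untopD 0,
        ((M.claimPath ω).stopAt t).stopAt ((min (τ ω) t).untopD 0)) :=
      hT.prodMk (StepPath.measurable_stopAt (M.measurable_stopAt_claimPath x t) hT)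
    have : (M.past τ ⁻¹' C ∩ {ω | τ ω ≠ ⊤}) ∩ {ω | τ ω ≤ t} =
        (fun ω => ((min (τ ω) t).untopD 0,
          ((M.claimPath ω).stopAt t).stopAt ((min (τ ω) t).untopD 0))) ⁻¹' C ∩ {ω | τ ω ≤ t} := by
      ext ω
      simp only [mem_inter_iff, mem_preimage, mem_ofPred_eq]
      refine and_congr_left fun hω => ?_
      have hne : τ ω ≠ ⊤ := (hω.trans_lt (WithTop.coe_lt_top t)).ne
      obtain ⟨u, hu⟩ := WithTop.ne_top_iff_exists.1 hne
      have hut : u ≤ t := by rwa [← hu, WithTop.coe_le_coe] at hω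
      have hstopAt : ((M.claimPath ω).stopAt t).stopAt u = (M.claimPath ω).stopAt u := by
        ext r
        simp [min_assoc, min_eq_left hut]
      rw [min_eq_left hω, and_iff_left hne, past, ← hu, WithTop.untopD_coe, hstopAt]
    rw [this]
    exact (hY hC).inter (hτ t)
  have := measure_inter_shift hτ inter_subset_right hA ((measurable_past hτ hC).inter hne) hB
  rw [← this, inter_right_comm]
  rfl

end DegenerateRiskModel

/-! ### Splitting a rule at a stopping time: the inequality `≤` -/

namespace DegenerateRiskModel

variable {Ω : Type*} [mΩ : MeasurableSpace Ω] {P : Measure Ω} {M : DegenerateRiskModel Ω P}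
  {x : Fin 2 → ℝ} {τ : Ω → WithTop ℝ≥0}

theorem lintegral_past_future [IsProbabilityMeasure P] (hτ : IsStoppingTime (M.filtration x) τ)
    {h : (ℝ≥0 × StepPath) × StepPath → ℝ≥0∞} (hh : Measurable h) :
    ∫⁻ ω in {ω | τ ω ≠ ⊤}, h (M.past τ ω, M.future τ ω) ∂P =
      ∫⁻ ω in {ω | τ ω ≠ ⊤}, (∫⁻ s, h (M.past τ ω, s) ∂M.pathLaw) ∂P := by
  rw [← lintegral_map hh ((measurable_past hτ).prodMk (measurable_future hτ)), map_past_future hτ,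
    lintegral_prod _ hh.aemeasurable, lintegral_map hh.lintegral_prod_right' (measurable_past hτ)]

/-- Fubini's theorem for null sets, under the product law of past and future. -/
theorem ae_past_future [IsProbabilityMeasure P] (hτ : IsStoppingTime (M.filtration x) τ)
    {p : (ℝ≥0 × StepPath) × StepPath → Prop} (hp : MeasurableSet {z | p z}) :
    (∀ᵐ ω ∂P.restrict {ω | τ ω ≠ ⊤}, p (M.past τ ω, M.future τ ω)) ↔
      ∀ᵐ ω ∂P.restrict {ω | τ ω ≠ ⊤}, ∀ᵐ s ∂M.pathLaw, p (M.past τ ω, s) := by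
  have hq : MeasurableSet {y | ∀ᵐ s ∂M.pathLaw, p (y, s)} :=
    (measurable_measure_prodMk_left (ν := M.pathLaw) hp.compl) (measurableSet_singleton 0)
  rw [← ae_map_iff ((measurable_past hτ).prodMk (measurable_future hτ)).aemeasurable hp,
    map_past_future hτ, Measure.ae_prod_iff_ae_ae hp,
    ae_map_iff (measurable_past hτ).aemeasurable hq]

theorem concat_past_future (ω : Ω) :
    StepPath.concat (M.past τ ω).1 (M.past τ ω).2 (M.future τ ω) = M.claimPath ω :=
  StepPath.concat_stopAt_shift _ _

/-- The discounted payments of a rule before time `τ`. -/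
def stoppedPayoff (M : DegenerateRiskModel Ω P) (F : PathStrategy) (τ : Ω → WithTop ℝ≥0) (ω : Ω) :
    ℝ≥0∞ :=
  M.pathPayoff fun t i => F (M.claimPath ω) ((min (t : WithTop ℝ≥0) (τ ω)).untopD 0) i

theorem stoppedPayoff_of_eq_top (F : PathStrategy) {ω : Ω} (h : τ ω = ⊤) :
    M.stoppedPayoff F τ ω = M.pathPayoff (F (M.claimPath ω)) := by
  simp only [stoppedPayoff, h, min_eq_left le_top, WithTop.untopD_coe]

theorem stoppedPayoff_of_ne_top (F : PathStrategy) {ω : Ω} (h : τ ω ≠ ⊤) :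
    M.stoppedPayoff F τ ω =
      M.pathPayoff fun t i => F (M.claimPath ω) (min t ((τ ω).untopD 0)) i := by
  obtain ⟨T, hT⟩ := WithTop.ne_top_iff_exists.1 h
  simp only [stoppedPayoff, ← hT, ← WithTop.coe_min, WithTop.untopD_coe]

theorem measurable_stoppedPayoff (hτ : IsStoppingTime (M.filtration x) τ) (F : PathStrategy) :
    Measurable (M.stoppedPayoff F τ) := by
  classical
  have h1 : Measurable fun ω => M.pathPayoff (F (M.claimPath ω)) :=
    (measurable_pathPayoff_rule F).comp M.measurable_claimPath
  have h2 : Measurable fun ω =>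
      M.pathPayoff fun t i => F (M.claimPath ω) (min t ((τ ω).untopD 0)) i :=
    measurable_pathPayoff fun i => F.measurable_eval_comp
      (M.measurable_claimPath.comp measurable_fst)
      (measurable_snd.min ((measurable_untopD hτ).comp measurable_fst)) i
  have h4 : M.stoppedPayoff F τ = fun ω => if τ ω ≠ ⊤ then
      M.pathPayoff (fun t i => F (M.claimPath ω) (min t ((τ ω).untopD 0)) i)
      else M.pathPayoff (F (M.claimPath ω)) := by
    ext ω
    by_cases h : τ ω ≠ ⊤
    · rw [if_pos h, stoppedPayoff_of_ne_top F h]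
    · rw [if_neg h, stoppedPayoff_of_eq_top F (not_not.1 h)]
  rw [h4]
  exact Measurable.ite (measurableSet_ne_top hτ) h2 h1

theorem pathPayoff_paste {f g : ℝ≥0 → Fin 2 → ℝ} (hf : ∀ i, IsDividendPath fun t => f t i)
    (hg : ∀ i, IsDividendPath fun t => g t i) (T : ℝ≥0) :
    M.pathPayoff (fun t i => f (min t T) i + g (t - T) i) =
      M.pathPayoff (fun t i => f (min t T) i) +
        ENNReal.ofReal (Real.exp (-M.q * T)) * M.pathPayoff g := by
  simp only [pathPayoff]
  rw [Finset.mul_sum, ← Finset.sum_add_distrib]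
  exact Finset.sum_congr rfl fun i _ => payoff_paste M.q (hf i) (hg i) T

theorem pathPayoff_split {f : ℝ≥0 → Fin 2 → ℝ} (hf : ∀ i, IsDividendPath fun t => f t i)
    (T : ℝ≥0) :
    M.pathPayoff f = M.pathPayoff (fun t i => f (min t T) i) +
        ENNReal.ofReal (Real.exp (-M.q * T)) * M.pathPayoff fun t i => f (T + t) i - f T i := by
  simp only [pathPayoff]
  rw [Finset.mul_sum, ← Finset.sum_add_distrib]
  exact Finset.sum_congr rfl fun i _ => payoff_split M.q (hf i) T

theorem pathPayoff_zero : M.pathPayoff (fun _ _ => 0) = 0 := by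
  simp [pathPayoff, payoff_zero]

theorem measurable_discount :
    Measurable fun y : ℝ≥0 × StepPath => ENNReal.ofReal (Real.exp (-M.q * (y.1 : ℝ))) := by
  fun_prop

/-- The value of a rule splits at a stopping time into the payments before it and the value of the
continuation. -/
theorem ruleValue_split [IsProbabilityMeasure P] (hτ : IsStoppingTime (M.filtration x) τ)
    (F : PathStrategy) :
    M.ruleValue F = ∫⁻ ω, M.stoppedPayoff F τ ω ∂P + ∫⁻ ω in {ω | τ ω ≠ ⊤},
      ENNReal.ofReal (Real.exp (-M.q * (M.past τ ω).1)) *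
        M.ruleValue (F.continuation (M.past τ ω).1 (M.past τ ω).2) ∂P := by
  set h : (ℝ≥0 × StepPath) × StepPath → ℝ≥0∞ := fun z =>
    ENNReal.ofReal (Real.exp (-M.q * z.1.1)) * M.pathPayoff (F.continuation z.1.1 z.1.2 z.2)
  have hcont : ∀ i, Measurable fun p : ((ℝ≥0 × StepPath) × StepPath) × ℝ≥0 =>
      F.continuation p.1.1.1 p.1.1.2 p.1.2 p.2 i := fun i => by
    have h1 : Measurable fun p : ((ℝ≥0 × StepPath) × StepPath) × ℝ≥0 =>
        StepPath.concat p.1.1.1 p.1.1.2 p.1.2 :=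
      StepPath.measurable_concat (by fun_prop) (by fun_prop) (by fun_prop)
    exact (F.measurable_eval_comp h1 (by fun_prop) i).sub
      (F.measurable_eval_comp h1 (by fun_prop) i)
  have hh : Measurable h :=
    (measurable_discount.comp measurable_fst).mul (measurable_pathPayoff hcont)
  have h1 : ∀ ω, M.pathPayoff (F (M.claimPath ω)) = M.stoppedPayoff F τ ω +
      {ω | τ ω ≠ ⊤}.indicator (fun ω => h (M.past τ ω, M.future τ ω)) ω := by
    intro ω
    by_cases hω : τ ω ≠ ⊤
    · rw [indicator_of_mem hω, stoppedPayoff_of_ne_top F hω,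
        pathPayoff_split (F.isDividendPath (M.claimPath ω)) ((τ ω).untopD 0)]
      simp only [h, PathStrategy.continuation, concat_past_future]
      rfl
    · rw [indicator_of_notMem hω, add_zero, stoppedPayoff_of_eq_top F (not_not.1 hω)]
  rw [ruleValue_eq, lintegral_congr h1, lintegral_add_left (measurable_stoppedPayoff hτ F),
    lintegral_indicator (measurableSet_ne_top hτ), lintegral_past_future hτ hh]
  congr 1
  refine lintegral_congr fun ω => ?_
  rw [ruleValue, ← lintegral_const_mul _ (measurable_pathPayoff_rule _)]

theorem pathSurplus_congr {s s' : StepPath} {t : ℝ≥0} (h : s t = s' t) (i : Fin 2) :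
    M.pathSurplus x s t i = M.pathSurplus x s' t i := by
  rw [pathSurplus, pathSurplus, h]

/-- The surplus at time `τ` under a rule. -/
def surplusAt (M : DegenerateRiskModel Ω P) (x : Fin 2 → ℝ) (F : PathStrategy) (s : StepPath)
    (T : ℝ≥0) (i : Fin 2) : ℝ :=
  M.pathSurplus x s T i - F s T i

/-- Paths that agree up to a time are treated alike up to that time. -/
theorem rule_congr (F : PathStrategy) {s s' : StepPath} {T r : ℝ≥0} (h : ∀ u ≤ T, s u = s' u)
    (hr : r ≤ T) : F s r = F s' r :=
  F.nonanticipating _ _ _ fun u hu => h u (hu.le.trans hr)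

theorem concat_stopAt_of_le (s s' : StepPath) {T u : ℝ≥0} (h : u ≤ T) :
    StepPath.concat T (s.stopAt T) s' u = s u := by
  rw [StepPath.concat_of_le _ _ h, StepPath.stopAt_apply, min_eq_left h]

theorem surplusAt_concat (F : PathStrategy) (s s' : StepPath) (T : ℝ≥0) :
    M.surplusAt x F (.concat T (s.stopAt T) s') T = M.surplusAt x F s T := by
  ext i
  rw [surplusAt, surplusAt, pathSurplus_congr (concat_stopAt_of_le s s' le_rfl),
    rule_congr F (fun u hu => concat_stopAt_of_le s s' hu) le_rfl]

/-- Given the claims up to `τ`, the continuation of an admissible rule is admissible for the surplus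
reached, and pays nothing after ruin. -/
theorem ae_continuation [IsProbabilityMeasure P] (hτ : IsStoppingTime (M.filtration x) τ)
    {F : PathStrategy} (hF : M.AdmissibleRule x F) :
    ∀ᵐ ω ∂P.restrict {ω | τ ω ≠ ⊤},
      M.AdmissibleRule (M.surplusAt x F (M.claimPath ω) ((τ ω).untopD 0))
        (F.continuation (M.past τ ω).1 (M.past τ ω).2) ∧
      (¬ M.Alive x (M.claimPath ω) (F (M.claimPath ω)) ((τ ω).untopD 0) →
        M.ruleValue (F.continuation (M.past τ ω).1 (M.past τ ω).2) = 0) := by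
  set p : (ℝ≥0 × StepPath) × StepPath → Prop := fun z =>
    M.PathAdmissible x (.concat z.1.1 z.1.2 z.2) (F (.concat z.1.1 z.1.2 z.2))
  have hp : MeasurableSet {z | p z} :=
    (StepPath.measurable_concat (measurable_fst.comp measurable_fst)
      (measurable_snd.comp measurable_fst) measurable_snd) (measurableSet_pathAdmissible x F)
  have h1 : ∀ᵐ ω ∂P.restrict {ω | τ ω ≠ ⊤}, p (M.past τ ω, M.future τ ω) := by
    refine ae_restrict_of_ae ((admissibleRule_iff.1 hF).mono fun ω hω => ?_)
    simp only [p, concat_past_future]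
    exact hω
  -- Almost sure admissibility becomes, for almost every past, admissibility along almost every
  -- future path independent of it.
  filter_upwards [(ae_past_future hτ hp).1 h1] with ω hω
  set T := (τ ω).untopD 0
  change ∀ᵐ s ∂M.pathLaw, M.PathAdmissible x (.concat T ((M.claimPath ω).stopAt T) s)
    (F (.concat T ((M.claimPath ω).stopAt T) s)) at hω
  refine ⟨hω.mono fun s hs => ?_, fun hdead => ?_⟩
  · have h2 := hs.shift T
    rw [StepPath.shift_concat] at h2
    rw [← surplusAt_concat F (M.claimPath ω) s T]
    exact h2
  · rw [Alive] at hdead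
    push Not at hdead
    obtain ⟨r, hr, hneg⟩ := hdead
    refine (lintegral_congr_ae (hω.mono fun s hs => ?_)).trans lintegral_zero
    have hagree : ∀ u ≤ T, StepPath.concat T ((M.claimPath ω).stopAt T) s u = M.claimPath ω u :=
      fun u hu => concat_stopAt_of_le _ s hu
    have hneg' : ∀ i, M.pathSurplus x (.concat T ((M.claimPath ω).stopAt T) s) r i <
        F (.concat T ((M.claimPath ω).stopAt T) s) r i := fun i => by
      rw [pathSurplus_congr (hagree r hr), rule_congr F hagree hr]
      exact hneg i
    -- Ruin at `r ≤ T` is part of the past, and all later payments equal those at `r`.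
    have hzero : F.continuation T ((M.claimPath ω).stopAt T) s = fun _ _ => 0 := by
      ext t i
      change F (.concat T ((M.claimPath ω).stopAt T) s) (T + t) i -
        F (.concat T ((M.claimPath ω).stopAt T) s) T i = 0
      rw [hs.stopped r (T + t) (hr.trans le_self_add) hneg' i, hs.stopped r T hr hneg' i, sub_self]
    change M.pathPayoff (F.continuation T ((M.claimPath ω).stopAt T) s) = 0
    rw [hzero, pathPayoff_zero]

theorem value_of_neg {y : Fin 2 → ℝ} (h : ∀ i, y i < 0) : M.value y = 0 := by
  rw [value, if_neg]
  exact fun h' => h' h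

open Classical in
/-- The integrand of the dynamic programming principle along an admissible rule. -/
theorem integrand_eq (hx : x ∈ solvencySet) {L : ℝ≥0 → Ω → Fin 2 → ℝ} {F : PathStrategy} {ω : Ω}
    (hL : (fun t => L t ω) = F (M.claimPath ω))
    (hF : M.PathAdmissible x (M.claimPath ω) (F (M.claimPath ω))) :
    M.dividends L (min (τ ω) (M.ruinTime x L ω)) ω +
        M.discountedValue x L (min (τ ω) (M.ruinTime x L ω)) ω =
      M.stoppedPayoff F τ ω + {ω | τ ω ≠ ⊤}.indicator (fun ω =>
        if M.Alive x (M.claimPath ω) (F (M.claimPath ω)) ((τ ω).untopD 0) then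
          ENNReal.ofReal (Real.exp (-M.q * (M.past τ ω).1)) *
            M.value (M.surplusAt x F (M.claimPath ω) ((τ ω).untopD 0)) else 0) ω := by
  have hd := F.isDividendPath (M.claimPath ω)
  have hL' : ∀ t i, L t ω i = F (M.claimPath ω) t i := fun t i =>
    congrFun (congrFun hL t) i
  have hruin : M.ruinTime x L ω = M.pathRuinTime x (M.claimPath ω) (F (M.claimPath ω)) := by
    rw [ruinTime_eq, hL]
  rw [hruin]
  congr 1
  · rw [stoppedPayoff, ← hF.sum_discountedIntegral hd, dividends]
    simp only [hL']
  -- The value term vanishes at ruin, where both surpluses are negative, and at `⊤` by convention;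
  -- it contributes only if `τ` precedes ruin.
  · have hneg : ∀ r : ℝ≥0, M.pathRuinTime x (M.claimPath ω) (F (M.claimPath ω)) = r →
        M.discountedValue x L r ω = 0 := fun r hr => by
      rw [discountedValue, if_neg WithTop.coe_ne_top, WithTop.untopD_coe, value_of_neg, mul_zero]
      intro i
      have := hF.neg_at_ruin hr i
      simp only [controlled, hL']
      exact sub_neg.2 this
    have hdead : M.discountedValue x L (M.pathRuinTime x (M.claimPath ω) (F (M.claimPath ω))) ω =
        0 := by
      by_cases htop : M.pathRuinTime x (M.claimPath ω) (F (M.claimPath ω)) = ⊤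
      · rw [htop, discountedValue, if_pos rfl]
      · obtain ⟨r, hr⟩ := WithTop.ne_top_iff_exists.1 htop
        rw [← hr]
        exact hneg r hr.symm
    by_cases hω : τ ω ≠ ⊤
    · rw [indicator_of_mem hω]
      obtain ⟨T, hT⟩ := WithTop.ne_top_iff_exists.1 hω
      have hTeq : (τ ω).untopD 0 = T := by rw [← hT, WithTop.untopD_coe]
      simp only [hTeq, past]
      have hiff := hF.lt_ruin_iff hx (fun i => (hd i).zero) T
      split_ifs with hA
      · rw [← hT, min_eq_left (hiff.2 hA).le, discountedValue, if_neg WithTop.coe_ne_top,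
          WithTop.untopD_coe]
        congr 2
        ext i
        simp only [controlled, surplusAt, hL']
        rfl
      · rw [← hT, min_eq_right (not_lt.1 (mt hiff.1 hA)), hdead]
    · rw [indicator_of_notMem hω, not_not.1 hω, min_eq_right le_top, hdead]

theorem surplusAt_mem_of_alive {F : PathStrategy} {s : StepPath} {T : ℝ≥0}
    (h : M.Alive x s (F s) T) : M.surplusAt x F s T ∈ solvencySet := by
  intro hneg
  obtain ⟨i, hi⟩ := h T le_rfl
  exact absurd (hneg i) (not_lt.2 (sub_nonneg.2 hi))

/-- The value of an admissible rule is at most the payments before `τ` plus the discounted optimal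
value at `τ`. -/
theorem ruleValue_le_lintegral [IsProbabilityMeasure P] (hx : x ∈ solvencySet)
    (hτ : IsStoppingTime (M.filtration x) τ) {L : ℝ≥0 → Ω → Fin 2 → ℝ} {F : PathStrategy}
    (hF : M.AdmissibleRule x F) (hL : ∀ᵐ ω ∂P, (fun t => L t ω) = F (M.claimPath ω)) :
    M.ruleValue F ≤ ∫⁻ ω, (M.dividends L (min (τ ω) (M.ruinTime x L ω)) ω +
        M.discountedValue x L (min (τ ω) (M.ruinTime x L ω)) ω) ∂P := by
  classical
  rw [ruleValue_split hτ F, ← lintegral_indicator (measurableSet_ne_top hτ),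
    ← lintegral_add_left (measurable_stoppedPayoff hτ F)]
  refine lintegral_mono_ae ?_
  have h1 := (ae_restrict_iff' (measurableSet_ne_top hτ)).1 (ae_continuation hτ hF)
  filter_upwards [h1, hL, admissibleRule_iff.1 hF] with ω h1 h2 h3
  rw [integrand_eq hx h2 h3]
  refine add_le_add le_rfl ?_
  by_cases hω : ω ∈ {ω | τ ω ≠ ⊤}
  swap
  · rw [indicator_of_notMem hω, indicator_of_notMem hω]
  rw [indicator_of_mem hω, indicator_of_mem hω]
  obtain ⟨h4, h5⟩ := h1 hω
  split_ifs with hA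
  · gcongr
    exact ruleValue_le_value (surplusAt_mem_of_alive hA) h4
  · rw [h5 hA, mul_zero]

end DegenerateRiskModel

/-! ### Pasting nearly optimal rules: the inequality `≥` -/

namespace DegenerateRiskModel

variable {Ω : Type*} [mΩ : MeasurableSpace Ω] {P : Measure Ω} {M : DegenerateRiskModel Ω P}
  {x : Fin 2 → ℝ} {τ : Ω → WithTop ℝ≥0}
  {ι : Type*}

/-- The strategy that follows the rule `F` up to time `τ` and then, depending on what was observed up
to `τ`, one of the rules `G k`. -/
def pasted (M : DegenerateRiskModel Ω P) (F : PathStrategy) (G : ι → PathStrategy)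
    (κ : ℝ≥0 × StepPath → ι) (τ : Ω → WithTop ℝ≥0) (t : ℝ≥0) (ω : Ω) (i : Fin 2) : ℝ :=
  F (M.claimPath ω) (min t ((min (τ ω) t).untopD 0)) i +
    G (κ ((min (τ ω) t).untopD 0, (M.claimPath ω).stopAt ((min (τ ω) t).untopD 0)))
      ((M.claimPath ω).shift ((min (τ ω) t).untopD 0)) (t - (min (τ ω) t).untopD 0) i

theorem pasted_of_eq_top (F : PathStrategy) (G : ι → PathStrategy) (κ : ℝ≥0 × StepPath → ι)
    {ω : Ω} (h : τ ω = ⊤) : (fun t => M.pasted F G κ τ t ω) = F (M.claimPath ω) := by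
  ext t i
  simp only [pasted, h, min_eq_right le_top, WithTop.untopD_coe, min_self, tsub_self]
  rw [((G _).isDividendPath _ i).zero, add_zero]

/-- The truncation of `τ` at `t` in `pasted` serves adaptedness only: before `τ` the second rule
contributes its initial value `0`, whichever index is chosen. -/
theorem pasted_of_ne_top (F : PathStrategy) (G : ι → PathStrategy) (κ : ℝ≥0 × StepPath → ι)
    {ω : Ω} (h : τ ω ≠ ⊤) : (fun t => M.pasted F G κ τ t ω) =
      fun t i => F (M.claimPath ω) (min t ((τ ω).untopD 0)) i +
        G (κ (M.past τ ω)) (M.future τ ω) (t - (τ ω).untopD 0) i := by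
  obtain ⟨T, hT⟩ := WithTop.ne_top_iff_exists.1 h
  ext t i
  simp only [pasted, past, future, ← hT, ← WithTop.coe_min, WithTop.untopD_coe]
  rcases le_total T t with h1 | h1
  · rw [min_eq_left h1]
  · rw [min_eq_right h1, min_self, min_eq_left h1, tsub_self, tsub_eq_zero_of_le h1,
      ((G _).isDividendPath _ i).zero, ((G _).isDividendPath _ i).zero]

theorem isDividendPath_pasted (F : PathStrategy) (G : ι → PathStrategy) (κ : ℝ≥0 × StepPath → ι)
    (ω : Ω) (i : Fin 2) : IsDividendPath fun t => M.pasted F G κ τ t ω i := by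
  by_cases h : τ ω = ⊤
  · have := fun t => congrFun (congrFun (pasted_of_eq_top (M := M) F G κ h) t) i
    simp only [this]
    exact F.isDividendPath _ i
  · have := fun t => congrFun (congrFun (pasted_of_ne_top (M := M) F G κ h) t) i
    simp only [this]
    exact (F.isDividendPath _ i).paste ((G _).isDividendPath _ i) _

theorem measurable_choice [MeasurableSpace ι] [Countable ι] [MeasurableSingletonClass ι]
    {α : Type*} {_ : MeasurableSpace α} (G : ι → PathStrategy) {k : α → ι}
    {s : α → StepPath} {t : α → ℝ≥0} (hk : Measurable k) (hs : Measurable s) (ht : Measurable t)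
    (i : Fin 2) : Measurable fun a => G (k a) (s a) (t a) i := by
  have h : Measurable fun p : ι × (ℝ≥0 × StepPath) => G p.1 p.2.2 p.2.1 i :=
    measurable_from_prod_countable_right fun k => (G k).measurable_eval i
  exact h.comp (hk.prodMk (ht.prodMk hs))

/-- At time `t` everything can be read off the claim path stopped at `t`: the rules are
nonanticipating, and what the shifted path does before `t - T` happens before `t`. -/
theorem measurable_pasted [MeasurableSpace ι] [Countable ι] [MeasurableSingletonClass ι]
    (hτ : IsStoppingTime (M.filtration x) τ) (F : PathStrategy)
    (G : ι → PathStrategy) {κ : ℝ≥0 × StepPath → ι} (hκ : Measurable κ) (t : ℝ≥0) (i : Fin 2) :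
    Measurable[M.filtration x t] fun ω => M.pasted F G κ τ t ω i := by
  have hT := measurable_min_untopD hτ t
  have hS := M.measurable_stopAt_claimPath x t
  have hle : ∀ ω, (min (τ ω) t).untopD 0 ≤ t := fun ω => by
    obtain ⟨u, hu⟩ := WithTop.ne_top_iff_exists.1
      ((min_le_right (τ ω) (t : WithTop ℝ≥0)).trans_lt (WithTop.coe_lt_top t)).ne
    rw [← hu, WithTop.untopD_coe, ← WithTop.coe_le_coe, hu]
    exact min_le_right _ _
  have heq : (fun ω => M.pasted F G κ τ t ω i) = fun ω =>
      F ((M.claimPath ω).stopAt t) (min t ((min (τ ω) t).untopD 0)) i +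
      G (κ ((min (τ ω) t).untopD 0, ((M.claimPath ω).stopAt t).stopAt ((min (τ ω) t).untopD 0)))
        (((M.claimPath ω).stopAt t).shift ((min (τ ω) t).untopD 0))
        (t - (min (τ ω) t).untopD 0) i := by
    ext ω
    have h1 := hle ω
    rw [pasted]
    generalize (min (τ ω) t).untopD 0 = T at h1 ⊢
    have e1 : F (M.claimPath ω) (min t T) = F ((M.claimPath ω).stopAt t) (min t T) :=
      F.nonanticipating _ _ _ fun u hu => by
        rw [StepPath.stopAt_apply, min_eq_left (hu.le.trans (min_le_left _ _))]
    have e2 : ((M.claimPath ω).stopAt t).stopAt T = (M.claimPath ω).stopAt T := by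
      ext u
      simp only [StepPath.stopAt_apply, min_assoc, min_eq_left h1]
    have e3 : ∀ k, G k ((M.claimPath ω).shift T) (t - T) =
        G k (((M.claimPath ω).stopAt t).shift T) (t - T) := fun k =>
      (G k).nonanticipating _ _ _ fun u hu => by
        rw [StepPath.shift_apply, StepPath.shift_apply, StepPath.stopAt_apply, StepPath.stopAt_apply,
          min_eq_left h1, min_eq_left (lt_tsub_iff_left.1 hu).le]
    rw [e1, e2, e3]
  rw [heq]
  refine (F.measurable_eval_comp hS (measurable_const.min hT) i).add ?_
  exact measurable_choice G (hκ.comp (hT.prodMk (StepPath.measurable_stopAt hS hT)))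
    (StepPath.measurable_shift hS hT) (measurable_const.sub hT) i

/-- Following an admissible rule up to a stopping time and then one of countably many rules that are
admissible for at most the surplus reached yields at most the optimal value. -/
theorem paste_le_value [MeasurableSpace ι] [Countable ι] [MeasurableSingletonClass ι]
    [IsProbabilityMeasure P] (hx : x ∈ solvencySet)
    (hτ : IsStoppingTime (M.filtration x) τ) {F : PathStrategy} (hF : M.AdmissibleRule x F)
    {G : ι → PathStrategy} {y : ι → Fin 2 → ℝ} (hG : ∀ k, M.AdmissibleRule (y k) (G k))
    {κ : ℝ≥0 × StepPath → ι} (hκ : Measurable κ)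
    (h : ∀ᵐ ω ∂P, τ ω ≠ ⊤ → G (κ (M.past τ ω)) = PathStrategy.zero ∨
      (M.Alive x (M.claimPath ω) (F (M.claimPath ω)) ((τ ω).untopD 0) ∧
        ∀ i, y (κ (M.past τ ω)) i ≤ M.surplusAt x F (M.claimPath ω) ((τ ω).untopD 0) i)) :
    ∫⁻ ω, M.stoppedPayoff F τ ω ∂P + ∫⁻ ω in {ω | τ ω ≠ ⊤},
      ENNReal.ofReal (Real.exp (-M.q * (M.past τ ω).1)) * M.ruleValue (G (κ (M.past τ ω))) ∂P ≤
      M.value x := by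
  have hfut : ∀ᵐ ω ∂P, τ ω ≠ ⊤ → ∀ k, M.PathAdmissible (y k) (M.future τ ω)
      (G k (M.future τ ω)) := by
    -- Countably many rules share one null set, so the index may depend on the past.
    refine (ae_restrict_iff' (measurableSet_ne_top hτ)).1 (ae_all_iff.2 fun k => ?_)
    exact (ae_past_future hτ (p := fun z => M.PathAdmissible (y k) z.2 (G k z.2))
      (measurable_snd (measurableSet_pathAdmissible (y k) (G k)))).2 (ae_of_all _ fun ω => hG k)
  have hadm : ∀ᵐ ω ∂P, M.PathAdmissible x (M.claimPath ω) fun t => M.pasted F G κ τ t ω := by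
    filter_upwards [h, hfut, admissibleRule_iff.1 hF] with ω h1 h2 h3
    by_cases hω : τ ω = ⊤
    · rw [pasted_of_eq_top F G κ hω]
      exact h3
    · rw [pasted_of_ne_top F G κ hω]
      rcases h1 hω with h4 | ⟨h4, h5⟩
      · rw [h4]
        simpa only [PathStrategy.zero, add_zero] using h3.paste_zero ((τ ω).untopD 0)
      · exact h3.paste (fun i => ((G _).isDividendPath _ i).zero) (h2 hω _) h5 h4
  refine le_trans (le_of_eq ?_) (lintegral_pathPayoff_le_value hx (isDividendPath_pasted F G κ)
    (measurable_pasted hτ F G hκ) hadm)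
  set g : (ℝ≥0 × StepPath) × StepPath → ℝ≥0∞ := fun z =>
    ENNReal.ofReal (Real.exp (-M.q * z.1.1)) * M.pathPayoff (G (κ z.1) z.2)
  have hg : Measurable g := (measurable_discount.comp measurable_fst).mul
    (measurable_pathPayoff fun i => measurable_choice G (hκ.comp (by fun_prop)) (by fun_prop)
      measurable_snd i)
  have h1 : ∀ ω, M.pathPayoff (fun t => M.pasted F G κ τ t ω) = M.stoppedPayoff F τ ω +
      {ω | τ ω ≠ ⊤}.indicator (fun ω => g (M.past τ ω, M.future τ ω)) ω := by
    intro ω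
    by_cases hω : τ ω ≠ ⊤
    · rw [indicator_of_mem hω, stoppedPayoff_of_ne_top F hω, pasted_of_ne_top F G κ hω,
        pathPayoff_paste (F.isDividendPath _) ((G _).isDividendPath _)]
      rfl
    · rw [indicator_of_notMem hω, add_zero, stoppedPayoff_of_eq_top F (not_not.1 hω),
        pasted_of_eq_top F G κ (not_not.1 hω)]
  rw [lintegral_congr h1, lintegral_add_left (measurable_stoppedPayoff hτ F),
    lintegral_indicator (measurableSet_ne_top hτ), lintegral_past_future hτ hg]
  congr 1
  refine lintegral_congr fun ω => ?_
  rw [ruleValue, ← lintegral_const_mul _ (measurable_pathPayoff_rule _)]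

theorem admissibleRule_zero (x : Fin 2 → ℝ) : M.AdmissibleRule x PathStrategy.zero :=
  ae_of_all _ fun s => pathAdmissible_zero x s

/-- Waiting for the premiums of a time span `δ` without claims bounds the growth of the value. -/
theorem value_le_mul_value [IsProbabilityMeasure P] {y y' : Fin 2 → ℝ} (hy : y ∈ solvencySet)
    {δ : ℝ≥0} (hδ : ∀ i, y' i ≤ y i + M.c i * δ) :
    M.value y' ≤ ENNReal.ofReal (Real.exp ((M.q + M.rate) * δ)) * M.value y := by
  classical
  by_cases hy' : y' ∈ solvencySet
  swap
  · rw [value, if_neg hy']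
    exact zero_le
  refine value_le hy' fun F hF => ?_
  -- From `y`, nothing is paid up to `δ`. If there was no claim, the surplus is then at least `y'`
  -- and `F` is followed; otherwise nothing is ever paid.
  set G : Bool → PathStrategy := fun k => if k then F else PathStrategy.zero
  set z : Bool → Fin 2 → ℝ := fun k => if k then y' else y
  set κ : ℝ≥0 × StepPath → Bool := fun p => decide (p.2 δ = 0)
  set τ : Ω → WithTop ℝ≥0 := fun _ => (δ : WithTop ℝ≥0)
  have hτ : IsStoppingTime (M.filtration y) τ := isStoppingTime_const _ _
  have hset : MeasurableSet {p : ℝ≥0 × StepPath | p.2 δ = 0} :=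
    ((StepPath.measurable_apply δ).comp measurable_snd) (measurableSet_singleton 0)
  have hκ : Measurable κ := measurable_to_bool (by
    have : κ ⁻¹' {true} = {p : ℝ≥0 × StepPath | p.2 δ = 0} := by
      ext p
      simp [κ]
    rw [this]
    exact hset)
  have hκτ : ∀ ω, κ (M.past τ ω) = decide (M.claims δ ω = 0) := fun ω => by
    simp only [κ, past, τ, WithTop.untopD_coe, StepPath.stopAt_apply, min_self, claimPath_apply]
  have hG : ∀ k, M.AdmissibleRule (z k) (G k) := by
    rintro (_ | _)
    · simpa [z, G] using admissibleRule_zero y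
    · simpa [z, G] using hF
  have key := paste_le_value hy hτ (admissibleRule_zero y) hG hκ (ae_of_all _ fun ω _ => by
    rw [hκτ]
    by_cases h0 : M.claims δ ω = 0
    · right
      simp only [h0, decide_true, τ, WithTop.untopD_coe]
      refine ⟨fun r hr => ?_, fun i => ?_⟩
      · have hr0 : M.claimPath ω r = 0 :=
          le_antisymm (((M.claimPath ω).mono hr).trans_eq h0) ((M.claimPath ω).nonneg r)
        by_contra! hneg
        refine hy fun i => ?_
        have h2 := hneg i
        have h3 := mul_nonneg (M.c_pos i).le r.coe_nonneg
        simp only [pathSurplus, hr0, PathStrategy.zero] at h2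
        linarith
      · have := hδ i
        simp only [z, surplusAt, pathSurplus, claimPath_apply, h0, PathStrategy.zero, if_true]
        linarith
    · left
      simp [h0, G])
  -- Only the claim-free event is kept, of probability at least `e^{-rate δ}`; the discount over the
  -- waiting time is `e^{-q δ}`.
  have hle : ENNReal.ofReal (Real.exp (-M.q * δ)) * M.ruleValue F *
      ENNReal.ofReal (Real.exp (-(M.rate * δ))) ≤ M.value y := by
    refine le_trans ?_ (le_trans le_add_self key)
    have huniv : {ω | τ ω ≠ ⊤} = univ := by
      ext ω
      simp only [τ, mem_ofPred_eq, mem_univ, iff_true]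
      exact WithTop.coe_ne_top
    have hm : MeasurableSet {ω | M.claims δ ω = 0} :=
      M.measurable_claims δ (measurableSet_singleton 0)
    rw [huniv, Measure.restrict_univ]
    calc _ ≤ ENNReal.ofReal (Real.exp (-M.q * δ)) * M.ruleValue F * P {ω | M.claims δ ω = 0} := by
          gcongr
          exact M.exp_le_measure_claims_eq_zero δ
      _ = ∫⁻ ω, {ω | M.claims δ ω = 0}.indicator
            (fun _ => ENNReal.ofReal (Real.exp (-M.q * δ)) * M.ruleValue F) ω ∂P :=
          (lintegral_indicator_const hm _).symm
      _ ≤ _ := by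
          refine lintegral_mono fun ω => ?_
          by_cases h0 : M.claims δ ω = 0
          swap
          · rw [indicator_of_notMem (by exact h0)]
            exact zero_le
          rw [indicator_of_mem (by exact h0)]
          rw [hκτ]
          simp only [h0, decide_true, G, if_true]
          exact le_rfl
  have hexp : ENNReal.ofReal (Real.exp ((M.q + M.rate) * δ)) *
      (ENNReal.ofReal (Real.exp (-M.q * δ)) * ENNReal.ofReal (Real.exp (-(M.rate * δ)))) = 1 := by
    rw [← ENNReal.ofReal_mul (Real.exp_pos _).le, ← ENNReal.ofReal_mul (Real.exp_pos _).le,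
      ← Real.exp_add, ← Real.exp_add]
    ring_nf
    simp
  calc M.ruleValue F = ENNReal.ofReal (Real.exp ((M.q + M.rate) * δ)) *
        (ENNReal.ofReal (Real.exp (-M.q * δ)) * M.ruleValue F *
          ENNReal.ofReal (Real.exp (-(M.rate * δ)))) := by
        rw [mul_right_comm, ← mul_assoc, hexp, one_mul]
    _ ≤ _ := by gcongr

/-- If every rule missed by more than `ε`, the finite value would be at most itself minus `ε`.
Truncated subtraction makes this harmless for value `0`, where the zero rule serves instead. -/
theorem exists_nearly_optimal [IsProbabilityMeasure P] {y : Fin 2 → ℝ} (hy : y ∈ solvencySet)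
    {ε : ℝ≥0∞} (hε : ε ≠ 0) :
    ∃ F, M.AdmissibleRule y F ∧ M.value y ≤ M.ruleValue F + ε := by
  by_contra! h
  rcases eq_or_ne (M.value y) 0 with h0 | h0
  · have := h _ (admissibleRule_zero y)
    rw [h0] at this
    exact absurd this (not_lt.2 zero_le)
  · have : M.value y ≤ M.value y - ε := value_le hy fun F hF =>
      ENNReal.le_sub_of_add_le_right
        (ne_top_of_lt ((le_add_self).trans_lt (h F hF))) (h F hF).le
    exact absurd (ENNReal.sub_lt_self (M.value_lt_top y).ne h0 hε) (not_lt.2 this)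

/-- The lower left corner of the grid cell with index `k`. -/
def gridCorner (M : DegenerateRiskModel Ω P) (δ : ℝ≥0) (k : Fin 2 → ℤ) (i : Fin 2) : ℝ :=
  M.c i * δ * k i

/-- The grid cell that contains a point. -/
def gridIndex (M : DegenerateRiskModel Ω P) (δ : ℝ≥0) (y : Fin 2 → ℝ) (i : Fin 2) : ℤ :=
  ⌊y i / (M.c i * δ)⌋

theorem gridCorner_le {δ : ℝ≥0} (hδ : 0 < δ) (y : Fin 2 → ℝ) (i : Fin 2) :
    M.gridCorner δ (M.gridIndex δ y) i ≤ y i := by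
  have h : 0 < M.c i * (δ : ℝ) := mul_pos (M.c_pos i) (by exact_mod_cast hδ)
  rw [gridCorner, gridIndex, mul_comm, ← le_div_iff₀ h]
  exact Int.floor_le _

/-- The side `c i * δ` is the premium income over a time `δ`, as `value_le_mul_value` demands for
comparing a point with its corner. -/
theorem le_gridCorner_add {δ : ℝ≥0} (hδ : 0 < δ) (y : Fin 2 → ℝ) (i : Fin 2) :
    y i ≤ M.gridCorner δ (M.gridIndex δ y) i + M.c i * δ := by
  have h : 0 < M.c i * (δ : ℝ) := mul_pos (M.c_pos i) (by exact_mod_cast hδ)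
  have h1 := Int.lt_floor_add_one (y i / (M.c i * δ))
  rw [div_lt_iff₀ h] at h1
  rw [gridCorner, gridIndex]
  linarith

/-- The grid is anchored at the origin, so rounding down keeps a nonnegative coordinate nonnegative.
-/
theorem gridCorner_mem {δ : ℝ≥0} {y : Fin 2 → ℝ} (hy : y ∈ solvencySet) :
    M.gridCorner δ (M.gridIndex δ y) ∈ solvencySet := by
  refine fun h => hy fun i => ?_
  by_contra! hi
  have hc : 0 ≤ M.c i * (δ : ℝ) := mul_nonneg (M.c_pos i).le δ.coe_nonneg
  refine absurd (h i) (not_lt.2 (mul_nonneg hc ?_))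
  exact_mod_cast Int.floor_nonneg.2 (div_nonneg hi hc)

/-- Ruin has not occurred up to time `T`, checked at countably many times. -/
def AliveDense (M : DegenerateRiskModel Ω P) (x : Fin 2 → ℝ) (F : PathStrategy)
    (p : ℝ≥0 × StepPath) : Prop :=
  (∃ i, F p.2 p.1 i ≤ M.pathSurplus x p.2 p.1 i) ∧
    ∀ n, denseTime n < p.1 →
      ∃ i, F p.2 (denseTime n) i ≤ M.pathSurplus x p.2 (denseTime n) i

theorem measurable_pathSurplus_eval (x : Fin 2 → ℝ) (i : Fin 2) :
    Measurable fun p : ℝ≥0 × StepPath => M.pathSurplus x p.2 p.1 i := by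
  have := StepPath.measurable_eval
  unfold pathSurplus
  fun_prop

theorem measurableSet_aliveDense (x : Fin 2 → ℝ) (F : PathStrategy) :
    MeasurableSet {p | M.AliveDense x F p} := by
  simp only [AliveDense, ofPred_and, ofPred_forall, ofPred_exists]
  refine .inter (.iUnion fun i => measurableSet_le (F.measurable_eval i)
    (measurable_pathSurplus_eval x i)) (.iInter fun n => ?_)
  have : {p : ℝ≥0 × StepPath | denseTime n < p.1 →
      ∃ i, F p.2 (denseTime n) i ≤ M.pathSurplus x p.2 (denseTime n) i} =
      {p | denseTime n < p.1}ᶜ ∪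
        ⋃ i, {p | F p.2 (denseTime n) i ≤ M.pathSurplus x p.2 (denseTime n) i} := by
    ext p
    simp only [mem_ofPred_eq, mem_union, mem_compl_iff, mem_iUnion, imp_iff_not_or]
  rw [this]
  exact .union (measurableSet_lt measurable_const measurable_fst).compl
    (.iUnion fun i => measurableSet_le ((F.measurable_apply _ i).comp measurable_snd)
      ((measurable_pathSurplus x _ i).comp measurable_snd))

theorem rule_stopAt (F : PathStrategy) (s : StepPath) {T r : ℝ≥0} (hr : r ≤ T) :
    F (s.stopAt T) r = F s r :=
  rule_congr F (T := T) (fun u hu => by rw [StepPath.stopAt_apply, min_eq_left hu]) hr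

theorem pathSurplus_stopAt (s : StepPath) {T r : ℝ≥0} (hr : r ≤ T) (i : Fin 2) :
    M.pathSurplus x (s.stopAt T) r i = M.pathSurplus x s r i :=
  pathSurplus_congr (by rw [StepPath.stopAt_apply, min_eq_left hr]) i

/-- Survival is decided by the path stopped at `τ`, so the choice of the continuation may depend on
it. -/
theorem aliveDense_past_iff {F : PathStrategy} {ω : Ω}
    (hF : M.PathAdmissible x (M.claimPath ω) (F (M.claimPath ω))) :
    M.AliveDense x F (M.past τ ω) ↔
      M.Alive x (M.claimPath ω) (F (M.claimPath ω)) ((τ ω).untopD 0) := by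
  rw [hF.alive_iff, AliveDense, past]
  simp only [rule_stopAt F _ le_rfl, pathSurplus_stopAt _ le_rfl]
  refine and_congr_right fun _ => forall_congr' fun n => forall_congr' fun hn => ?_
  simp only [rule_stopAt F _ hn.le, pathSurplus_stopAt _ hn.le]

/-- Payments before `τ` plus the discounted optimal value at `τ` exceed the optimal value by an
arbitrarily small amount only. -/
theorem lintegral_le_mul_value [IsProbabilityMeasure P] (hx : x ∈ solvencySet)
    (hτ : IsStoppingTime (M.filtration x) τ) {L : ℝ≥0 → Ω → Fin 2 → ℝ} {F : PathStrategy}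
    (hF : M.AdmissibleRule x F) (hL : ∀ᵐ ω ∂P, (fun t => L t ω) = F (M.claimPath ω))
    {δ : ℝ≥0} (hδ : 0 < δ) :
    ∫⁻ ω, (M.dividends L (min (τ ω) (M.ruinTime x L ω)) ω +
        M.discountedValue x L (min (τ ω) (M.ruinTime x L ω)) ω) ∂P ≤
      ENNReal.ofReal (Real.exp ((M.q + M.rate) * δ)) * (M.value x + δ) := by
  classical
  set A : ℝ≥0∞ := ENNReal.ofReal (Real.exp ((M.q + M.rate) * δ))
  have hA1 : 1 ≤ A := by
    rw [ENNReal.one_le_ofReal]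
    have := M.q_pos.le
    exact Real.one_le_exp (by positivity)
  have hδ0 : (δ : ℝ≥0∞) ≠ 0 := by exact_mod_cast hδ.ne'
  have hopt : ∀ y : Fin 2 → ℝ, ∃ F, M.AdmissibleRule y F ∧
      (y ∈ solvencySet → M.value y ≤ M.ruleValue F + δ) := fun y => by
    by_cases hy : y ∈ solvencySet
    · obtain ⟨F, h1, h2⟩ := exists_nearly_optimal (M := M) hy hδ0
      exact ⟨F, h1, fun _ => h2⟩
    · exact ⟨_, admissibleRule_zero y, fun h => absurd h hy⟩
  choose opt hopt_adm hopt_le using hopt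
  -- The index `none` stands for ruin by time `τ`: the zero rule follows, and its base point is
  -- arbitrary. The index `some k` selects the rule for the corner of the cell `k`.
  set y : Option (Fin 2 → ℤ) → Fin 2 → ℝ := fun k => k.elim 0 (M.gridCorner δ)
  set G : Option (Fin 2 → ℤ) → PathStrategy := fun k =>
    k.elim PathStrategy.zero fun k => opt (M.gridCorner δ k)
  have hG : ∀ k, M.AdmissibleRule (y k) (G k) := by
    rintro (_ | k)
    · exact admissibleRule_zero _
    · exact hopt_adm _
  let _ : MeasurableSpace (Option (Fin 2 → ℤ)) := ⊤
  set κ : ℝ≥0 × StepPath → Option (Fin 2 → ℤ) := fun p =>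
    if M.AliveDense x F p then some (M.gridIndex δ (M.surplusAt x F p.2 p.1)) else none
  have hκ : Measurable κ := by
    refine Measurable.ite (measurableSet_aliveDense x F) ?_ measurable_const
    have hidx : Measurable fun p : ℝ≥0 × StepPath => M.gridIndex δ (M.surplusAt x F p.2 p.1) := by
      refine measurable_pi_lambda _ fun i => ?_
      have h1 : Measurable fun p : ℝ≥0 × StepPath =>
          M.surplusAt x F p.2 p.1 i / (M.c i * δ) :=
        ((measurable_pathSurplus_eval x i).sub (F.measurable_eval i)).div_const _
      exact h1.floor
    exact (measurable_of_countable some).comp hidx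
  have hpast : ∀ ω, M.surplusAt x F (M.past τ ω).2 (M.past τ ω).1 =
      M.surplusAt x F (M.claimPath ω) ((τ ω).untopD 0) := fun ω => by
    ext i
    simp only [surplusAt, past, rule_stopAt F _ le_rfl, pathSurplus_stopAt _ le_rfl]
  have key := paste_le_value hx hτ hF hG hκ (by
    filter_upwards [admissibleRule_iff.1 hF] with ω hω _
    by_cases hal : M.AliveDense x F (M.past τ ω)
    · right
      refine ⟨(aliveDense_past_iff hω).1 hal, fun i => ?_⟩
      simp only [κ, if_pos hal, y, Option.elim, hpast]
      exact gridCorner_le hδ _ i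
    · left
      simp only [κ, if_neg hal, G, Option.elim])
  have hne := measurableSet_ne_top hτ
  set R : Ω → ℝ≥0∞ := fun ω => ENNReal.ofReal (Real.exp (-M.q * (M.past τ ω).1)) *
    M.ruleValue (G (κ (M.past τ ω)))
  calc ∫⁻ ω, (M.dividends L (min (τ ω) (M.ruinTime x L ω)) ω +
        M.discountedValue x L (min (τ ω) (M.ruinTime x L ω)) ω) ∂P
      ≤ ∫⁻ ω, (M.stoppedPayoff F τ ω +
          {ω | τ ω ≠ ⊤}.indicator (fun ω => A * (R ω + δ)) ω) ∂P := by
        -- Only monotonicity of the integral is applied to the term with `M.value`, so its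
        -- measurability is not needed.
        refine lintegral_mono_ae ?_
        filter_upwards [hL, admissibleRule_iff.1 hF] with ω h1 h2
        rw [integrand_eq hx h1 h2]
        refine add_le_add le_rfl ?_
        by_cases hω : ω ∈ {ω | τ ω ≠ ⊤}
        swap
        · rw [indicator_of_notMem hω, indicator_of_notMem hω]
        rw [indicator_of_mem hω, indicator_of_mem hω]
        split_ifs with hal
        swap
        · exact zero_le
        have hmem := surplusAt_mem_of_alive hal
        have hκω : κ (M.past τ ω) =
            some (M.gridIndex δ (M.surplusAt x F (M.claimPath ω) ((τ ω).untopD 0))) := by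
          simp only [κ, if_pos ((aliveDense_past_iff h2).2 hal), hpast]
        have h3 := value_le_mul_value (M := M) (gridCorner_mem (M := M) (δ := δ) hmem)
          (le_gridCorner_add hδ (M.surplusAt x F (M.claimPath ω) ((τ ω).untopD 0)))
        have h4 := hopt_le _ (gridCorner_mem (M := M) (δ := δ) hmem)
        have h5 : ENNReal.ofReal (Real.exp (-M.q * (M.past τ ω).1)) ≤ 1 := by
          rw [ENNReal.ofReal_le_one]
          refine Real.exp_le_one_iff.2 ?_
          have := mul_nonneg M.q_pos.le (M.past τ ω).1.coe_nonneg
          linarith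
        calc ENNReal.ofReal (Real.exp (-M.q * (M.past τ ω).1)) *
              M.value (M.surplusAt x F (M.claimPath ω) ((τ ω).untopD 0))
            ≤ ENNReal.ofReal (Real.exp (-M.q * (M.past τ ω).1)) *
              (A * (M.ruleValue (G (κ (M.past τ ω))) + δ)) := by
              gcongr
              refine h3.trans ?_
              gcongr
              rw [hκω]
              exact h4
          _ = A * (R ω + ENNReal.ofReal (Real.exp (-M.q * (M.past τ ω).1)) * δ) := by
              simp only [R]
              ring
          _ ≤ A * (R ω + δ) := by
              gcongr
              exact mul_le_of_le_one_left zero_le h5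
    _ = ∫⁻ ω, M.stoppedPayoff F τ ω ∂P + A * (∫⁻ ω in {ω | τ ω ≠ ⊤}, R ω ∂P +
          ∫⁻ _ in {ω | τ ω ≠ ⊤}, δ ∂P) := by
        rw [lintegral_add_left (measurable_stoppedPayoff hτ F), lintegral_indicator hne,
          lintegral_const_mul' _ _ ENNReal.ofReal_ne_top, lintegral_add_right _ measurable_const]
    -- Since `A ≥ 1`, the payments before `τ` may carry the factor `A` too, and `key` then bounds
    -- the sum of both integrals.
    _ ≤ A * ∫⁻ ω, M.stoppedPayoff F τ ω ∂P + A * (∫⁻ ω in {ω | τ ω ≠ ⊤}, R ω ∂P + δ) := by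
        gcongr
        · exact le_mul_of_one_le_left zero_le hA1
        · rw [setLIntegral_const]
          exact mul_le_of_le_one_right zero_le prob_le_one
    _ = A * (∫⁻ ω, M.stoppedPayoff F τ ω ∂P + ∫⁻ ω in {ω | τ ω ≠ ⊤}, R ω ∂P + δ) := by ring
    _ ≤ A * (M.value x + δ) := by gcongr

end DegenerateRiskModel

end

/-! ### The dynamic programming principle -/

theorem mainTheorem6 {Ω : Type*} [MeasurableSpace Ω] (P : Measure Ω) [IsProbabilityMeasure P]
    (M : DegenerateRiskModel Ω P) (x : Fin 2 → ℝ) (hx : x ∈ solvencySet)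
    (τ : Ω → WithTop ℝ≥0) (hτ : IsStoppingTime (M.filtration x) τ) :
    M.value x ≠ ⊤ ∧
    M.value x = ⨆ (L) (_ : M.IsAdmissible x L),
      ∫⁻ ω, (M.dividends L (min (τ ω) (M.ruinTime x L ω)) ω +
        M.discountedValue x L (min (τ ω) (M.ruinTime x L ω)) ω) ∂P := by
  refine ⟨(M.value_lt_top x).ne, le_antisymm ?_ ?_⟩
  · refine DegenerateRiskModel.value_le hx fun F hF => ?_
    have hadm : M.IsAdmissible x fun t ω => F (M.claimPath ω) t :=
      .of_path (fun ω i => F.isDividendPath _ i)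
        (DegenerateRiskModel.measurable_rule_claimPath F x)
        (DegenerateRiskModel.admissibleRule_iff.1 hF)
    exact (DegenerateRiskModel.ruleValue_le_lintegral hx hτ hF (ae_of_all _ fun _ => rfl)).trans
      (le_iSup₂_of_le _ hadm le_rfl)
  · refine iSup₂_le fun L hL => ?_
    obtain ⟨F, hF, hLF⟩ := hL.exists_rule hx
    have hδ : Tendsto (fun n : ℕ => 1 / ((n : ℝ≥0) + 1)) atTop (𝓝 0) :=
      tendsto_one_div_add_atTop_nhds_zero_nat
    -- As the mesh `δ` tends to `0`, the bound of `lintegral_le_mul_value` tends to the value.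
    have hlim : Tendsto (fun δ : ℝ≥0 => ENNReal.ofReal (Real.exp ((M.q + M.rate) * δ)) *
        (M.value x + δ)) (𝓝 0) (𝓝 (1 * (M.value x + 0))) := by
      refine ENNReal.Tendsto.mul ?_ (Or.inl one_ne_zero) ?_ (Or.inr ENNReal.one_ne_top)
      · have h1 : ContinuousAt (fun δ : ℝ≥0 =>
            ENNReal.ofReal (Real.exp ((M.q + M.rate) * δ))) 0 :=
          (ENNReal.continuous_ofReal.comp (by fun_prop)).continuousAt
        have h2 := h1.tendsto
        simpa using h2
      · refine tendsto_const_nhds.add ?_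
        simpa using ENNReal.continuous_coe.tendsto (0 : ℝ≥0)
    rw [one_mul, add_zero] at hlim
    exact ge_of_tendsto' (hlim.comp hδ) fun n =>
      DegenerateRiskModel.lintegral_le_mul_value hx hτ hF hLF (by positivity)
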